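/- Let $n\ge 2$ and write $x=(x',x_n)\in\mathbb{R}^{n-1}\times\mathbb{R}$. Put $w_{\alpha,\beta}(x)=|x'|^{-\alpha}|x_n|^{-\beta}$. Let $\psi:\mathbb{R}\to[0,\infty)$ be a smooth function supported in $[\frac14,1]$ with $\sum_{\gamma\in\mathbb{Z}}\psi(2^\gamma s)=1$ for all $s>0$. For $0<\delta<1$ let $\mu_\delta$ be a smooth function on $\mathbb{R}^{n-1}$ with $$\operatorname{supp}\mu_\delta\subset\{\xi':1-\delta\le|\xi'|\le1\},\qquad |\partial^l\mu_\delta(\xi')|\le C_l\,\delta^{-|l|}\quad\text{for all multi-indices } l,$$ where the constants $C_l$ do not depend on $\delta$. Put $m_\delta(\xi',\xi_n)=\mu_\delta(\xi'/\xi_n)\,\psi(\xi_n/2)$ and $$G_0(f)(x)=\Big(\int_1^2\Big|\big[m_\delta(t^{-1}\xi',\xi_n)\widehat f(\xi)\big]^\vee(x)\Big|^2\frac{dt}{t}\Big)^{1/2},\qquad \widehat f(\xi)=\int_{\mathbb{R}^n} f(x)e^{-2\pi i x\cdot\xi}\,dx.$$ For general $f\in L^2(w_{\alpha,\beta})$,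 $[m_\delta(t^{-1}\xi',\xi_n)\widehat f(\xi)]^\vee$ is understood as the convolution of $f$ with the inverse Fourier transform of $\xi\mapsto m_\delta(t^{-1}\xi',\xi_n)$. There is $\delta_0\in(0,1)$ such that the following holds. Let $\alpha\in[0,n-1)$ and $\beta\in[0,1)$. Then there is a constant $C$, depending only on $n,\alpha,\beta,\psi$ and the constants $(C_l)_l$, such that for all $0<\delta<\delta_0$, all $\mu_\delta$ as above and all $f\in L^2(w_{\alpha,\beta})$, the convolutions defining $G_0(f)$ converge absolutely at every point and $$\|G_0(f)\|_{L^2(w_{\alpha,\beta})}\le C\,A_\delta(\alpha,\beta)\,\|f\|_{L^2(w_{\alpha,\beta})},$$ where $$A_\delta(\alpha,\beta)=\begin{cases}\delta^{1/2},&\alpha+\beta<1,\\ \delta^{1/2}(\log\frac1\delta)^{1/2},&\alpha+\beta=1,\\ \delta^{(2-\alpha-\beta)/2},&\alpha+\beta>1.\end{cases}$$ -/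

import Mathlib

open MeasureTheory
open scoped FourierTransform ENNReal ContDiff

noncomputable section

/-- `ℝᵏ` with the Euclidean norm. The ambient space `ℝⁿ = ℝⁿ⁻¹ × ℝ` is `Euc (d + 1)`,
with `n = d + 1`. -/
abbrev Euc (k : ℕ) : Type := EuclideanSpace ℝ (Fin k)

/-- The component `x'` of `x = (x', x_n)`. -/
def headPart {d : ℕ} (x : Euc (d + 1)) : Euc d := WithLp.toLp 2 (fun i => x i.castSucc)

/-- The last coordinate `x_n` of `x = (x', x_n)`. -/
def lastPart {d : ℕ} (x : Euc (d + 1)) : ℝ := x (Fin.last d)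

/-- The weight `w_{α,β}(x) = |x'|^{-α} |x_n|^{-β}`. -/
def coneWeight {d : ℕ} (α β : ℝ) (x : Euc (d + 1)) : ℝ :=
  ‖headPart x‖ ^ (-α) * |lastPart x| ^ (-β)

/-- The measure `w_{α,β}(x) dx` on `ℝⁿ`. -/
def coneWeightMeasure (d : ℕ) (α β : ℝ) : Measure (Euc (d + 1)) :=
  (volume : Measure (Euc (d + 1))).withDensity fun x => ENNReal.ofReal (coneWeight α β x)

/-- A nonnegative smooth function supported in `[1/4, 1]` whose dyadic dilates sum to one
on the positive half line. -/
structure IsDyadicBump (ψ : ℝ → ℝ) : Prop where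
  smooth : ContDiff ℝ ∞ ψ
  nonneg : ∀ s, 0 ≤ ψ s
  supp : tsupport ψ ⊆ Set.Icc (1 / 4) 1
  hasSum : ∀ s : ℝ, 0 < s → HasSum (fun γ : ℤ => ψ ((2 : ℝ) ^ γ * s)) 1

/-- A smooth function on `ℝⁿ⁻¹`, supported in `{1 - δ ≤ |η| ≤ 1}`, all of whose derivatives
of order `k` are bounded by `B k * δ ^ (-k)`. -/
structure IsAnnularCutoff {d : ℕ} (δ : ℝ) (B : ℕ → ℝ) (μ : Euc d → ℂ) : Prop where
  smooth : ContDiff ℝ ∞ μ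
  supp : tsupport μ ⊆ {η | ‖η‖ ∈ Set.Icc (1 - δ) 1}
  bound : ∀ (k : ℕ) (η : Euc d), ‖iteratedFDeriv ℝ k μ η‖ ≤ B k * (δ ^ k)⁻¹

/-- The multiplier `m(ξ', ξ_n) = μ(ξ' / ξ_n) ψ(ξ_n / 2)`. -/
def coneMultiplier {d : ℕ} (μ : Euc d → ℂ) (ψ : ℝ → ℝ) (η : Euc d) (s : ℝ) : ℂ :=
  μ (s⁻¹ • η) * (ψ (2⁻¹ * s) : ℂ)

/-- The dilated multiplier `ξ ↦ m(t⁻¹ ξ', ξ_n)`. -/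
def coneMultiplierDil {d : ℕ} (μ : Euc d → ℂ) (ψ : ℝ → ℝ) (t : ℝ) (ξ : Euc (d + 1)) : ℂ :=
  coneMultiplier μ ψ (t⁻¹ • headPart ξ) (lastPart ξ)

/-- The convolution kernel: the inverse Fourier transform of `ξ ↦ m(t⁻¹ ξ', ξ_n)`. -/
def coneKernel {d : ℕ} (μ : Euc d → ℂ) (ψ : ℝ → ℝ) (t : ℝ) : Euc (d + 1) → ℂ :=
  𝓕⁻ (coneMultiplierDil μ ψ t)

/-- The multiplier operator `f ↦ (m(t⁻¹ ξ', ξ_n) f̂(ξ))^∨`, for functions `f` that need not have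
a pointwise defined Fourier transform: the inverse Fourier transform of the product of `f̂` with
the smooth compactly supported multiplier is the convolution of `f` with the kernel. -/
def coneOp {d : ℕ} (μ : Euc d → ℂ) (ψ : ℝ → ℝ) (t : ℝ) (f : Euc (d + 1) → ℂ)
    (x : Euc (d + 1)) : ℂ :=
  ∫ y, coneKernel μ ψ t (x - y) * f y

/-- For integrable `f` the operator is given by the literal multiplier formula. -/
theorem coneOp_eq_fourierInv {d : ℕ} (μ : Euc d → ℂ) (ψ : ℝ → ℝ) (t : ℝ)
    (f : Euc (d + 1) → ℂ) (hf : Integrable f) (hm : Integrable (coneMultiplierDil μ ψ t))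
    (x : Euc (d + 1)) :
    coneOp μ ψ t f x = 𝓕⁻ (fun ξ => coneMultiplierDil μ ψ t ξ * 𝓕 f ξ) x := by
  have hg : Integrable (fun ξ => Real.fourierChar (inner ℝ ξ x) • coneMultiplierDil μ ψ t ξ) := by
    have := (Real.fourierIntegral_convergent_iff (μ := volume) (-x)).2 hm
    simpa using this
  have key := VectorFourier.integral_fourierIntegral_smul_eq_flip
    (μ := (volume : Measure (Euc (d + 1)))) (ν := (volume : Measure (Euc (d + 1))))
    (L := innerₗ (Euc (d + 1))) (f := f) Real.continuous_fourierChar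
    (by simpa using continuous_inner) hf hg
  have h1 : ∀ y, VectorFourier.fourierIntegral Real.fourierChar volume
      (innerₗ (Euc (d + 1))).flip
      (fun ξ => Real.fourierChar (inner ℝ ξ x) • coneMultiplierDil μ ψ t ξ) y =
      coneKernel μ ψ t (x - y) := by
    intro y
    rw [coneKernel, Real.fourierInv_eq]
    unfold VectorFourier.fourierIntegral
    refine integral_congr_ae (Filter.Eventually.of_forall fun ξ => ?_)
    simp only [LinearMap.flip_apply, innerₗ_apply_apply]
    rw [smul_smul, ← AddChar.map_add_eq_mul, inner_sub_right, real_inner_comm ξ y]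
    congr 2
    ring
  rw [coneOp, Real.fourierInv_eq]
  simp only [h1, smul_eq_mul] at key
  calc ∫ y, coneKernel μ ψ t (x - y) * f y = ∫ y, f y * coneKernel μ ψ t (x - y) := by
        simp only [mul_comm]
    _ = _ := key.symm
    _ = _ := by
        refine integral_congr_ae (Filter.Eventually.of_forall fun ξ => ?_)
        simp only [Circle.smul_def, smul_eq_mul]
        change 𝓕 f ξ * _ = _
        ring

/-- The local square function
`G₀ f(x) = (∫_1^2 |(m(t⁻¹ ξ', ξ_n) f̂(ξ))^∨(x)|² dt/t)^{1/2}`, with values in `[0, ∞]`. -/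
def localSquareFn {d : ℕ} (μ : Euc d → ℂ) (ψ : ℝ → ℝ) (f : Euc (d + 1) → ℂ)
    (x : Euc (d + 1)) : ℝ≥0∞ :=
  (∫⁻ t in Set.Icc (1 : ℝ) 2, ‖coneOp μ ψ t f x‖ₑ ^ 2 / ENNReal.ofReal t) ^ (1 / 2 : ℝ)

/-- The factor `A_δ(α, β)`. -/
def coneFactor (δ α β : ℝ) : ℝ :=
  if α + β < 1 then δ ^ (1 / 2 : ℝ)
  else if α + β = 1 then δ ^ (1 / 2 : ℝ) * Real.log (1 / δ) ^ (1 / 2 : ℝ)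
  else δ ^ ((2 - α - β) / 2)

end

/-! The weight is decomposed into Gaussians, and each Gaussian is handled on the frequency side. For
a Gaussian weight `γ`, the integral of `γ |F⁻¹h|²` is at most the double integral of `|h(ξ)| |h(η)|
|γ̂(ξ - η)|`, and `|γ̂|` is again a product Gaussian of mass one, with widths `(r, …, r, s)`,
wherever `γ` is centred. When `h` lives on the shell `(1 - δ) t ξ_n ≤ |ξ'| ≤ t ξ_n`, Schur's test
bounds the form by the largest mass that the Gaussian puts on the shell. The shell has thickness
`O(δ)` both in the direction of `ξ_n` and, near any of its points, in some coordinate direction of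
`ξ'`; slicing in either way gives mass `O(δ · capBound d r s)`. Integrating in `t` gains a second
`δ`, because a fixed `ξ` lies in the shell only for a set of `t` of measure `O(δ)`. The outcome is
`lintegral_gaussWeight_coneShell_multiplier_le`, with constant `δ² capBound d r s`.

On a box of side comparable to `1/δ` the weight is at most its typical size (`boxWeight`) times a
sum over `(j, k)` of `2^(αj) 2^(βk)` times Gaussians of frequency widths `r = δ 2^j`, `s = δ 2^k`
(`exists_coneWeight_le`). Summing the Schur bounds leaves essentially `δ ∑ 2^((α+β-1)j)` over `2^j ≤
1/δ`, which is the square of `A_δ`; the three regimes are those of a geometric sum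
(`exists_sum_capBound_le`).

To pass from one box to the whole space, write `f = P(δ(y - c)) g` with a polynomial `P`. For `x` in
the box around `c`, expanding `P(δ(y - c))` in powers of `δ(x_i - y_i)` has bounded coefficients,
and the kernel `(δ z_i)^k K_t(z)` belongs to the multiplier `δ^k ∂_i^k m`, which is bounded
uniformly in `δ` and supported in the same shell. So the box estimate holds with `g = f / P(δ(· -
c))` on the right (`exists_lintegral_box_le`). Integrating over all centres `c` recovers the full
weighted norms, since `boxWeight` at `c` is at most the weight at `y` times `(1 + δ|y - c|)^(α+β)`,
and `P⁻²` makes this loss integrable. -/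

/-! ### Gaussian weights on the Fourier side and Schur's test -/

section GaussianPairing

/-- A weighted `L²` norm of a Fourier transform is controlled by the quadratic form with kernel the
Fourier transform of the weight. -/
theorem lintegral_weight_mul_fourier_sq_le {m : ℕ} {γ : Euc m → ℝ} (hγ0 : ∀ x, 0 ≤ γ x)
    (hγ : Integrable γ) {h : Euc m → ℂ} (hh : Integrable h) :
    ∫⁻ x, ENNReal.ofReal (γ x) * ‖𝓕 h x‖ₑ ^ 2 ≤
      ∫⁻ ξ, ‖h ξ‖ₑ * ∫⁻ η, ‖h η‖ₑ * ‖𝓕 (fun x => (γ x : ℂ)) (η - ξ)‖ₑ := by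
  have hcont : Continuous (𝓕 h) := VectorFourier.fourierIntegral_continuous
    Real.continuous_fourierChar (by simpa using continuous_inner) hh
  have hbd : ∀ x, ‖𝓕 h x‖ ≤ ∫ y, ‖h y‖ := fun x =>
    VectorFourier.norm_fourierIntegral_le_integral_norm _ _ _ _ _
  have hγc : Integrable (fun x => (γ x : ℂ)) := hγ.ofReal
  have hG : Integrable (fun x => (γ x : ℂ) * 𝓕 h x) :=
    hγc.mul_bdd hcont.aestronglyMeasurable (Filter.Eventually.of_forall hbd)
  have hsq : Integrable (fun x => γ x * ‖𝓕 h x‖ ^ 2) := by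
    refine hγ.mul_bdd (c := (∫ y, ‖h y‖) ^ 2) (hcont.norm.pow 2).aestronglyMeasurable
      (Filter.Eventually.of_forall fun x => ?_)
    rw [norm_pow, norm_norm]
    exact pow_le_pow_left₀ (norm_nonneg _) (hbd x) 2
  -- The form `⟨ĥ, γ ĥ⟩` equals `⟨h, F⁻¹(γ ĥ)⟩`. A second use of duality, in `key2`, moves the
  -- remaining transform off `h` and onto the modulated weight, giving `γ̂(η - ξ)`.
  have key := VectorFourier.integral_sesq_fourierIntegral_eq_neg_flip
    (μ := (volume : Measure (Euc m))) (ν := (volume : Measure (Euc m)))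
    (L := innerₗ (Euc m)) (innerSL ℂ : ℂ →L⋆[ℂ] ℂ →L[ℂ] ℂ) Real.continuous_fourierChar
    (by simpa using continuous_inner) hh hG
  have hlhs : ∫⁻ x, ENNReal.ofReal (γ x) * ‖𝓕 h x‖ₑ ^ 2 =
      ‖∫ x, (innerSL ℂ : ℂ →L⋆[ℂ] ℂ →L[ℂ] ℂ) (VectorFourier.fourierIntegral Real.fourierChar
        volume (innerₗ (Euc m)) h x) ((γ x : ℂ) * 𝓕 h x)‖ₑ := by
    have h1 : ∀ x, (innerSL ℂ : ℂ →L⋆[ℂ] ℂ →L[ℂ] ℂ) (VectorFourier.fourierIntegral Real.fourierChar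
        volume (innerₗ (Euc m)) h x) ((γ x : ℂ) * 𝓕 h x) = ((γ x * ‖𝓕 h x‖ ^ 2 : ℝ) : ℂ) := by
      intro x
      change inner ℂ (𝓕 h x) _ = _
      rw [RCLike.inner_apply, mul_assoc, Complex.mul_conj, Complex.normSq_eq_norm_sq]
      push_cast
      ring
    simp_rw [h1]
    rw [integral_complex_ofReal, ← ofReal_norm, Complex.norm_real, Real.norm_of_nonneg
      (integral_nonneg fun x => mul_nonneg (hγ0 x) (sq_nonneg _)),
      ofReal_integral_eq_lintegral_ofReal hsq
      (Filter.Eventually.of_forall fun x => mul_nonneg (hγ0 x) (sq_nonneg _))]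
    refine lintegral_congr fun x => ?_
    rw [ENNReal.ofReal_mul (hγ0 x), ENNReal.ofReal_pow (norm_nonneg _), ofReal_norm]
  rw [hlhs, key]
  refine (enorm_integral_le_lintegral_enorm _).trans (lintegral_mono fun ξ => ?_)
  change ‖inner ℂ (h ξ) _‖ₑ ≤ _
  rw [RCLike.inner_apply, enorm_mul, mul_comm, RCLike.enorm_conj]
  gcongr
  have hγξ : Integrable (fun x => (Real.fourierChar (inner ℝ x ξ) : ℂ) * (γ x : ℂ)) := by
    have := (Real.fourierIntegral_convergent_iff (μ := volume) (-ξ)).2 hγc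
    simpa [Circle.smul_def] using this
  have key2 := VectorFourier.integral_fourierIntegral_smul_eq_flip
    (μ := (volume : Measure (Euc m))) (ν := (volume : Measure (Euc m)))
    (L := innerₗ (Euc m)) Real.continuous_fourierChar
    (by simpa using continuous_inner) hh hγξ
  have h2 : VectorFourier.fourierIntegral Real.fourierChar volume (-(innerₗ (Euc m)).flip)
      (fun x => (γ x : ℂ) * 𝓕 h x) ξ = ∫ x, h x • VectorFourier.fourierIntegral Real.fourierChar
        volume (innerₗ (Euc m)).flip
        (fun x => (Real.fourierChar (inner ℝ x ξ) : ℂ) * (γ x : ℂ)) x := by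
    rw [← key2]
    unfold VectorFourier.fourierIntegral
    refine integral_congr_ae (Filter.Eventually.of_forall fun x => ?_)
    simp only [LinearMap.neg_apply, neg_neg, LinearMap.flip_apply, innerₗ_apply_apply,
      Circle.smul_def, smul_eq_mul]
    rw [real_inner_comm]
    change _ * (_ * 𝓕 h x) = 𝓕 h x * _
    ring
  rw [h2]
  refine (enorm_integral_le_lintegral_enorm _).trans (lintegral_mono fun η => ?_)
  rw [enorm_smul]
  gcongr
  apply le_of_eq
  congr 1
  rw [Real.fourier_eq]
  unfold VectorFourier.fourierIntegral
  refine integral_congr_ae (Filter.Eventually.of_forall fun x => ?_)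
  simp only [LinearMap.flip_apply, innerₗ_apply_apply, Circle.smul_def, smul_eq_mul]
  rw [← mul_assoc, ← Circle.coe_mul, ← AddChar.map_add_eq_mul, inner_sub_right, real_inner_comm η x]
  congr 3
  ring

/-- The one-dimensional Gaussian of mass one and width `b`. -/
noncomputable def gaussKer (b u : ℝ) : ℝ := b⁻¹ * Real.exp (-Real.pi * (u / b) ^ 2)

/-- The anisotropic Gaussian weight centred at `a`. -/
noncomputable def gaussWeight {m : ℕ} (b : Fin m → ℝ) (a x : Euc m) : ℝ :=
  Real.exp (-Real.pi * ∑ i, (b i * (x i - a i)) ^ 2)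

theorem gaussKer_nonneg {b : ℝ} (hb : 0 < b) (u : ℝ) : 0 ≤ gaussKer b u := by
  unfold gaussKer; positivity

theorem gaussKer_le {b : ℝ} (hb : 0 < b) (u : ℝ) : gaussKer b u ≤ b⁻¹ := by
  unfold gaussKer
  refine mul_le_of_le_one_right (by positivity) (Real.exp_le_one_iff.2 ?_)
  nlinarith [Real.pi_pos, sq_nonneg (u / b)]

theorem gaussKer_neg (b u : ℝ) : gaussKer b (-u) = gaussKer b u := by
  unfold gaussKer; ring_nf

@[fun_prop]
theorem continuous_gaussKer (b : ℝ) : Continuous (gaussKer b) := by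
  unfold gaussKer; fun_prop

theorem gaussKer_eq {b : ℝ} (u : ℝ) :
    gaussKer b u = b⁻¹ * Real.exp (-(Real.pi / b ^ 2) * u ^ 2) := by
  unfold gaussKer; congr 2; ring

theorem lintegral_gaussKer {b : ℝ} (hb : 0 < b) (a : ℝ) :
    ∫⁻ u, ENNReal.ofReal (gaussKer b (a - u)) = 1 := by
  rw [lintegral_sub_left_eq_self (fun u => ENNReal.ofReal (gaussKer b u)) a,
    ← ofReal_integral_eq_lintegral_ofReal]
  · simp_rw [gaussKer_eq]
    rw [integral_const_mul, integral_gaussian, div_div_cancel₀ Real.pi_ne_zero,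
      Real.sqrt_sq hb.le, inv_mul_cancel₀ hb.ne', ENNReal.ofReal_one]
  · simp_rw [funext fun u => gaussKer_eq (b := b) u]
    exact (integrable_exp_neg_mul_sq (by positivity)).const_mul _
  · exact Filter.Eventually.of_forall fun u => gaussKer_nonneg hb u

theorem gaussWeight_nonneg {m : ℕ} (b : Fin m → ℝ) (a x : Euc m) : 0 ≤ gaussWeight b a x :=
  (Real.exp_pos _).le

theorem gaussWeight_eq_prod {m : ℕ} (b : Fin m → ℝ) (a x : Euc m) :
    gaussWeight b a x = ∏ i, Real.exp (-(Real.pi * b i ^ 2) * (x i - a i) ^ 2) := by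
  rw [gaussWeight, ← Real.exp_sum, Finset.mul_sum]
  congr 1
  exact Finset.sum_congr rfl fun i _ => by ring

theorem continuous_gaussWeight {m : ℕ} (b : Fin m → ℝ) (a : Euc m) :
    Continuous (gaussWeight b a) := by
  unfold gaussWeight; fun_prop

theorem integrable_gaussWeight {m : ℕ} {b : Fin m → ℝ} (hb : ∀ i, 0 < b i) (a : Euc m) :
    Integrable (gaussWeight b a) := by
  rw [← (PiLp.volume_preserving_toLp (Fin m)).integrable_comp_emb
    (MeasurableEquiv.toLp 2 _).measurableEmbedding]
  simp_rw [Function.comp_def, gaussWeight_eq_prod]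
  refine Integrable.fintype_prod (f := fun i (u : ℝ) =>
    Real.exp (-(Real.pi * b i ^ 2) * (u - a i) ^ 2)) fun i => ?_
  have := hb i
  exact (integrable_exp_neg_mul_sq (b := Real.pi * b i ^ 2)
    (by positivity)).comp_sub_right (a i)

/-- Translating the Gaussian only multiplies its transform by a phase, so the modulus does not see
`a`; all later bounds are therefore uniform in the centre. -/
theorem norm_fourier_gaussWeight {m : ℕ} {b : Fin m → ℝ} (hb : ∀ i, 0 < b i) (a w : Euc m) :
    ‖𝓕 (fun x => (gaussWeight b a x : ℂ)) w‖ = ∏ i, gaussKer (b i) (w i) := by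
  have h0 : (fun x => (gaussWeight b a x : ℂ)) =
      (fun x => (gaussWeight b 0 x : ℂ)) ∘ (fun x => x + (-a)) := by
    ext x; simp [gaussWeight, sub_eq_add_neg]
  have h1 := congrFun (VectorFourier.fourierIntegral_comp_add_right Real.fourierChar
    (volume : Measure (Euc m)) (innerₗ (Euc m)) (fun x => (gaussWeight b 0 x : ℂ)) (-a)) w
  have h2 : ‖𝓕 (fun x => (gaussWeight b a x : ℂ)) w‖ =
      ‖𝓕 (fun x => (gaussWeight b 0 x : ℂ)) w‖ := by
    rw [h0]
    change ‖VectorFourier.fourierIntegral Real.fourierChar volume (innerₗ (Euc m)) _ w‖ = _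
    rw [h1, Circle.norm_smul]
    rfl
  rw [h2, Real.fourier_eq', ← (PiLp.volume_preserving_toLp (Fin m)).integral_comp
    (MeasurableEquiv.toLp 2 _).measurableEmbedding]
  have h3 := GaussianFourier.integral_cexp_neg_sum_mul_add (ι := Fin m)
    (b := fun i => ((Real.pi * b i ^ 2 : ℝ) : ℂ)) (fun i => by
      have := hb i; rw [Complex.ofReal_re]; positivity)
    (fun i => -2 * Real.pi * Complex.I * w i)
  have h4 : ∀ v : Fin m → ℝ, Complex.exp (((-2 * Real.pi * inner ℝ (WithLp.toLp 2 v) w : ℝ) : ℂ)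
      * Complex.I) • (gaussWeight b 0 (WithLp.toLp 2 v) : ℂ) =
      Complex.exp (-∑ i, ((Real.pi * b i ^ 2 : ℝ) : ℂ) * (v i : ℂ) ^ 2 +
        ∑ i, (-2 * Real.pi * Complex.I * w i) * v i) := by
    intro v
    rw [gaussWeight, Complex.ofReal_exp, smul_eq_mul, ← Complex.exp_add, add_comm]
    congr 1
    simp only [PiLp.inner_apply, RCLike.inner_apply, conj_trivial]
    push_cast
    simp only [Finset.mul_sum, Finset.sum_mul, ← Finset.sum_neg_distrib]
    congr 1
    · refine Finset.sum_congr rfl fun i _ => ?_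
      simp; ring
    · refine Finset.sum_congr rfl fun i _ => ?_
      ring
  simp_rw [h4, h3]
  rw [norm_prod]
  refine Finset.prod_congr rfl fun i _ => ?_
  have hbi := hb i
  rw [norm_mul, Complex.norm_exp]
  have e1 : (Real.pi : ℂ) / ((Real.pi * b i ^ 2 : ℝ) : ℂ) = (((b i)⁻¹ ^ 2 : ℝ) : ℂ) := by
    push_cast
    have : (Real.pi : ℂ) ≠ 0 := by exact_mod_cast Real.pi_ne_zero
    have : (b i : ℂ) ≠ 0 := by exact_mod_cast hbi.ne'
    field_simp
  have e2 : (-2 * (Real.pi : ℂ) * Complex.I * w i) ^ 2 / (4 * ((Real.pi * b i ^ 2 : ℝ) : ℂ)) =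
      ((-Real.pi * (w i / b i) ^ 2 : ℝ) : ℂ) := by
    have : (Real.pi : ℂ) ≠ 0 := by exact_mod_cast Real.pi_ne_zero
    have : (b i : ℂ) ≠ 0 := by exact_mod_cast hbi.ne'
    push_cast
    rw [mul_pow, mul_pow, Complex.I_sq]
    field_simp
    ring
  rw [e1, e2, Complex.ofReal_re, gaussKer]
  congr 1
  have : (1 / 2 : ℂ) = ((1 / 2 : ℝ) : ℂ) := by push_cast; rfl
  rw [this, ← Complex.ofReal_cpow (by positivity), Complex.norm_real, ← Real.sqrt_eq_rpow,
    Real.sqrt_sq (by positivity), Real.norm_of_nonneg (by positivity)]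

/-- The product Gaussian kernel. -/
noncomputable def gaussProd {m : ℕ} (b : Fin m → ℝ) (w : Euc m) : ℝ≥0∞ :=
  ∏ i, ENNReal.ofReal (gaussKer (b i) (w i))

theorem gaussProd_neg {m : ℕ} (b : Fin m → ℝ) (w : Euc m) : gaussProd b (-w) = gaussProd b w := by
  simp [gaussProd, gaussKer_neg]

@[fun_prop]
theorem measurable_gaussProd {m : ℕ} (b : Fin m → ℝ) : Measurable (gaussProd b) := by
  unfold gaussProd
  refine Finset.measurable_fun_prod _ fun i _ => ?_
  have := (continuous_gaussKer (b i)).measurable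
  fun_prop

theorem lintegral_gaussWeight_mul_fourier_sq_le {m : ℕ} {b : Fin m → ℝ} (hb : ∀ i, 0 < b i)
    (a : Euc m) {h : Euc m → ℂ} (hh : Integrable h) :
    ∫⁻ x, ENNReal.ofReal (gaussWeight b a x) * ‖𝓕 h x‖ₑ ^ 2 ≤
      ∫⁻ ξ, ‖h ξ‖ₑ * ∫⁻ η, ‖h η‖ₑ * gaussProd b (ξ - η) := by
  refine (lintegral_weight_mul_fourier_sq_le (gaussWeight_nonneg b a)
    (integrable_gaussWeight hb a) hh).trans (le_of_eq ?_)
  refine lintegral_congr fun ξ => ?_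
  congr 1
  refine lintegral_congr fun η => ?_
  congr 1
  rw [← gaussProd_neg, neg_sub, ← ofReal_norm, norm_fourier_gaussWeight hb,
    ENNReal.ofReal_prod_of_nonneg fun i _ => gaussKer_nonneg (hb i) _]
  rfl

theorem lintegral_gaussWeight_mul_fourierInv_sq_le {m : ℕ} {b : Fin m → ℝ} (hb : ∀ i, 0 < b i)
    (a : Euc m) {h : Euc m → ℂ} (hh : Integrable h) :
    ∫⁻ x, ENNReal.ofReal (gaussWeight b a x) * ‖𝓕⁻ h x‖ₑ ^ 2 ≤
      ∫⁻ ξ, ‖h ξ‖ₑ * ∫⁻ η, ‖h η‖ₑ * gaussProd b (ξ - η) := by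
  refine le_trans (le_of_eq ?_) (lintegral_gaussWeight_mul_fourier_sq_le hb (-a) hh)
  rw [← lintegral_neg_eq_self]
  refine lintegral_congr fun x => ?_
  rw [Real.fourierInv_eq_fourier_neg, neg_neg]
  have : gaussWeight b a (-x) = gaussWeight b (-a) x := by
    unfold gaussWeight
    congr 2
    refine Finset.sum_congr rfl fun i _ => ?_
    simp only [PiLp.neg_apply]
    ring
  rw [this]

/-- Schur's test for a symmetric kernel and a function supported in `S`. -/
theorem lintegral_quadratic_form_le {m : ℕ} {h : Euc m → ℂ} (hh : AEMeasurable h)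
    {k : Euc m → ℝ≥0∞} (hk : Measurable k) (hsymm : ∀ w, k (-w) = k w) {S : Set (Euc m)}
    (hS : MeasurableSet S) (hsupp : ∀ ξ, ξ ∉ S → h ξ = 0) {Q : ℝ≥0∞}
    (hQ : ∀ ξ, ∫⁻ η in S, k (ξ - η) ≤ Q) :
    ∫⁻ ξ, ‖h ξ‖ₑ * ∫⁻ η, ‖h η‖ₑ * k (ξ - η) ≤ Q * ∫⁻ ξ, ‖h ξ‖ₑ ^ 2 := by
  classical
  have hhe : AEMeasurable (fun ξ => ‖h ξ‖ₑ) := hh.enorm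
  -- The product `χ ξ * χ η` can be inserted freely because `h` vanishes off `S`. After
  -- `2|h(ξ)||h(η)| ≤ |h(ξ)|² + |h(η)|²` one indicator survives in each term and restricts the
  -- kernel integral to `S`.
  set χ : Euc m → ℝ≥0∞ := S.indicator 1 with hχ
  have hχm : Measurable χ := measurable_one.indicator hS
  have hχh : ∀ ξ, χ ξ * ‖h ξ‖ₑ = ‖h ξ‖ₑ := by
    intro ξ
    by_cases hξ : ξ ∈ S
    · simp [hχ, hξ]
    · simp [hχ, hξ, hsupp ξ hξ]
  have hprod : AEMeasurable (fun p : Euc m × Euc m => ‖h p.1‖ₑ ^ 2 * χ p.2 * k (p.1 - p.2))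
      (volume.prod volume) :=
    (((hhe.comp_quasiMeasurePreserving Measure.quasiMeasurePreserving_fst).pow_const 2).mul
      (hχm.comp measurable_snd).aemeasurable).mul
      (hk.comp (measurable_fst.sub measurable_snd)).aemeasurable
  have hprod2 : AEMeasurable (fun p : Euc m × Euc m => ‖h p.2‖ₑ ^ 2 * χ p.1 * k (p.1 - p.2))
      (volume.prod volume) :=
    (((hhe.comp_quasiMeasurePreserving Measure.quasiMeasurePreserving_snd).pow_const 2).mul
      (hχm.comp measurable_fst).aemeasurable).mul
      (hk.comp (measurable_fst.sub measurable_snd)).aemeasurable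
  have hbound : ∀ ξ, ∫⁻ η, ‖h ξ‖ₑ ^ 2 * χ η * k (ξ - η) ≤ Q * ‖h ξ‖ₑ ^ 2 := by
    intro ξ
    have : ∀ η, ‖h ξ‖ₑ ^ 2 * χ η * k (ξ - η) = ‖h ξ‖ₑ ^ 2 * S.indicator (fun η => k (ξ - η)) η := by
      intro η
      by_cases hη : η ∈ S <;> simp [hχ, hη]
    simp_rw [this]
    rw [lintegral_const_mul' _ _ (by simp),
      lintegral_indicator hS, mul_comm]
    gcongr
    exact hQ ξ
  have hpt : ∀ ξ η, 2 * (‖h ξ‖ₑ * (‖h η‖ₑ * k (ξ - η))) ≤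
      ‖h ξ‖ₑ ^ 2 * χ η * k (ξ - η) + ‖h η‖ₑ ^ 2 * χ ξ * k (ξ - η) := by
    intro ξ η
    have h2 : 2 * (‖h ξ‖ₑ * ‖h η‖ₑ) ≤ ‖h ξ‖ₑ ^ 2 + ‖h η‖ₑ ^ 2 := by
      have : 2 * (‖h ξ‖₊ * ‖h η‖₊) ≤ ‖h ξ‖₊ ^ 2 + ‖h η‖₊ ^ 2 := by
        have := two_mul_le_add_sq (‖h ξ‖₊) (‖h η‖₊)
        rwa [mul_assoc] at this
      simp only [enorm_eq_nnnorm]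
      exact_mod_cast this
    calc 2 * (‖h ξ‖ₑ * (‖h η‖ₑ * k (ξ - η)))
        = (2 * (‖h ξ‖ₑ * ‖h η‖ₑ)) * (χ ξ * χ η) * k (ξ - η) := by
          conv_lhs => rw [← hχh ξ, ← hχh η]
          ring
      _ ≤ (‖h ξ‖ₑ ^ 2 + ‖h η‖ₑ ^ 2) * (χ ξ * χ η) * k (ξ - η) := by gcongr
      _ = ‖h ξ‖ₑ ^ 2 * χ ξ * χ η * k (ξ - η) + ‖h η‖ₑ ^ 2 * χ η * χ ξ * k (ξ - η) := by ring
      _ = _ := by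
          have e : ∀ ζ, ‖h ζ‖ₑ ^ 2 * χ ζ = ‖h ζ‖ₑ ^ 2 := by
            intro ζ; rw [sq, mul_assoc, mul_comm _ (χ ζ), hχh]
          rw [e, e]
  have hdouble : 2 * ∫⁻ ξ, ‖h ξ‖ₑ * ∫⁻ η, ‖h η‖ₑ * k (ξ - η) ≤
      2 * (Q * ∫⁻ ξ, ‖h ξ‖ₑ ^ 2) := by
    calc 2 * ∫⁻ ξ, ‖h ξ‖ₑ * ∫⁻ η, ‖h η‖ₑ * k (ξ - η)
        = ∫⁻ ξ, ∫⁻ η, 2 * (‖h ξ‖ₑ * (‖h η‖ₑ * k (ξ - η))) := by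
          rw [← lintegral_const_mul' _ _ (by simp)]
          refine lintegral_congr fun ξ => ?_
          rw [lintegral_const_mul' _ _ (by simp), lintegral_const_mul' _ _ enorm_ne_top]
      _ ≤ ∫⁻ ξ, ∫⁻ η, (‖h ξ‖ₑ ^ 2 * χ η * k (ξ - η) + ‖h η‖ₑ ^ 2 * χ ξ * k (ξ - η)) :=
          lintegral_mono fun ξ => lintegral_mono fun η => hpt ξ η
      _ = ∫⁻ p : Euc m × Euc m, (‖h p.1‖ₑ ^ 2 * χ p.2 * k (p.1 - p.2) +
            ‖h p.2‖ₑ ^ 2 * χ p.1 * k (p.1 - p.2)) ∂(volume.prod volume) :=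
          (lintegral_prod _ (hprod.add hprod2)).symm
      _ = (∫⁻ ξ, ∫⁻ η, ‖h ξ‖ₑ ^ 2 * χ η * k (ξ - η)) +
            ∫⁻ η, ∫⁻ ξ, ‖h η‖ₑ ^ 2 * χ ξ * k (ξ - η) := by
          rw [lintegral_add_left' hprod, lintegral_prod _ hprod, lintegral_prod_symm _ hprod2]
      _ ≤ (∫⁻ ξ, Q * ‖h ξ‖ₑ ^ 2) + ∫⁻ η, Q * ‖h η‖ₑ ^ 2 := by
          gcongr with ξ η
          · exact hbound ξ
          · refine le_trans (le_of_eq (lintegral_congr fun ξ => ?_)) (hbound η)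
            rw [← hsymm (ξ - η), neg_sub]
      _ = 2 * (Q * ∫⁻ ξ, ‖h ξ‖ₑ ^ 2) := by
          rw [lintegral_const_mul'' _ (hhe.pow_const 2), two_mul]
  exact (ENNReal.mul_le_mul_iff_right (by simp) (by simp)).1 hdouble

end GaussianPairing

/-! ### Gaussian mass of thin sets, by slicing, and Plancherel's inequality -/

section SliceBounds

theorem lintegral_pi_prod_eq {m : ℕ} {g : Fin m → ℝ → ℝ≥0∞} (hg : ∀ i, Measurable (g i)) :
    ∫⁻ v : Fin m → ℝ, ∏ i, g i (v i) = ∏ i, ∫⁻ u, g i u := by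
  induction m with
  | zero => simp [volume_pi]
  | succ m ih =>
    have hmeas : Measurable fun v : Fin m → ℝ => ∏ i, g i.succ (v i) :=
      Finset.measurable_fun_prod _ fun i _ => (hg i.succ).comp (measurable_pi_apply i)
    rw [← (volume_preserving_piFinSuccAbove (fun _ : Fin (m + 1) => ℝ) 0).symm.lintegral_comp_emb
      (MeasurableEquiv.measurableEmbedding _)]
    simp only [MeasurableEquiv.piFinSuccAbove_symm_apply, Fin.prod_univ_succ]
    simp only [Fin.insertNthEquiv_zero, Fin.consEquiv_apply,
      Fin.cons_zero, Fin.cons_succ]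
    rw [Measure.volume_eq_prod, lintegral_prod_mul (hg 0).aemeasurable hmeas.aemeasurable,
      ih fun i => hg i.succ]

/-- If the slices of `S` in direction `i` have measure at most `ℓ`, integrals of product functions
over `S` gain the factor `ℓ`. -/
theorem setLIntegral_pi_prod_le_of_slice {m : ℕ} {g : Fin (m + 1) → ℝ → ℝ≥0∞}
    (hg : ∀ i, Measurable (g i)) (i : Fin (m + 1)) {A ℓ : ℝ≥0∞} (hA : ∀ u, g i u ≤ A)
    {S : Set (Fin (m + 1) → ℝ)} (hS : MeasurableSet S)
    (hℓ : ∀ v : Fin m → ℝ, volume {u : ℝ | i.insertNth u v ∈ S} ≤ ℓ) :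
    ∫⁻ v in S, ∏ j, g j (v j) ≤ A * ℓ * ∏ j, ∫⁻ u, g (i.succAbove j) u := by
  have hmeas : Measurable fun v : Fin m → ℝ => ∏ j, g (i.succAbove j) (v j) :=
    Finset.measurable_fun_prod _ fun j _ => (hg _).comp (measurable_pi_apply j)
  have hins : Measurable fun p : ℝ × (Fin m → ℝ) => (i.insertNth p.1 p.2 : Fin (m + 1) → ℝ) :=
    (MeasurableEquiv.piFinSuccAbove (fun _ : Fin (m + 1) => ℝ) i).symm.measurable
  rw [← lintegral_indicator hS,
    ← (volume_preserving_piFinSuccAbove (fun _ : Fin (m + 1) => ℝ) i).symm.lintegral_comp_emb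
      (MeasurableEquiv.measurableEmbedding _)]
  calc _ ≤ ∫⁻ p : ℝ × (Fin m → ℝ), A * ((fun p : ℝ × (Fin m → ℝ) =>
          (i.insertNth p.1 p.2 : Fin (m + 1) → ℝ)) ⁻¹' S).indicator
          (fun p => ∏ j, g (i.succAbove j) (p.2 j)) p ∂(volume.prod volume) := by
        refine lintegral_mono fun p => ?_
        change S.indicator _ (i.insertNth p.1 p.2) ≤ _
        by_cases hp : (i.insertNth p.1 p.2 : Fin (m + 1) → ℝ) ∈ S
        · rw [Set.indicator_of_mem hp, Set.indicator_of_mem (show p ∈ (fun p : ℝ × (Fin m → ℝ) =>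
            (i.insertNth p.1 p.2 : Fin (m + 1) → ℝ)) ⁻¹' S from hp),
            Fin.prod_univ_succAbove _ i]
          simp only [Fin.insertNth_apply_same, Fin.insertNth_apply_succAbove]
          gcongr
          exact hA _
        · rw [Set.indicator_of_notMem hp]
          exact zero_le
    _ = ∫⁻ v : Fin m → ℝ, ∫⁻ u : ℝ, A * ((fun p : ℝ × (Fin m → ℝ) =>
          (i.insertNth p.1 p.2 : Fin (m + 1) → ℝ)) ⁻¹' S).indicator
          (fun p => ∏ j, g (i.succAbove j) (p.2 j)) (u, v) := by
        rw [lintegral_prod_symm']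
        exact ((hmeas.comp measurable_snd).indicator (hins hS)).const_mul A
    _ ≤ ∫⁻ v : Fin m → ℝ, A * ℓ * ∏ j, g (i.succAbove j) (v j) := by
        refine lintegral_mono fun v => ?_
        have hsl : MeasurableSet {u : ℝ | (i.insertNth u v : Fin (m + 1) → ℝ) ∈ S} :=
          (hins.comp (measurable_id.prodMk measurable_const)) hS
        calc ∫⁻ u : ℝ, A * ((fun p : ℝ × (Fin m → ℝ) =>
              (i.insertNth p.1 p.2 : Fin (m + 1) → ℝ)) ⁻¹' S).indicator
              (fun p => ∏ j, g (i.succAbove j) (p.2 j)) (u, v)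
            = ∫⁻ u : ℝ, {u : ℝ | (i.insertNth u v : Fin (m + 1) → ℝ) ∈ S}.indicator
                (fun _ => A * ∏ j, g (i.succAbove j) (v j)) u := by
              refine lintegral_congr fun u => ?_
              by_cases hu : (i.insertNth u v : Fin (m + 1) → ℝ) ∈ S
              · rw [Set.indicator_of_mem (show (u, v) ∈ _ from hu), Set.indicator_of_mem
                  (show u ∈ {u : ℝ | (i.insertNth u v : Fin (m + 1) → ℝ) ∈ S} from hu)]
              · rw [Set.indicator_of_notMem (show (u, v) ∉ _ from hu), Set.indicator_of_notMem
                  (show u ∉ {u : ℝ | (i.insertNth u v : Fin (m + 1) → ℝ) ∈ S} from hu), mul_zero]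
          _ = (A * ∏ j, g (i.succAbove j) (v j)) *
                volume {u : ℝ | (i.insertNth u v : Fin (m + 1) → ℝ) ∈ S} :=
              lintegral_indicator_const hsl _
          _ ≤ (A * ∏ j, g (i.succAbove j) (v j)) * ℓ := by gcongr; exact hℓ v
          _ = _ := by ring
    _ = _ := by
        rw [lintegral_const_mul _ hmeas, lintegral_pi_prod_eq fun j => hg (i.succAbove j)]

/-- Only pairs of equal sign are compared, so the set splits into a nonnegative and a nonpositive
piece, each of diameter at most `ℓ`. This suits slices of the shell along a coordinate of `ξ'`,
which are symmetric under a change of sign. -/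
theorem volume_le_of_abs_sub_le {s : Set ℝ} {ℓ : ℝ}
    (h : ∀ u ∈ s, ∀ v ∈ s, 0 ≤ u * v → |u - v| ≤ ℓ) : volume s ≤ ENNReal.ofReal (2 * ℓ) := by
  have key : ∀ s' ⊆ s, (∀ u ∈ s', ∀ v ∈ s', 0 ≤ u * v) → volume s' ≤ ENNReal.ofReal ℓ := by
    intro s' hs' hpos
    refine (Real.volume_le_diam s').trans (Metric.ediam_le fun u hu v hv => ?_)
    rw [edist_dist, Real.dist_eq]
    exact ENNReal.ofReal_le_ofReal (h u (hs' hu) v (hs' hv) (hpos u hu v hv))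
  by_cases hℓ : 0 ≤ ℓ
  · calc volume s ≤ volume ((s ∩ {u | 0 ≤ u}) ∪ (s ∩ {u | u ≤ 0})) := by
          refine measure_mono fun u hu => ?_
          rcases le_total 0 u with h0 | h0
          · exact Or.inl ⟨hu, h0⟩
          · exact Or.inr ⟨hu, h0⟩
      _ ≤ volume (s ∩ {u | 0 ≤ u}) + volume (s ∩ {u | u ≤ 0}) := measure_union_le _ _
      _ ≤ ENNReal.ofReal ℓ + ENNReal.ofReal ℓ := by
          gcongr
          · exact key _ Set.inter_subset_left fun u hu v hv => mul_nonneg hu.2 hv.2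
          · exact key _ Set.inter_subset_left fun u hu v hv =>
              mul_nonneg_of_nonpos_of_nonpos hu.2 hv.2
      _ = _ := by rw [← ENNReal.ofReal_add hℓ hℓ, two_mul]
  · have : s = ∅ := by
      rw [Set.eq_empty_iff_forall_notMem]
      intro u hu
      exact hℓ ((abs_nonneg _).trans (h u hu u hu (mul_self_nonneg u)))
    simp [this]

/-- The factor `min(1, 1/r)`. -/
noncomputable def capFactor (r : ℝ) : ℝ := min 1 r⁻¹

theorem capFactor_pos {r : ℝ} (hr : 0 < r) : 0 < capFactor r := lt_min one_pos (inv_pos.2 hr)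

theorem capFactor_le_one (r : ℝ) : capFactor r ≤ 1 := min_le_left _ _

/-- The part of a Gaussian kernel living on `[-4, 4]`. -/
noncomputable def truncGauss (b a u : ℝ) : ℝ≥0∞ :=
  (Set.Icc (-4 : ℝ) 4).indicator (fun u => ENNReal.ofReal (gaussKer b (a - u))) u

theorem measurable_truncGauss (b a : ℝ) : Measurable (truncGauss b a) := by
  refine Measurable.indicator ?_ measurableSet_Icc
  exact ((continuous_gaussKer b).comp (by fun_prop)).measurable.ennreal_ofReal

theorem truncGauss_le {b : ℝ} (hb : 0 < b) (a u : ℝ) :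
    truncGauss b a u ≤ ENNReal.ofReal b⁻¹ := by
  unfold truncGauss
  refine (Set.indicator_le_self _ _ _).trans ?_
  exact ENNReal.ofReal_le_ofReal (gaussKer_le hb _)

/-- A narrow Gaussian has total mass one; a wide one is at most `b⁻¹` on an interval of length `8`.
-/
theorem lintegral_truncGauss_le {b : ℝ} (hb : 0 < b) (a : ℝ) :
    ∫⁻ u, truncGauss b a u ≤ ENNReal.ofReal (8 * capFactor b) := by
  have h1 : ∫⁻ u, truncGauss b a u ≤ 1 := by
    rw [← lintegral_gaussKer hb a]
    exact lintegral_mono fun u => Set.indicator_le_self _ _ _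
  have h2 : ∫⁻ u, truncGauss b a u ≤ ENNReal.ofReal (8 * b⁻¹) := by
    unfold truncGauss
    rw [lintegral_indicator measurableSet_Icc]
    calc _ ≤ ∫⁻ u in Set.Icc (-4 : ℝ) 4, ENNReal.ofReal b⁻¹ :=
          lintegral_mono fun u => ENNReal.ofReal_le_ofReal (gaussKer_le hb _)
      _ = _ := by
          rw [setLIntegral_const, Real.volume_Icc, ← ENNReal.ofReal_mul (by positivity)]
          congr 1; ring
  rcases le_total 1 b⁻¹ with h | h
  · rw [capFactor, min_eq_left h]
    refine h1.trans ?_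
    rw [← ENNReal.ofReal_one]
    exact ENNReal.ofReal_le_ofReal (by norm_num)
  · rwa [capFactor, min_eq_right h]

/-- In the thin direction `i` the kernel is bounded by its supremum `(b i)⁻¹` and the slice
contributes its length `2ℓ`; every other direction contributes the Gaussian mass on `[-4, 4]`. -/
theorem setLIntegral_gaussProd_le_of_slice {m : ℕ} {b : Fin (m + 1) → ℝ} (hb : ∀ i, 0 < b i)
    (ξ : Euc (m + 1)) (i : Fin (m + 1)) {S : Set (Euc (m + 1))} (hS : MeasurableSet S)
    (hS4 : ∀ η ∈ S, ∀ j, |η j| ≤ 4) {ℓ : ℝ}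
    (hℓ : ∀ η ∈ S, ∀ ζ ∈ S, (∀ j, j ≠ i → η j = ζ j) → 0 ≤ η i * ζ i → |η i - ζ i| ≤ ℓ) :
    ∫⁻ η in S, gaussProd b (ξ - η) ≤
      ENNReal.ofReal ((b i)⁻¹ * (2 * ℓ) * ∏ j, (8 * capFactor (b (i.succAbove j)))) := by
  by_cases hne : S = ∅
  · simp [hne]
  have hℓ0 : 0 ≤ ℓ := by
    obtain ⟨η, hη⟩ := Set.nonempty_iff_ne_empty.2 hne
    exact (abs_nonneg _).trans (hℓ η hη η hη (fun _ _ => rfl) (mul_self_nonneg _))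
  have hS' : MeasurableSet (WithLp.toLp 2 ⁻¹' S : Set (Fin (m + 1) → ℝ)) :=
    (MeasurableEquiv.toLp 2 (Fin (m + 1) → ℝ)).measurable hS
  rw [← (PiLp.volume_preserving_toLp (Fin (m + 1))).setLIntegral_comp_preimage_emb
    (MeasurableEquiv.toLp 2 _).measurableEmbedding]
  calc ∫⁻ v in (WithLp.toLp 2 ⁻¹' S : Set (Fin (m + 1) → ℝ)), gaussProd b (ξ - WithLp.toLp 2 v)
      = ∫⁻ v in (WithLp.toLp 2 ⁻¹' S : Set (Fin (m + 1) → ℝ)),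
          ∏ j, truncGauss (b j) (ξ j) (v j) := by
        refine setLIntegral_congr_fun hS' fun v hv => ?_
        refine Finset.prod_congr rfl fun j _ => ?_
        have := abs_le.1 (hS4 _ hv j)
        unfold truncGauss
        rw [Set.indicator_of_mem (show v j ∈ Set.Icc (-4 : ℝ) 4 from this)]
        rfl
    _ ≤ ENNReal.ofReal (b i)⁻¹ * ENNReal.ofReal (2 * ℓ) *
          ∏ j, ∫⁻ u, truncGauss (b (i.succAbove j)) (ξ (i.succAbove j)) u := by
        refine setLIntegral_pi_prod_le_of_slice
          (g := fun j => truncGauss (b j) (ξ j)) (fun j => measurable_truncGauss _ _) i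
          (fun u => truncGauss_le (hb i) _ u) hS' fun v => ?_
        refine volume_le_of_abs_sub_le fun u hu u' hu' hpos => ?_
        have := hℓ _ hu _ hu' (fun j hj => ?_) (by simpa using hpos)
        · simpa using this
        · obtain ⟨k, rfl⟩ := Fin.exists_succAbove_eq hj
          simp
    _ ≤ ENNReal.ofReal (b i)⁻¹ * ENNReal.ofReal (2 * ℓ) *
          ∏ j, ENNReal.ofReal (8 * capFactor (b (i.succAbove j))) := by
        gcongr with j
        exact lintegral_truncGauss_le (hb _) _
    _ = _ := by
        have h8 : ∀ j, 0 ≤ 8 * capFactor (b (i.succAbove j)) := fun j =>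
          mul_nonneg (by norm_num) (capFactor_pos (hb _)).le
        rw [← ENNReal.ofReal_prod_of_nonneg fun j _ => h8 j,
          ← ENNReal.ofReal_mul (inv_nonneg.2 (hb i).le), ← ENNReal.ofReal_mul]
        have := hb i
        positivity

theorem lintegral_gaussProd_sub {m : ℕ} {b : Fin m → ℝ} (hb : ∀ i, 0 < b i) (ξ : Euc m) :
    ∫⁻ η, gaussProd b (ξ - η) = 1 := by
  rw [← (PiLp.volume_preserving_toLp (Fin m)).lintegral_comp_emb
    (MeasurableEquiv.toLp 2 _).measurableEmbedding]
  have := lintegral_pi_prod_eq (g := fun (i : Fin m) u => ENNReal.ofReal (gaussKer (b i) (ξ i - u)))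
    fun i => ((continuous_gaussKer (b i)).comp (by fun_prop)).measurable.ennreal_ofReal
  simp_rw [lintegral_gaussKer (hb _), Finset.prod_const_one] at this
  exact this

/-- The Plancherel inequality for integrable functions. -/
theorem lintegral_fourier_sq_le {m : ℕ} {g : Euc m → ℂ} (hg : Integrable g) :
    ∫⁻ ξ, ‖𝓕 g ξ‖ₑ ^ 2 ≤ ∫⁻ x, ‖g x‖ₑ ^ 2 := by
  have hcont : Continuous (𝓕 g) := VectorFourier.fourierIntegral_continuous
    Real.continuous_fourierChar (by simpa using continuous_inner) hg
  -- The weights with parameter `1/(k+1)` tend to one pointwise. For each of them Schur's test holds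
  -- with constant one, the kernel having mass one, and Fatou's lemma gives the limit.
  have hb : ∀ k : ℕ, ∀ i : Fin m, (0 : ℝ) < (fun _ => 1 / ((k : ℝ) + 1)) i := fun k i => by
    positivity
  have h1 : ∀ k : ℕ, ∫⁻ x, ENNReal.ofReal (gaussWeight (fun _ => 1 / ((k : ℝ) + 1)) 0 x) *
      ‖𝓕 g x‖ₑ ^ 2 ≤ ∫⁻ x, ‖g x‖ₑ ^ 2 := by
    intro k
    refine (lintegral_gaussWeight_mul_fourier_sq_le (hb k) 0 hg).trans ?_
    refine (lintegral_quadratic_form_le hg.aemeasurable (measurable_gaussProd _)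
      (gaussProd_neg _) MeasurableSet.univ (fun ξ h => absurd (Set.mem_univ ξ) h) (Q := 1)
      fun ξ => ?_).trans (by rw [one_mul])
    rw [setLIntegral_univ, lintegral_gaussProd_sub (hb k)]
  have h2 : ∀ x, Filter.Tendsto (fun k : ℕ =>
      ENNReal.ofReal (gaussWeight (fun _ => 1 / ((k : ℝ) + 1)) 0 x) * ‖𝓕 g x‖ₑ ^ 2)
      Filter.atTop (nhds (‖𝓕 g x‖ₑ ^ 2)) := by
    intro x
    have h3 : Filter.Tendsto (fun k : ℕ => gaussWeight (fun _ => 1 / ((k : ℝ) + 1)) 0 x)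
        Filter.atTop (nhds 1) := by
      have hc : Continuous fun s : ℝ => Real.exp (-Real.pi * ∑ i, (s * (x i - (0 : Euc m) i)) ^ 2) := by
        fun_prop
      have := (hc.tendsto 0).comp (tendsto_one_div_add_atTop_nhds_zero_nat (𝕜 := ℝ))
      simpa [Function.comp_def, gaussWeight] using this
    have := ENNReal.Tendsto.mul_const (b := ‖𝓕 g x‖ₑ ^ 2) (ENNReal.tendsto_ofReal h3)
      (Or.inl (by simp))
    simpa using this
  calc ∫⁻ ξ, ‖𝓕 g ξ‖ₑ ^ 2 = ∫⁻ ξ, Filter.liminf (fun k : ℕ =>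
      ENNReal.ofReal (gaussWeight (fun _ => 1 / ((k : ℝ) + 1)) 0 ξ) * ‖𝓕 g ξ‖ₑ ^ 2)
        Filter.atTop := lintegral_congr fun ξ => (h2 ξ).liminf_eq.symm
    _ ≤ Filter.liminf (fun k : ℕ => ∫⁻ ξ,
      ENNReal.ofReal (gaussWeight (fun _ => 1 / ((k : ℝ) + 1)) 0 ξ) * ‖𝓕 g ξ‖ₑ ^ 2)
        Filter.atTop := lintegral_liminf_le fun k =>
          (continuous_gaussWeight _ _).measurable.ennreal_ofReal.mul
            (hcont.measurable.enorm.pow_const 2)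
    _ ≤ _ := Filter.liminf_le_of_le (by isBoundedDefault) fun c hc => by
          obtain ⟨k, hk⟩ := hc.exists
          exact hk.trans (h1 k)

end SliceBounds

/-! ### Geometry of the cone shell and the estimate for one Gaussian -/

section ConeShell

@[fun_prop]
theorem continuous_headPart {d : ℕ} : Continuous (headPart : Euc (d + 1) → Euc d) := by
  unfold headPart; fun_prop

@[fun_prop]
theorem continuous_lastPart {d : ℕ} : Continuous (lastPart : Euc (d + 1) → ℝ) := by
  unfold lastPart; fun_prop

theorem norm_headPart_sq {d : ℕ} (x : Euc (d + 1)) :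
    ‖headPart x‖ ^ 2 = ∑ i : Fin d, x i.castSucc ^ 2 := by
  rw [EuclideanSpace.norm_sq_eq]
  simp [headPart]

theorem abs_castSucc_le_norm_headPart {d : ℕ} (x : Euc (d + 1)) (i : Fin d) :
    |x i.castSucc| ≤ ‖headPart x‖ := by
  refine abs_le_of_sq_le_sq ?_ (norm_nonneg _)
  rw [norm_headPart_sq]
  exact Finset.single_le_sum (f := fun i : Fin d => x i.castSucc ^ 2)
    (fun _ _ => sq_nonneg _) (Finset.mem_univ i)

/-- The `δ`-neighbourhood of the truncated cone `|ξ'| = t ξ_n`. -/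
def coneShell (d : ℕ) (δ t : ℝ) : Set (Euc (d + 1)) :=
  {ξ | (1 - δ) * (t * lastPart ξ) ≤ ‖headPart ξ‖ ∧ ‖headPart ξ‖ ≤ t * lastPart ξ ∧
    lastPart ξ ∈ Set.Icc (1 / 2 : ℝ) 2}

/-- Closedness in `(t, ξ)` jointly supplies the measurability needed to exchange the integrals over
`t` and `ξ`. -/
theorem isClosed_coneShell (d : ℕ) (δ : ℝ) :
    IsClosed {p : ℝ × Euc (d + 1) | p.2 ∈ coneShell d δ p.1} := by
  have h1 : Continuous fun p : ℝ × Euc (d + 1) => ‖headPart p.2‖ := by fun_prop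
  have h2 : Continuous fun p : ℝ × Euc (d + 1) => p.1 * lastPart p.2 := by fun_prop
  have h3 : Continuous fun p : ℝ × Euc (d + 1) => lastPart p.2 := by fun_prop
  exact (isClosed_le (continuous_const.mul h2) h1).inter
    ((isClosed_le h1 h2).inter (isClosed_Icc.preimage h3))

theorem isClosed_coneShell_slice (d : ℕ) (δ t : ℝ) : IsClosed (coneShell d δ t) :=
  (isClosed_coneShell d δ).preimage (f := fun ξ => (t, ξ)) (by fun_prop)

variable {d : ℕ} {δ t : ℝ}

theorem coneShell_abs_le (ht : t ∈ Set.Icc (1 : ℝ) 2) {ξ : Euc (d + 1)}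
    (hξ : ξ ∈ coneShell d δ t) (j : Fin (d + 1)) : |ξ j| ≤ 4 := by
  obtain ⟨_, h2, h3, h4⟩ := hξ
  have h5 : t * lastPart ξ ≤ 2 * 2 := mul_le_mul ht.2 h4 (by linarith) (by norm_num)
  induction j using Fin.lastCases with
  | last =>
    rw [abs_le]
    change -4 ≤ lastPart ξ ∧ lastPart ξ ≤ 4
    constructor <;> linarith
  | cast j => linarith [abs_castSucc_le_norm_headPart ξ j]

/-- The anisotropic scale `(r, …, r, s)`. -/
def coneScale (d : ℕ) (r s : ℝ) : Fin (d + 1) → ℝ := Fin.snoc (fun _ => r) s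

@[simp] theorem coneScale_castSucc (r s : ℝ) (i : Fin d) : coneScale d r s i.castSucc = r := by
  simp [coneScale]

@[simp] theorem coneScale_last (r s : ℝ) : coneScale d r s (Fin.last d) = s := by
  simp [coneScale]

theorem coneScale_pos {r s : ℝ} (hr : 0 < r) (hs : 0 < s) (i : Fin (d + 1)) :
    0 < coneScale d r s i := by
  induction i using Fin.lastCases with
  | last => simpa
  | cast j => simpa

theorem headPart_eq_of_forall {ξ η : Euc (d + 1)} (h : ∀ j, j ≠ Fin.last d → ξ j = η j) :
    headPart ξ = headPart η := by
  ext j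
  exact h j.castSucc (Fin.castSucc_lt_last j).ne

/-- With `ξ'` fixed, two admissible values of `t ξ_n` differ by at most `δ t ξ_n ≤ 4δ`, and `t ≥ 1`;
hence slices of length `4δ`. -/
theorem setLIntegral_coneShell_le_last (hδ : 0 < δ) (hδ' : δ ≤ 1 / 2)
    (ht : t ∈ Set.Icc (1 : ℝ) 2) {r s : ℝ} (hr : 0 < r) (hs : 0 < s) (ξ : Euc (d + 1)) :
    ∫⁻ η in coneShell d δ t, gaussProd (coneScale d r s) (ξ - η) ≤
      ENNReal.ofReal (8 * 8 ^ d * δ * (s⁻¹ * capFactor r ^ d)) := by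
  have h := setLIntegral_gaussProd_le_of_slice (coneScale_pos hr hs) ξ (Fin.last d)
    (isClosed_coneShell_slice d δ t).measurableSet (fun η hη j => coneShell_abs_le ht hη j)
    (ℓ := 4 * δ) ?_
  · refine h.trans (ENNReal.ofReal_le_ofReal (le_of_eq ?_))
    simp [mul_pow]
    ring
  · have key : ∀ η ∈ coneShell d δ t, ∀ ζ ∈ coneShell d δ t, headPart η = headPart ζ →
        lastPart η - lastPart ζ ≤ 4 * δ := by
      rintro η ⟨h1, -, -, h4⟩ ζ ⟨-, h2', h3', -⟩ he
      rw [he] at h1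
      have h5 : t * lastPart η ≤ 2 * 2 := by nlinarith [ht.1, ht.2]
      have h6 : t * (lastPart η - lastPart ζ) ≤ δ * (t * lastPart η) := by nlinarith
      by_contra hcon
      push Not at hcon
      nlinarith [ht.1]
    intro η hη ζ hζ he _
    have := headPart_eq_of_forall he
    exact abs_sub_le_iff.2 ⟨key η hη ζ hζ this, key ζ hζ η hη this.symm⟩

/-- With the other coordinates fixed, `|ξ'|²` varies by at most `32δ` on the shell, and this
variation is that of `ξ_i²`. Dividing by `|η_i| + |ζ_i| ≥ 1/(2d)`, valid for values of equal sign,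
bounds `|η_i - ζ_i|` by `64dδ`. -/
theorem setLIntegral_coneShell_le_head (hδ : 0 < δ) (hδ' : δ ≤ 1 / 2)
    (ht : t ∈ Set.Icc (1 : ℝ) 2) {r s : ℝ} (hr : 0 < r) (hs : 0 < s) (ξ : Euc (d + 1))
    (i : Fin d) :
    ∫⁻ η in coneShell d δ t ∩ {η | 1 / (4 * d) ≤ |η i.castSucc|},
        gaussProd (coneScale d r s) (ξ - η) ≤
      ENNReal.ofReal (128 * d * 8 ^ d * δ * (r⁻¹ * capFactor r ^ (d - 1) * capFactor s)) := by
  have hd : 0 < d := i.pos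
  have hd' : (0 : ℝ) < d := by exact_mod_cast hd
  have hmeas : MeasurableSet (coneShell d δ t ∩ {η | 1 / (4 * d) ≤ |η i.castSucc|}) := by
    refine (isClosed_coneShell_slice d δ t).measurableSet.inter (IsClosed.measurableSet ?_)
    exact isClosed_le (by fun_prop) (by fun_prop)
  have h := setLIntegral_gaussProd_le_of_slice (coneScale_pos hr hs) ξ i.castSucc
    hmeas (fun η hη j => coneShell_abs_le ht hη.1 j) (ℓ := 64 * d * δ) ?_
  · refine h.trans (ENNReal.ofReal_le_ofReal (le_of_eq ?_))
    have h1 := Fin.prod_univ_succAbove (fun j => 8 * capFactor (coneScale d r s j)) i.castSucc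
    rw [Fin.prod_univ_castSucc] at h1
    simp only [coneScale_castSucc, coneScale_last, Finset.prod_const, Finset.card_univ,
      Fintype.card_fin] at h1
    have h2 : (8 * capFactor r) ^ d = (8 * capFactor r) ^ (d - 1) * (8 * capFactor r) := by
      rw [← pow_succ, Nat.sub_add_cancel hd]
    rw [h2] at h1
    have h3 : 0 < 8 * capFactor r := mul_pos (by norm_num) (capFactor_pos hr)
    have h4 : ∏ j, 8 * capFactor (coneScale d r s (i.castSucc.succAbove j)) =
        (8 * capFactor r) ^ (d - 1) * (8 * capFactor s) := by
      apply mul_left_cancel₀ h3.ne'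
      rw [← h1]; ring
    have h5 : (8 : ℝ) ^ d = 8 ^ (d - 1) * 8 := by rw [← pow_succ, Nat.sub_add_cancel hd]
    rw [h4, coneScale_castSucc, mul_pow, h5]
    ring
  · rintro η ⟨hη, hη1⟩ ζ ⟨hζ, hζ1⟩ he hpos
    have hlast : lastPart η = lastPart ζ := he _ (Fin.castSucc_lt_last i).ne'
    have hsq : ‖headPart η‖ ^ 2 - ‖headPart ζ‖ ^ 2 = η i.castSucc ^ 2 - ζ i.castSucc ^ 2 := by
      rw [norm_headPart_sq, norm_headPart_sq, ← Finset.sum_sub_distrib]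
      refine Finset.sum_eq_single i (fun j _ hj => ?_) (by simp)
      rw [he j.castSucc (fun h => hj (Fin.castSucc_injective d h)), sub_self]
    -- Both squared norms lie between `((1 - δ)T)²` and `T²` with the same `T = t η_n ≤ 4`, and `T²
    -- - ((1 - δ)T)² ≤ 2δ · 16`.
    have hb : |‖headPart η‖ ^ 2 - ‖headPart ζ‖ ^ 2| ≤ 32 * δ := by
      obtain ⟨a1, a2, a3, a4⟩ := hη
      obtain ⟨b1, b2, -, -⟩ := hζ
      rw [← hlast] at b1 b2
      set T := t * lastPart η with hT
      have hT0 : 0 ≤ T := by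
        have := ht.1
        positivity
      have hT4 : T ≤ 2 * 2 := mul_le_mul ht.2 a4 (by linarith) (by norm_num)
      have hL : 0 ≤ (1 - δ) * T := mul_nonneg (by linarith) hT0
      have u1 : ‖headPart η‖ ^ 2 ≤ T ^ 2 := pow_le_pow_left₀ (norm_nonneg _) a2 2
      have u2 : ‖headPart ζ‖ ^ 2 ≤ T ^ 2 := pow_le_pow_left₀ (norm_nonneg _) b2 2
      have l1 : ((1 - δ) * T) ^ 2 ≤ ‖headPart η‖ ^ 2 := pow_le_pow_left₀ hL a1 2
      have l2 : ((1 - δ) * T) ^ 2 ≤ ‖headPart ζ‖ ^ 2 := pow_le_pow_left₀ hL b1 2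
      have hgap : T ^ 2 - ((1 - δ) * T) ^ 2 ≤ 32 * δ := by
        have hTT : T ^ 2 ≤ 16 := by nlinarith
        have : T ^ 2 - ((1 - δ) * T) ^ 2 = δ * (2 - δ) * T ^ 2 := by ring
        rw [this]
        have h2 : δ * (2 - δ) ≤ 2 * δ := by nlinarith
        nlinarith [sq_nonneg T]
      rw [abs_le]
      constructor <;> linarith
    rw [hsq, sq_sub_sq, abs_mul] at hb
    have hsum : |η i.castSucc + ζ i.castSucc| = |η i.castSucc| + |ζ i.castSucc| := by
      rw [abs_add_eq_add_abs_iff]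
      rcases mul_nonneg_iff.1 hpos with h | h
      · exact Or.inl h
      · exact Or.inr h
    rw [hsum] at hb
    have hη2 : 1 / (4 * (d : ℝ)) ≤ |η i.castSucc| := hη1
    have hζ2 : 1 / (4 * (d : ℝ)) ≤ |ζ i.castSucc| := hζ1
    have h6 : 1 / (2 * (d : ℝ)) * |η i.castSucc - ζ i.castSucc| ≤ 32 * δ := by
      refine le_trans (mul_le_mul_of_nonneg_right ?_ (abs_nonneg _)) hb
      have : 1 / (2 * (d : ℝ)) = 1 / (4 * d) + 1 / (4 * d) := by field_simp; norm_num
      rw [this]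
      exact add_le_add hη2 hζ2
    rw [div_mul_eq_mul_div, one_mul, div_le_iff₀ (by positivity)] at h6
    linarith

/-- The Schur bound for Gaussian averages over the cone shell. -/
noncomputable def capBound (d : ℕ) (r s : ℝ) : ℝ :=
  min (r⁻¹ * capFactor r ^ (d - 1) * capFactor s) (s⁻¹ * capFactor r ^ d)

theorem setLIntegral_coneShell_le (hd : 0 < d) (hδ : 0 < δ) (hδ' : δ ≤ 1 / 2)
    (ht : t ∈ Set.Icc (1 : ℝ) 2) {r s : ℝ} (hr : 0 < r) (hs : 0 < s) (ξ : Euc (d + 1)) :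
    ∫⁻ η in coneShell d δ t, gaussProd (coneScale d r s) (ξ - η) ≤
      ENNReal.ofReal (128 * d ^ 2 * 8 ^ d * δ * capBound d r s) := by
  have hd1 : (1 : ℝ) ≤ d := by exact_mod_cast hd
  have hcr := capFactor_pos hr
  have hcs := capFactor_pos hs
  unfold capBound
  rcases min_choice (r⁻¹ * capFactor r ^ (d - 1) * capFactor s) (s⁻¹ * capFactor r ^ d) with h | h
  · rw [h]
    -- On the shell `|ξ'| ≥ (1 - δ) t ξ_n ≥ 1/4`, so some coordinate of `ξ'` has size at least
    -- `1/(4d)`. Summing over the `d` pieces turns `128 d` into `128 d²`.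
    have hcover : coneShell d δ t ⊆
        ⋃ i : Fin d, coneShell d δ t ∩ {η | 1 / (4 * d) ≤ |η i.castSucc|} := by
      intro η hη
      rw [Set.mem_iUnion]
      by_contra! hcon
      have hlt : ∀ i : Fin d, |η i.castSucc| < 1 / (4 * d) := fun i => by
        by_contra! h'
        exact hcon i ⟨hη, h'⟩
      have h1 : ‖headPart η‖ ^ 2 < (1 / 4 : ℝ) ^ 2 := by
        rw [norm_headPart_sq]
        have : Nonempty (Fin d) := ⟨⟨0, hd⟩⟩
        calc ∑ i : Fin d, η i.castSucc ^ 2 < ∑ i : Fin d, (1 / (4 * d) : ℝ) ^ 2 := by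
              refine Finset.sum_lt_sum_of_nonempty Finset.univ_nonempty fun i _ => ?_
              rw [← sq_abs]
              exact pow_lt_pow_left₀ (hlt i) (abs_nonneg _) two_ne_zero
          _ = (1 / 4 : ℝ) ^ 2 * (1 / d) := by
              rw [Finset.sum_const, Finset.card_univ, Fintype.card_fin, nsmul_eq_mul]
              field_simp
          _ ≤ (1 / 4 : ℝ) ^ 2 := by
              refine mul_le_of_le_one_right (by positivity) ?_
              rw [div_le_one (by linarith)]
              exact hd1
      have h2 := abs_lt_of_sq_lt_sq h1 (by norm_num)
      rw [abs_norm] at h2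
      obtain ⟨a1, -, a3, -⟩ := hη
      have h3 : (1 / 2 : ℝ) ≤ t * lastPart η := by nlinarith [ht.1]
      nlinarith
    calc _ ≤ ∫⁻ η in ⋃ i : Fin d, coneShell d δ t ∩ {η | 1 / (4 * d) ≤ |η i.castSucc|},
          gaussProd (coneScale d r s) (ξ - η) := lintegral_mono_set hcover
      _ ≤ ∑' i : Fin d, ∫⁻ η in coneShell d δ t ∩ {η | 1 / (4 * d) ≤ |η i.castSucc|},
          gaussProd (coneScale d r s) (ξ - η) := lintegral_iUnion_le _ _
      _ ≤ ∑' _ : Fin d, ENNReal.ofReal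
            (128 * d * 8 ^ d * δ * (r⁻¹ * capFactor r ^ (d - 1) * capFactor s)) :=
          ENNReal.tsum_le_tsum fun i => setLIntegral_coneShell_le_head hδ hδ' ht hr hs ξ i
      _ = _ := by
          rw [tsum_fintype, Finset.sum_const, Finset.card_univ, Fintype.card_fin,
            ← ENNReal.ofReal_nsmul, nsmul_eq_mul]
          congr 1; ring
  · rw [h]
    refine (setLIntegral_coneShell_le_last hδ hδ' ht hr hs ξ).trans
      (ENNReal.ofReal_le_ofReal ?_)
    have : (8 : ℝ) ≤ 128 * d ^ 2 := by nlinarith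
    gcongr

/-- If `ξ` is in the shells of both `u` and `v`, then `(1 - δ)u ≤ v`, so `u - v ≤ δu ≤ 2δ`. This is
the gain from averaging over dilations. -/
theorem volume_coneShell_dilations_le (hδ : 0 < δ) (hδ' : δ ≤ 1 / 2) (ξ : Euc (d + 1)) :
    volume ({t | ξ ∈ coneShell d δ t} ∩ Set.Icc (1 : ℝ) 2) ≤ ENNReal.ofReal (4 * δ) := by
  have key : ∀ u ∈ {t | ξ ∈ coneShell d δ t} ∩ Set.Icc (1 : ℝ) 2,
      ∀ v ∈ {t | ξ ∈ coneShell d δ t} ∩ Set.Icc (1 : ℝ) 2, u - v ≤ 2 * δ := by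
    rintro u ⟨⟨h1, -, h3, -⟩, hu⟩ v ⟨⟨-, h2, -⟩, hv⟩
    have h4 : (1 - δ) * u * lastPart ξ ≤ v * lastPart ξ := by linarith
    have h5 := le_of_mul_le_mul_right h4 (by linarith)
    nlinarith [hu.2]
  refine (volume_le_of_abs_sub_le (ℓ := 2 * δ) fun u hu v hv _ =>
    abs_sub_le_iff.2 ⟨key u hu v hv, key v hv u hu⟩).trans (le_of_eq ?_)
  congr 1; ring

/-- The basic `L²` estimate: the square function of multipliers supported in the cone shells,
against a Gaussian weight. -/
theorem lintegral_gaussWeight_coneShell_multiplier_le (hd : 0 < d) (hδ : 0 < δ) (hδ' : δ ≤ 1 / 2)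
    {r s : ℝ} (hr : 0 < r) (hs : 0 < s) (a : Euc (d + 1)) {A : ℝ} (hA : 0 ≤ A)
    {M : ℝ → Euc (d + 1) → ℂ} (hM : ∀ t ∈ Set.Icc (1 : ℝ) 2, Measurable (M t))
    (hMb : ∀ t ∈ Set.Icc (1 : ℝ) 2, ∀ ξ, ‖M t ξ‖ ≤ A)
    (hMs : ∀ t ∈ Set.Icc (1 : ℝ) 2, ∀ ξ, ξ ∉ coneShell d δ t → M t ξ = 0)
    {g : Euc (d + 1) → ℂ} (hg : Integrable g) :
    ∫⁻ t in Set.Icc (1 : ℝ) 2, ∫⁻ x, ENNReal.ofReal (gaussWeight (coneScale d r s) a x) *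
        ‖𝓕⁻ (fun ξ => M t ξ * 𝓕 g ξ) x‖ₑ ^ 2 ≤
      ENNReal.ofReal (512 * d ^ 2 * 8 ^ d * A ^ 2 * δ ^ 2 * capBound d r s) *
        ∫⁻ x, ‖g x‖ₑ ^ 2 := by
  classical
  have hcont : Continuous (𝓕 g) := VectorFourier.fourierIntegral_continuous
    Real.continuous_fourierChar (by simpa using continuous_inner) hg
  set Q := ENNReal.ofReal (128 * d ^ 2 * 8 ^ d * δ * capBound d r s) with hQ
  have hslice : ∀ t ∈ Set.Icc (1 : ℝ) 2,
      ∫⁻ x, ENNReal.ofReal (gaussWeight (coneScale d r s) a x) *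
        ‖𝓕⁻ (fun ξ => M t ξ * 𝓕 g ξ) x‖ₑ ^ 2 ≤ Q * ∫⁻ ξ, ENNReal.ofReal (A ^ 2) *
          ({p : ℝ × Euc (d + 1) | p.2 ∈ coneShell d δ p.1}.indicator
            (fun p => ‖𝓕 g p.2‖ₑ ^ 2) (t, ξ)) := by
    intro t ht
    have hsupp : ∀ ξ, ξ ∉ coneShell d δ t → M t ξ * 𝓕 g ξ = 0 := fun ξ hξ => by
      rw [hMs t ht ξ hξ, zero_mul]
    have hbdd : Bornology.IsBounded (coneShell d δ t) := by
      refine (Metric.isBounded_closedBall (x := (0 : Euc (d + 1)))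
        (r := Real.sqrt (∑ _j : Fin (d + 1), 4 ^ 2))).subset fun ξ hξ => ?_
      rw [mem_closedBall_zero_iff, EuclideanSpace.norm_eq]
      refine Real.sqrt_le_sqrt (Finset.sum_le_sum fun j _ => ?_)
      rw [Real.norm_eq_abs]
      exact pow_le_pow_left₀ (abs_nonneg _) (coneShell_abs_le ht hξ j) 2
    have hmeas : Measurable fun ξ => M t ξ * 𝓕 g ξ := (hM t ht).mul hcont.measurable
    have hint : Integrable fun ξ => M t ξ * 𝓕 g ξ := by
      rw [← integrableOn_iff_integrable_of_support_subset (s := coneShell d δ t)]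
      · refine Measure.integrableOn_of_bounded (M := A * ∫ y, ‖g y‖) hbdd.measure_lt_top.ne
          hmeas.aestronglyMeasurable (Filter.Eventually.of_forall fun ξ => ?_)
        rw [norm_mul]
        exact mul_le_mul (hMb t ht ξ)
          (VectorFourier.norm_fourierIntegral_le_integral_norm _ _ _ _ _) (norm_nonneg _) hA
      · intro ξ hξ
        by_contra h'
        exact hξ (hsupp ξ h')
    refine (lintegral_gaussWeight_mul_fourierInv_sq_le (coneScale_pos hr hs) a hint).trans ?_
    refine (lintegral_quadratic_form_le hint.aemeasurable (measurable_gaussProd _)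
      (gaussProd_neg _) (isClosed_coneShell_slice d δ t).measurableSet hsupp
      (setLIntegral_coneShell_le hd hδ hδ' ht hr hs)).trans ?_
    gcongr with ξ
    by_cases hξ : ξ ∈ coneShell d δ t
    · rw [Set.indicator_of_mem (show (t, ξ) ∈ {p : ℝ × Euc (d + 1) | p.2 ∈ coneShell d δ p.1}
        from hξ), enorm_mul, mul_pow, ENNReal.ofReal_pow hA]
      gcongr
      rw [← ofReal_norm]
      exact ENNReal.ofReal_le_ofReal (hMb t ht ξ)
    · rw [hsupp ξ hξ]; simp
  have hmeas2 : Measurable ({p : ℝ × Euc (d + 1) | p.2 ∈ coneShell d δ p.1}.indicator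
      (fun p => ‖𝓕 g p.2‖ₑ ^ 2)) := by
    refine Measurable.indicator ?_ (isClosed_coneShell d δ).measurableSet
    exact ((hcont.comp continuous_snd).measurable.enorm).pow_const 2
  calc _ ≤ ∫⁻ t in Set.Icc (1 : ℝ) 2, Q * ∫⁻ ξ, ENNReal.ofReal (A ^ 2) *
          ({p : ℝ × Euc (d + 1) | p.2 ∈ coneShell d δ p.1}.indicator
            (fun p => ‖𝓕 g p.2‖ₑ ^ 2) (t, ξ)) :=
        setLIntegral_mono' measurableSet_Icc hslice
    _ = Q * (ENNReal.ofReal (A ^ 2) * ∫⁻ t in Set.Icc (1 : ℝ) 2, ∫⁻ ξ,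
          ({p : ℝ × Euc (d + 1) | p.2 ∈ coneShell d δ p.1}.indicator
            (fun p => ‖𝓕 g p.2‖ₑ ^ 2) (t, ξ))) := by
        rw [lintegral_const_mul' _ _ ENNReal.ofReal_ne_top]
        simp_rw [lintegral_const_mul' _ _ (ENNReal.ofReal_ne_top (r := A ^ 2))]
        rw [hQ]
    _ = Q * (ENNReal.ofReal (A ^ 2) * ∫⁻ ξ, ∫⁻ t in Set.Icc (1 : ℝ) 2,
          ({p : ℝ × Euc (d + 1) | p.2 ∈ coneShell d δ p.1}.indicator
            (fun p => ‖𝓕 g p.2‖ₑ ^ 2) (t, ξ))) := by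
        -- After the exchange the inner integral is the measure of the dilations that put `ξ` in the
        -- shell, which yields the second factor `δ`.
        rw [lintegral_lintegral_swap]
        exact hmeas2.aemeasurable
    _ ≤ Q * (ENNReal.ofReal (A ^ 2) * ∫⁻ ξ, ENNReal.ofReal (4 * δ) * ‖𝓕 g ξ‖ₑ ^ 2) := by
        gcongr with ξ
        have hms : MeasurableSet {t | ξ ∈ coneShell d δ t} :=
          ((isClosed_coneShell d δ).preimage (f := fun t => (t, ξ)) (by fun_prop)).measurableSet
        have : ∀ t, ({p : ℝ × Euc (d + 1) | p.2 ∈ coneShell d δ p.1}.indicator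
            (fun p => ‖𝓕 g p.2‖ₑ ^ 2) (t, ξ)) =
            {t | ξ ∈ coneShell d δ t}.indicator (fun _ => ‖𝓕 g ξ‖ₑ ^ 2) t := by
          intro t
          by_cases hξ : ξ ∈ coneShell d δ t <;> simp [hξ]
        simp_rw [this]
        rw [lintegral_indicator_const hms, mul_comm, Measure.restrict_apply hms]
        gcongr
        exact volume_coneShell_dilations_le hδ hδ' ξ
    _ ≤ Q * (ENNReal.ofReal (A ^ 2) * (ENNReal.ofReal (4 * δ) * ∫⁻ x, ‖g x‖ₑ ^ 2)) := by
        rw [lintegral_const_mul' _ _ ENNReal.ofReal_ne_top]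
        exact mul_le_mul' le_rfl (mul_le_mul' le_rfl (mul_le_mul' le_rfl
          (lintegral_fourier_sq_le hg)))
    _ = _ := by
        have h0 : 0 ≤ capBound d r s := by
          have := capFactor_pos hr
          have := capFactor_pos hs
          unfold capBound
          positivity
        rw [hQ, ← mul_assoc, ← mul_assoc, ← ENNReal.ofReal_mul (by positivity),
          ← ENNReal.ofReal_mul (by positivity)]
        congr 2; ring

end ConeShell

/-! ### Dyadic sums and the size of `coneFactor` -/

section DyadicSums

/-- The growth of the dyadic sums `∑_{2 ^ j ≤ D} 2 ^ (p j)`. -/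
noncomputable def dyadicGrowth (p D : ℝ) : ℝ :=
  if p < 0 then 1 else if p = 0 then Real.log D else D ^ p

/-- The two bounds on `φ j` meet at `2^j = D`. Below this threshold the sum is geometric of ratio
`2^p`, which explains the three cases of `dyadicGrowth`; above it the terms decay geometrically from
the value `D^p`. Since `D ≥ 2`, the logarithm stays away from zero and dominates the tail when `p =
0`. -/
theorem exists_sum_dyadic_le (p : ℝ) {q : ℝ} (hq : 0 < q) :
    ∃ C : ℝ, 0 < C ∧ ∀ D : ℝ, 2 ≤ D → ∀ φ : ℕ → ℝ,
      (∀ j : ℕ, φ j ≤ (2 : ℝ) ^ (p * j)) → (∀ j : ℕ, φ j ≤ D ^ (p + q) * (2 : ℝ) ^ (-q * j)) →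
      ∀ n : ℕ, ∑ j ∈ Finset.range n, φ j ≤ C * dyadicGrowth p D := by
  have hl2 : 0 < Real.log 2 := Real.log_pos one_lt_two
  have hy : (2 : ℝ) ^ (-q) < 1 := Real.rpow_lt_one_of_one_lt_of_neg one_lt_two (by linarith)
  have hy0 : (0 : ℝ) < (2 : ℝ) ^ (-q) := by positivity
  have hyinv : 0 < 1 / (1 - (2 : ℝ) ^ (-q)) := by
    have : 0 < 1 - (2 : ℝ) ^ (-q) := by linarith
    positivity
  have hpow : ∀ (e : ℝ) (j : ℕ), (2 : ℝ) ^ (e * j) = ((2 : ℝ) ^ e) ^ j := fun e j => by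
    rw [Real.rpow_mul (by norm_num), Real.rpow_natCast]
  -- the part below the threshold
  obtain ⟨C₁, hC₁, hlow⟩ : ∃ C₁ : ℝ, 0 < C₁ ∧ ∀ D : ℝ, 2 ≤ D → ∀ L : ℕ, (2 : ℝ) ^ L ≤ D →
      ∑ j ∈ Finset.range (L + 1), (2 : ℝ) ^ (p * j) ≤ C₁ * dyadicGrowth p D := by
    rcases lt_trichotomy p 0 with hp | hp | hp
    · have h1 : (2 : ℝ) ^ p < 1 := Real.rpow_lt_one_of_one_lt_of_neg one_lt_two hp
      refine ⟨1 / (1 - (2 : ℝ) ^ p), by have : 0 < 1 - (2 : ℝ) ^ p := by linarith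
                                        positivity, fun D hD L hL => ?_⟩
      simp_rw [dyadicGrowth, if_pos hp, mul_one, hpow]
      have := geom_sum_Ico_le_of_lt_one (x := (2 : ℝ) ^ p) (m := 0) (n := L + 1)
        (by positivity) h1
      rwa [← Finset.range_eq_Ico, pow_zero] at this
    · refine ⟨2 / Real.log 2, by positivity, fun D hD L hL => ?_⟩
      have hL' : (L : ℝ) * Real.log 2 ≤ Real.log D := by
        rw [← Real.log_pow]
        exact Real.log_le_log (by positivity) hL
      have h2 : Real.log 2 ≤ Real.log D := Real.log_le_log (by norm_num) hD
      simp only [dyadicGrowth, hp, lt_self_iff_false, if_false, if_true, zero_mul, Real.rpow_zero,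
        Finset.sum_const, Finset.card_range, nsmul_eq_mul, mul_one]
      push_cast
      rw [div_mul_eq_mul_div, le_div_iff₀ hl2]
      linarith
    · have h1 : 1 < (2 : ℝ) ^ p := Real.one_lt_rpow one_lt_two hp
      refine ⟨(2 : ℝ) ^ p / ((2 : ℝ) ^ p - 1), by
        have : 0 < (2 : ℝ) ^ p - 1 := by linarith
        positivity, fun D hD L hL => ?_⟩
      have h2 : 0 < (2 : ℝ) ^ p - 1 := by linarith
      simp_rw [dyadicGrowth, if_neg hp.le.not_gt, if_neg hp.ne', hpow]
      rw [geom_sum_eq h1.ne', div_mul_eq_mul_div]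
      gcongr
      have h3 : ((2 : ℝ) ^ p) ^ L ≤ D ^ p := by
        rw [← hpow, mul_comm, Real.rpow_mul (by norm_num), Real.rpow_natCast]
        exact Real.rpow_le_rpow (by positivity) hL hp.le
      rw [pow_succ, mul_comm]
      nlinarith
  have hone : ∃ c : ℝ, 0 < c ∧ ∀ D : ℝ, 2 ≤ D → D ^ p ≤ c * dyadicGrowth p D := by
    rcases lt_trichotomy p 0 with hp | hp | hp
    · refine ⟨1, one_pos, fun D hD => ?_⟩
      rw [dyadicGrowth, if_pos hp, mul_one]
      exact Real.rpow_le_one_of_one_le_of_nonpos (by linarith) hp.le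
    · refine ⟨1 / Real.log 2, by positivity, fun D hD => ?_⟩
      have h2 : Real.log 2 ≤ Real.log D := Real.log_le_log (by norm_num) hD
      simp only [dyadicGrowth, hp, lt_self_iff_false, if_false, if_true, Real.rpow_zero]
      rw [div_mul_eq_mul_div, one_mul, le_div_iff₀ hl2]
      linarith
    · refine ⟨1, one_pos, fun D hD => ?_⟩
      rw [dyadicGrowth, if_neg hp.le.not_gt, if_neg hp.ne', one_mul]
  obtain ⟨c, hc, hone⟩ := hone
  refine ⟨C₁ + 1 / (1 - (2 : ℝ) ^ (-q)) * c, by positivity, fun D hD φ h1 h2 n => ?_⟩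
  have hD0 : 0 < D := by linarith
  -- Here `2^L ≤ D < 2^(L+1)`: the first inequality is used for the head of the sum, the second for
  -- the tail starting at `L + 1`.
  obtain ⟨L, hL1, hL2⟩ := exists_nat_pow_near (show 1 ≤ D by linarith) one_lt_two
  -- No sign is assumed on `φ`; passing to its positive part allows the range of summation to be
  -- enlarged.
  set ψ : ℕ → ℝ := fun j => max (φ j) 0 with hψ
  have hψ0 : ∀ j, 0 ≤ ψ j := fun j => le_max_right _ _
  have hψ1 : ∀ j : ℕ, ψ j ≤ (2 : ℝ) ^ (p * j) := fun j => max_le (h1 j) (by positivity)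
  have hψ2 : ∀ j : ℕ, ψ j ≤ D ^ (p + q) * (2 : ℝ) ^ (-q * j) := fun j =>
    max_le (h2 j) (by positivity)
  calc ∑ j ∈ Finset.range n, φ j ≤ ∑ j ∈ Finset.range n, ψ j :=
        Finset.sum_le_sum fun j _ => le_max_left _ _
    _ ≤ ∑ j ∈ Finset.range (L + 1) ∪ Finset.Ico (L + 1) (L + 1 + n), ψ j := by
        refine Finset.sum_le_sum_of_subset_of_nonneg (fun j hj => ?_) fun j _ _ => hψ0 j
        simp only [Finset.mem_union, Finset.mem_range, Finset.mem_Ico] at hj ⊢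
        omega
    _ = ∑ j ∈ Finset.range (L + 1), ψ j + ∑ j ∈ Finset.Ico (L + 1) (L + 1 + n), ψ j := by
        refine Finset.sum_union (Finset.disjoint_left.2 fun j hj hj' => ?_)
        simp only [Finset.mem_range, Finset.mem_Ico] at hj hj'
        omega
    _ ≤ C₁ * dyadicGrowth p D + D ^ (p + q) * (D ^ (-q) * (1 / (1 - (2 : ℝ) ^ (-q)))) := by
        refine add_le_add ((Finset.sum_le_sum fun j _ => hψ1 j).trans (hlow D hD L hL1)) ?_
        refine (Finset.sum_le_sum fun j _ => hψ2 j).trans ?_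
        rw [← Finset.mul_sum]
        simp_rw [hpow]
        refine mul_le_mul_of_nonneg_left
          ((geom_sum_Ico_le_of_lt_one hy0.le hy).trans ?_) (by positivity)
        rw [div_eq_mul_one_div]
        refine mul_le_mul_of_nonneg_right ?_ hyinv.le
        rw [← hpow, mul_comm, Real.rpow_mul (by norm_num), Real.rpow_natCast]
        exact Real.rpow_le_rpow_of_nonpos hD0 hL2.le (by linarith)
    _ = C₁ * dyadicGrowth p D + 1 / (1 - (2 : ℝ) ^ (-q)) * D ^ p := by
        rw [← mul_assoc, ← Real.rpow_add hD0, mul_comm (D ^ _)]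
        congr 3; ring
    _ ≤ C₁ * dyadicGrowth p D + 1 / (1 - (2 : ℝ) ^ (-q)) * (c * dyadicGrowth p D) := by
        gcongr
        exact hone D hD
    _ = _ := by ring

/-- The coefficients in the dyadic Gaussian decomposition of `ρ ^ (-α)`. -/
noncomputable def dyadCoeff (α : ℝ) (j : ℕ) : ℝ :=
  if α = 0 then (if j = 0 then 1 else 0) else (2 : ℝ) ^ (α * j)

theorem dyadCoeff_nonneg (α : ℝ) (j : ℕ) : 0 ≤ dyadCoeff α j := by
  unfold dyadCoeff; split_ifs <;> positivity

theorem dyadCoeff_zero (α : ℝ) : dyadCoeff α 0 = 1 := by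
  simp [dyadCoeff]

theorem dyadCoeff_le {α : ℝ} (j : ℕ) : dyadCoeff α j ≤ (2 : ℝ) ^ (α * j) := by
  unfold dyadCoeff
  split_ifs with h1 h2
  · simp [h1]
  · positivity
  · exact le_rfl

theorem capFactor_dyadic_le {δ : ℝ} (j : ℕ) :
    capFactor (δ * 2 ^ j) ≤ (1 / δ) * (2 : ℝ) ^ (-(j : ℝ)) := by
  refine (min_le_right _ _).trans (le_of_eq ?_)
  rw [Real.rpow_neg (by norm_num), Real.rpow_natCast, mul_inv, one_div]

theorem capFactor_dyadic_nonneg {δ : ℝ} (hδ : 0 < δ) (j : ℕ) : 0 ≤ capFactor (δ * 2 ^ j) :=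
  (capFactor_pos (by positivity)).le

/-- The first bound ignores the cap and serves indices with `2^n ≤ 1/δ`; the second uses the cap,
whose decay wins because `α < q`. For `α = 0` both must be `O(1)`, which is why `dyadCoeff 0` keeps
the single term `j = 0`: unit coefficients at all scales would cost a logarithm. -/
theorem exists_sum_dyadCoeff_le {α : ℝ} (hα : 0 ≤ α) {q : ℕ} (hq : α < q) :
    ∃ C : ℝ, 0 < C ∧ ∀ δ : ℝ, 0 < δ → δ ≤ 1 / 2 → ∀ n : ℕ,
      ∑ j ∈ Finset.range (n + 1), dyadCoeff α j * capFactor (δ * 2 ^ j) ^ q ≤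
          C * (2 : ℝ) ^ (α * n) ∧
      ∑ j ∈ Finset.range (n + 1), dyadCoeff α j * capFactor (δ * 2 ^ j) ^ q ≤ C * (1 / δ) ^ α := by
  rcases hα.eq_or_lt with h0 | h0
  · refine ⟨1, one_pos, fun δ hδ hδ' n => ?_⟩
    have : ∑ j ∈ Finset.range (n + 1), dyadCoeff α j * capFactor (δ * 2 ^ j) ^ q ≤ 1 := by
      rw [Finset.sum_eq_single_of_mem 0 (by simp)]
      · rw [dyadCoeff_zero, one_mul]
        exact pow_le_one₀ (capFactor_dyadic_nonneg hδ 0) (capFactor_le_one _)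
      · intro j _ hj
        simp [dyadCoeff, ← h0, hj]
    simpa [← h0] using this
  · obtain ⟨C, hC, h⟩ := exists_sum_dyadic_le α (q := q - α) (by linarith)
    have h1 : 1 < (2 : ℝ) ^ α := Real.one_lt_rpow one_lt_two h0
    have h2 : 0 < (2 : ℝ) ^ α - 1 := by linarith
    refine ⟨max C ((2 : ℝ) ^ α / ((2 : ℝ) ^ α - 1)), lt_max_of_lt_left hC,
      fun δ hδ hδ' n => ⟨?_, ?_⟩⟩
    · have h3 : ∀ j ∈ Finset.range (n + 1), dyadCoeff α j * capFactor (δ * 2 ^ j) ^ q ≤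
          ((2 : ℝ) ^ α) ^ j := by
        intro j _
        rw [← Real.rpow_natCast ((2 : ℝ) ^ α), ← Real.rpow_mul (by norm_num)]
        exact (mul_le_of_le_one_right (dyadCoeff_nonneg _ _)
          (pow_le_one₀ (capFactor_dyadic_nonneg hδ j) (capFactor_le_one _))).trans (dyadCoeff_le j)
      refine (Finset.sum_le_sum h3).trans ?_
      refine le_trans ?_ (mul_le_mul_of_nonneg_right (le_max_right _ _) (by positivity))
      rw [geom_sum_eq h1.ne', div_mul_eq_mul_div, Real.rpow_mul (by norm_num), Real.rpow_natCast,
        pow_succ, mul_comm]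
      gcongr
      linarith
    · have hD : 2 ≤ 1 / δ := by rw [le_div_iff₀ hδ]; linarith
      refine (h (1 / δ) hD _ (fun j => ?_) (fun j => ?_) (n + 1)).trans ?_
      · exact (mul_le_of_le_one_right (dyadCoeff_nonneg _ _)
          (pow_le_one₀ (capFactor_dyadic_nonneg hδ j) (capFactor_le_one _))).trans (dyadCoeff_le j)
      · calc dyadCoeff α j * capFactor (δ * 2 ^ j) ^ q
            ≤ (2 : ℝ) ^ (α * j) * ((1 / δ) * (2 : ℝ) ^ (-(j : ℝ))) ^ q := by
              gcongr
              · exact pow_nonneg (capFactor_dyadic_nonneg hδ j) q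
              · exact dyadCoeff_le j
              · exact capFactor_dyadic_nonneg hδ j
              · exact capFactor_dyadic_le j
          _ = _ := by
              rw [mul_pow, ← Real.rpow_natCast ((2 : ℝ) ^ (-(j : ℝ))),
                ← Real.rpow_mul (by norm_num), mul_left_comm, ← Real.rpow_add (by norm_num),
                add_sub_cancel, Real.rpow_natCast]
              congr 2; ring
      · rw [dyadicGrowth, if_neg h0.le.not_gt, if_neg h0.ne']
        gcongr
        exact le_max_left _ _

theorem coneFactor_sq {δ : ℝ} (hδ : 0 < δ) (hδ' : δ ≤ 1 / 2) (α β : ℝ) :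
    coneFactor δ α β ^ 2 = δ * dyadicGrowth (α + β - 1) (1 / δ) := by
  have hlog : 0 ≤ Real.log (1 / δ) := Real.log_nonneg (by rw [le_div_iff₀ hδ]; linarith)
  have hsq : (δ ^ (1 / 2 : ℝ)) ^ 2 = δ := by
    rw [← Real.sqrt_eq_rpow, Real.sq_sqrt hδ.le]
  unfold coneFactor dyadicGrowth
  rcases lt_trichotomy (α + β) 1 with h | h | h
  · rw [if_pos h, if_pos (by linarith), hsq, mul_one]
  · rw [if_neg (by linarith), if_pos h, if_neg (by linarith), if_pos (by linarith), mul_pow, hsq,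
      ← Real.sqrt_eq_rpow, Real.sq_sqrt hlog]
  · rw [if_neg (by linarith), if_neg (by linarith), if_neg (by linarith), if_neg (by linarith),
      one_div, Real.inv_rpow hδ.le, ← Real.rpow_neg hδ.le]
    nth_rewrite 2 [← Real.rpow_one δ]
    rw [← Real.rpow_add hδ, ← Real.rpow_natCast, ← Real.rpow_mul hδ.le]
    congr 1
    push_cast
    ring

theorem coneFactor_nonneg {δ : ℝ} (hδ : 0 < δ) (hδ' : δ ≤ 1 / 2) (α β : ℝ) :
    0 ≤ coneFactor δ α β := by
  have hlog : 0 ≤ Real.log (1 / δ) := Real.log_nonneg (by rw [le_div_iff₀ hδ]; linarith)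
  unfold coneFactor
  split_ifs <;> positivity

theorem capBound_nonneg {d : ℕ} {r s : ℝ} (hr : 0 < r) (hs : 0 < s) : 0 ≤ capBound d r s := by
  have := capFactor_pos hr
  have := capFactor_pos hs
  unfold capBound
  positivity

/-- The double dyadic sum of Schur bounds has the size of the square of `coneFactor`. -/
theorem exists_sum_capBound_le {d : ℕ} {α β : ℝ} (hα : 0 ≤ α) (hαd : α < d) (hβ : 0 ≤ β)
    (hβ1 : β < 1) :
    ∃ C : ℝ, 0 < C ∧ ∀ δ : ℝ, 0 < δ → δ ≤ 1 / 2 → ∀ n : ℕ,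
      ∑ j ∈ Finset.range n, ∑ k ∈ Finset.range n,
        dyadCoeff α j * dyadCoeff β k * (δ ^ 2 * capBound d (δ * 2 ^ j) (δ * 2 ^ k)) ≤
      C * coneFactor δ α β ^ 2 := by
  have hd : 0 < d := by
    rw [← Nat.cast_pos (α := ℝ)]; linarith
  obtain ⟨C₁, hC₁, hα'⟩ := exists_sum_dyadCoeff_le hα hαd
  obtain ⟨C₂, hC₂, hβ'⟩ := exists_sum_dyadCoeff_le hβ (q := 1) (by simpa using hβ1)
  obtain ⟨C₃, hC₃, h3⟩ := exists_sum_dyadic_le (α + β - 1) (q := d - α) (by linarith)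
  obtain ⟨C₄, hC₄, h4⟩ := exists_sum_dyadic_le (α + β - 1) (q := 1 - β) (by linarith)
  -- `C₁`, `C₂` control the inner sums over the smaller index; `C₃`, `C₄` control the outer sums,
  -- whose decay rates past the threshold are `d - α` and `1 - β`.
  refine ⟨C₂ * C₃ + C₁ * C₄, by positivity, fun δ hδ hδ' n => ?_⟩
  have hD : 2 ≤ 1 / δ := by rw [le_div_iff₀ hδ]; linarith
  have hD0 : 0 < 1 / δ := by positivity
  set a := dyadCoeff α with ha
  set b := dyadCoeff β with hb
  set M : ℕ → ℝ := fun j => capFactor (δ * 2 ^ j) with hM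
  have hM0 : ∀ j, 0 ≤ M j := capFactor_dyadic_nonneg hδ
  have hM1 : ∀ j, M j ≤ 1 := fun j => capFactor_le_one _
  have hM2 : ∀ j : ℕ, M j ≤ (1 / δ) * (2 : ℝ) ^ (-(j : ℝ)) := capFactor_dyadic_le
  have ha0 : ∀ j, 0 ≤ a j := dyadCoeff_nonneg α
  have hb0 : ∀ j, 0 ≤ b j := dyadCoeff_nonneg β
  have htwo : ∀ j : ℕ, ((2 : ℝ) ^ j)⁻¹ = (2 : ℝ) ^ (-(j : ℝ)) := fun j => by
    rw [Real.rpow_neg (by norm_num), Real.rpow_natCast]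
  set x : ℕ → ℕ → ℝ := fun j k => δ * ((a j * (2 : ℝ) ^ (-(j : ℝ)) * M j ^ (d - 1)) * (b k * M k))
  set y : ℕ → ℕ → ℝ := fun j k => δ * ((b k * (2 : ℝ) ^ (-(k : ℝ))) * (a j * M j ^ d))
  have hx0 : ∀ j k, 0 ≤ x j k := fun j k => by
    have := hM0 j; have := hM0 k; have := ha0 j; have := hb0 k
    positivity
  have hy0 : ∀ j k, 0 ≤ y j k := fun j k => by
    have := hM0 j; have := hM0 k; have := ha0 j; have := hb0 k
    positivity
  -- Of the two entries in `capBound`, the one dividing by the larger width is chosen: `r⁻¹` when `k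
  -- ≤ j`, `s⁻¹` when `j ≤ k`. The diagonal may be counted twice.
  have hterm : ∀ j k, a j * b k * (δ ^ 2 * capBound d (δ * 2 ^ j) (δ * 2 ^ k)) ≤
      (if k ∈ Finset.range (j + 1) then x j k else 0) +
        (if j ∈ Finset.range (k + 1) then y j k else 0) := by
    intro j k
    have e1 : a j * b k * (δ ^ 2 * capBound d (δ * 2 ^ j) (δ * 2 ^ k)) ≤ x j k := by
      calc _ ≤ a j * b k * (δ ^ 2 * ((δ * 2 ^ j)⁻¹ * M j ^ (d - 1) * M k)) :=
            mul_le_mul_of_nonneg_left (mul_le_mul_of_nonneg_left (min_le_left _ _)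
              (by positivity)) (mul_nonneg (ha0 j) (hb0 k))
        _ = x j k := by
            simp only [x]
            rw [mul_inv, htwo]
            field_simp
    have e2 : a j * b k * (δ ^ 2 * capBound d (δ * 2 ^ j) (δ * 2 ^ k)) ≤ y j k := by
      calc _ ≤ a j * b k * (δ ^ 2 * ((δ * 2 ^ k)⁻¹ * M j ^ d)) :=
            mul_le_mul_of_nonneg_left (mul_le_mul_of_nonneg_left (min_le_right _ _)
              (by positivity)) (mul_nonneg (ha0 j) (hb0 k))
        _ = y j k := by
            simp only [y]
            rw [mul_inv, htwo]
            field_simp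
    rcases le_total k j with h | h
    · rw [if_pos (Finset.mem_range.2 (by omega))]
      refine e1.trans (le_add_of_nonneg_right ?_)
      split_ifs
      exacts [hy0 j k, le_rfl]
    · rw [if_pos (c := j ∈ Finset.range (k + 1)) (Finset.mem_range.2 (by omega))]
      refine e2.trans (le_add_of_nonneg_left ?_)
      split_ifs
      exacts [hx0 j k, le_rfl]
  have hrestrict : ∀ (i : ℕ) (z : ℕ → ℝ), (∀ j, 0 ≤ z j) →
      ∑ j ∈ Finset.range n, (if j ∈ Finset.range (i + 1) then z j else 0) ≤
        ∑ j ∈ Finset.range (i + 1), z j := by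
    intro i z hz
    rw [← Finset.sum_filter]
    exact Finset.sum_le_sum_of_subset_of_nonneg
      (fun j hj => (Finset.mem_filter.1 hj).2) fun j _ _ => hz j
  have hX : ∑ j ∈ Finset.range n, ∑ k ∈ Finset.range n,
      (if k ∈ Finset.range (j + 1) then x j k else 0) ≤
      δ * (C₂ * (C₃ * dyadicGrowth (α + β - 1) (1 / δ))) := by
    -- The inserted `C₂ * C₂⁻¹` normalises the inner sum, so that `h3` applies with constant one in
    -- its two hypotheses.
    have hin : ∀ j, ∑ k ∈ Finset.range n, (if k ∈ Finset.range (j + 1) then x j k else 0) ≤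
        δ * (C₂ * (C₂⁻¹ * ((a j * (2 : ℝ) ^ (-(j : ℝ)) * M j ^ (d - 1)) *
          ∑ k ∈ Finset.range (j + 1), b k * M k))) := by
      intro j
      refine (hrestrict j (x j) (hx0 j)).trans (le_of_eq ?_)
      simp only [x]
      rw [← Finset.mul_sum, ← Finset.mul_sum]
      field_simp
    refine (Finset.sum_le_sum fun j _ => hin j).trans ?_
    rw [← Finset.mul_sum, ← Finset.mul_sum]
    gcongr
    have hS := fun j => hβ' δ hδ hδ' j
    simp only [pow_one] at hS
    have hsum0 : ∀ j, 0 ≤ ∑ k ∈ Finset.range (j + 1), b k * M k := fun j =>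
      Finset.sum_nonneg fun k _ => mul_nonneg (hb0 k) (hM0 k)
    refine h3 (1 / δ) hD _ (fun j => ?_) (fun j => ?_) n
    · calc C₂⁻¹ * ((a j * (2 : ℝ) ^ (-(j : ℝ)) * M j ^ (d - 1)) *
            ∑ k ∈ Finset.range (j + 1), b k * M k)
          ≤ C₂⁻¹ * (((2 : ℝ) ^ (α * j) * (2 : ℝ) ^ (-(j : ℝ)) * 1) *
              (C₂ * (2 : ℝ) ^ (β * j))) := by
            gcongr
            · exact hsum0 j
            · exact pow_nonneg (hM0 j) _
            · exact dyadCoeff_le j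
            · exact pow_le_one₀ (hM0 j) (hM1 j)
            · exact (hS j).1
        _ = _ := by
            have : (2 : ℝ) ^ ((α + β - 1) * j) =
                (2 : ℝ) ^ (α * j) * (2 : ℝ) ^ (-(j : ℝ)) * (2 : ℝ) ^ (β * j) := by
              rw [← Real.rpow_add (by norm_num), ← Real.rpow_add (by norm_num)]
              congr 1; ring
            rw [this]
            field_simp
    · calc C₂⁻¹ * ((a j * (2 : ℝ) ^ (-(j : ℝ)) * M j ^ (d - 1)) *
            ∑ k ∈ Finset.range (j + 1), b k * M k)
          ≤ C₂⁻¹ * (((2 : ℝ) ^ (α * j) * (2 : ℝ) ^ (-(j : ℝ)) *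
              ((1 / δ) * (2 : ℝ) ^ (-(j : ℝ))) ^ (d - 1)) * (C₂ * (1 / δ) ^ β)) := by
            gcongr
            · exact hsum0 j
            · exact pow_nonneg (hM0 j) _
            · exact dyadCoeff_le j
            · exact hM0 j
            · exact hM2 j
            · exact (hS j).2
        _ = _ := by
            have hdc : ((d - 1 : ℕ) : ℝ) = d - 1 := by
              rw [Nat.cast_sub hd, Nat.cast_one]
            have e1 : (2 : ℝ) ^ (-(d - α) * j) = (2 : ℝ) ^ (α * j) * (2 : ℝ) ^ (-(j : ℝ)) *
                ((2 : ℝ) ^ (-(j : ℝ))) ^ (d - 1) := by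
              rw [← Real.rpow_natCast ((2 : ℝ) ^ (-(j : ℝ))), ← Real.rpow_mul (by norm_num),
                ← Real.rpow_add (by norm_num), ← Real.rpow_add (by norm_num), hdc]
              congr 1; ring
            have e2 : (1 / δ) ^ (α + β - 1 + (d - α)) = (1 / δ) ^ (d - 1) * (1 / δ) ^ β := by
              rw [← Real.rpow_natCast, ← Real.rpow_add hD0, hdc]
              congr 1; ring
            rw [e1, e2, mul_pow]
            field_simp
  have hY : ∑ j ∈ Finset.range n, ∑ k ∈ Finset.range n,
      (if j ∈ Finset.range (k + 1) then y j k else 0) ≤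
      δ * (C₁ * (C₄ * dyadicGrowth (α + β - 1) (1 / δ))) := by
    rw [Finset.sum_comm]
    have hin : ∀ k, ∑ j ∈ Finset.range n, (if j ∈ Finset.range (k + 1) then y j k else 0) ≤
        δ * (C₁ * (C₁⁻¹ * ((b k * (2 : ℝ) ^ (-(k : ℝ))) *
          ∑ j ∈ Finset.range (k + 1), a j * M j ^ d))) := by
      intro k
      refine (hrestrict k (fun j => y j k) (fun j => hy0 j k)).trans (le_of_eq ?_)
      simp only [y]
      rw [← Finset.mul_sum, ← Finset.mul_sum]
      field_simp
    refine (Finset.sum_le_sum fun j _ => hin j).trans ?_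
    rw [← Finset.mul_sum, ← Finset.mul_sum]
    gcongr
    have hS := fun j => hα' δ hδ hδ' j
    have hsum0 : ∀ k, 0 ≤ ∑ j ∈ Finset.range (k + 1), a j * M j ^ d := fun k =>
      Finset.sum_nonneg fun j _ => mul_nonneg (ha0 j) (pow_nonneg (hM0 j) d)
    refine h4 (1 / δ) hD _ (fun k => ?_) (fun k => ?_) n
    · calc C₁⁻¹ * ((b k * (2 : ℝ) ^ (-(k : ℝ))) * ∑ j ∈ Finset.range (k + 1), a j * M j ^ d)
          ≤ C₁⁻¹ * (((2 : ℝ) ^ (β * k) * (2 : ℝ) ^ (-(k : ℝ))) * (C₁ * (2 : ℝ) ^ (α * k))) := by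
            gcongr
            · exact hsum0 k
            · exact dyadCoeff_le k
            · exact (hS k).1
        _ = _ := by
            have : (2 : ℝ) ^ ((α + β - 1) * k) =
                (2 : ℝ) ^ (β * k) * (2 : ℝ) ^ (-(k : ℝ)) * (2 : ℝ) ^ (α * k) := by
              rw [← Real.rpow_add (by norm_num), ← Real.rpow_add (by norm_num)]
              congr 1; ring
            rw [this]
            field_simp
    · calc C₁⁻¹ * ((b k * (2 : ℝ) ^ (-(k : ℝ))) * ∑ j ∈ Finset.range (k + 1), a j * M j ^ d)
          ≤ C₁⁻¹ * (((2 : ℝ) ^ (β * k) * (2 : ℝ) ^ (-(k : ℝ))) * (C₁ * (1 / δ) ^ α)) := by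
            gcongr
            · exact hsum0 k
            · exact dyadCoeff_le k
            · exact (hS k).2
        _ = _ := by
            have e1 : (2 : ℝ) ^ (-(1 - β) * k) = (2 : ℝ) ^ (β * k) * (2 : ℝ) ^ (-(k : ℝ)) := by
              rw [← Real.rpow_add (by norm_num)]
              congr 1; ring
            have e2 : α + β - 1 + (1 - β) = α := by ring
            rw [e1, e2]
            field_simp
  calc _ ≤ ∑ j ∈ Finset.range n, ∑ k ∈ Finset.range n,
        ((if k ∈ Finset.range (j + 1) then x j k else 0) +
          (if j ∈ Finset.range (k + 1) then y j k else 0)) :=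
        Finset.sum_le_sum fun j _ => Finset.sum_le_sum fun k _ => hterm j k
    _ ≤ δ * (C₂ * (C₃ * dyadicGrowth (α + β - 1) (1 / δ))) +
        δ * (C₁ * (C₄ * dyadicGrowth (α + β - 1) (1 / δ))) := by
        simp_rw [Finset.sum_add_distrib]
        exact add_le_add hX hY
    _ = _ := by rw [coneFactor_sq hδ hδ']; ring

theorem exists_tsum_capBound_le {d : ℕ} {α β : ℝ} (hα : 0 ≤ α) (hαd : α < d) (hβ : 0 ≤ β)
    (hβ1 : β < 1) :
    ∃ C : ℝ, 0 < C ∧ ∀ δ : ℝ, 0 < δ → δ ≤ 1 / 2 →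
      ∑' p : ℕ × ℕ, ENNReal.ofReal
        (dyadCoeff α p.1 * dyadCoeff β p.2 * (δ ^ 2 * capBound d (δ * 2 ^ p.1) (δ * 2 ^ p.2))) ≤
      ENNReal.ofReal (C * coneFactor δ α β ^ 2) := by
  obtain ⟨C, hC, h⟩ := exists_sum_capBound_le hα hαd hβ hβ1
  refine ⟨C, hC, fun δ hδ hδ' => ?_⟩
  rw [ENNReal.tsum_eq_iSup_sum]
  refine iSup_le fun s => ?_
  have h0 : ∀ p : ℕ × ℕ, 0 ≤ dyadCoeff α p.1 * dyadCoeff β p.2 *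
      (δ ^ 2 * capBound d (δ * 2 ^ p.1) (δ * 2 ^ p.2)) := fun p => by
    have h1 := dyadCoeff_nonneg α p.1
    have h2 := dyadCoeff_nonneg β p.2
    have h3 : 0 ≤ capBound d (δ * 2 ^ p.1) (δ * 2 ^ p.2) :=
      capBound_nonneg (by positivity) (by positivity)
    positivity
  rw [← ENNReal.ofReal_sum_of_nonneg fun p _ => h0 p]
  refine ENNReal.ofReal_le_ofReal ?_
  -- Every pair in the finite set `s` lies in the square `range n × range n`.
  set n := s.sup (fun p => max p.1 p.2) + 1
  refine le_trans (Finset.sum_le_sum_of_subset_of_nonneg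
    (t := Finset.range n ×ˢ Finset.range n) (fun p hp => ?_) fun p _ _ => h0 p) ?_
  · have := Finset.le_sup (f := fun p : ℕ × ℕ => max p.1 p.2) hp
    simp only [Finset.mem_product, Finset.mem_range, n]
    simp only [max_le_iff] at this
    omega
  · rw [Finset.sum_product]
    exact h δ hδ hδ' n

end DyadicSums

/-! ### Majorising the power weight by dyadic Gaussians on a box -/

section WeightMajorant

/-- For `ρ ≤ 1` choose `2^j ≤ ρ⁻¹ < 2^(j+1)`: then `ρ^(-α)` is comparable to `2^(αj)`, while `2^j ρ
≤ 1` keeps the Gaussian bounded below. For `1 ≤ ρ ≤ R` the scale `j = 0` suffices. -/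
theorem exists_rpow_neg_le_dyadic {α R ρ : ℝ} (hα : 0 ≤ α) (hR : 1 ≤ R) (hρ : 0 ≤ ρ) (hρR : ρ ≤ R) :
    ∃ j : ℕ, ρ ^ (-α) ≤ (2 : ℝ) ^ α * Real.exp (Real.pi * R ^ 2) *
      (dyadCoeff α j * Real.exp (-Real.pi * (2 ^ j * ρ) ^ 2)) := by
  have hbase : ∀ s : ℝ, 0 ≤ s → s ≤ R →
      1 ≤ Real.exp (Real.pi * R ^ 2) * Real.exp (-Real.pi * s ^ 2) := by
    intro s hs hsR
    rw [← Real.exp_add]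
    refine Real.one_le_exp ?_
    have : s ^ 2 ≤ R ^ 2 := pow_le_pow_left₀ hs hsR 2
    nlinarith [Real.pi_pos]
  have h2α : 1 ≤ (2 : ℝ) ^ α := Real.one_le_rpow one_le_two hα
  have hzero : ρ ^ (-α) ≤ 1 → ρ ^ (-α) ≤ (2 : ℝ) ^ α * Real.exp (Real.pi * R ^ 2) *
      (dyadCoeff α 0 * Real.exp (-Real.pi * (2 ^ 0 * ρ) ^ 2)) := by
    intro h
    rw [dyadCoeff_zero, one_mul, pow_zero, one_mul, mul_assoc]
    exact h.trans (one_le_mul_of_one_le_of_one_le h2α (hbase ρ hρ hρR))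
  rcases hα.eq_or_lt with h0 | h0
  · exact ⟨0, hzero (by rw [← h0]; simp)⟩
  rcases hρ.eq_or_lt with h1 | h1
  -- In `Real.rpow`, zero to a nonzero power is zero, so the singular point needs no large scale.
  · exact ⟨0, hzero (by rw [← h1, Real.zero_rpow (by linarith)]; norm_num)⟩
  rcases le_total 1 ρ with h2 | h2
  · exact ⟨0, hzero (Real.rpow_le_one_of_one_le_of_nonpos h2 (by linarith))⟩
  obtain ⟨j, hj1, hj2⟩ := exists_nat_pow_near (show 1 ≤ ρ⁻¹ from (one_le_inv₀ h1).2 h2) one_lt_two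
  refine ⟨j, ?_⟩
  have h3 : ρ ^ (-α) ≤ (2 : ℝ) ^ α * (2 : ℝ) ^ (α * j) := by
    rw [Real.rpow_neg hρ, ← Real.inv_rpow hρ, ← Real.rpow_add (by norm_num)]
    calc ρ⁻¹ ^ α ≤ ((2 : ℝ) ^ (j + 1)) ^ α :=
          Real.rpow_le_rpow (by positivity) hj2.le hα
      _ = _ := by
          rw [← Real.rpow_natCast, ← Real.rpow_mul (by norm_num)]
          congr 1; push_cast; ring
  have h4 : 2 ^ j * ρ ≤ R := by
    refine le_trans ?_ hR
    calc 2 ^ j * ρ ≤ ρ⁻¹ * ρ := by gcongr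
      _ = 1 := inv_mul_cancel₀ h1.ne'
  have h5 := hbase (2 ^ j * ρ) (by positivity) h4
  rw [dyadCoeff, if_neg h0.ne']
  calc ρ ^ (-α) ≤ (2 : ℝ) ^ α * (2 : ℝ) ^ (α * j) * 1 := by rw [mul_one]; exact h3
    _ ≤ (2 : ℝ) ^ α * (2 : ℝ) ^ (α * j) *
        (Real.exp (Real.pi * R ^ 2) * Real.exp (-Real.pi * (2 ^ j * ρ) ^ 2)) := by gcongr
    _ = _ := by ring

/-- On a ball of radius `R / δ` a power weight is dominated by its average times a dyadic sum of
Gaussians with a common centre. -/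
theorem exists_norm_rpow_neg_le {F : Type*} [SeminormedAddCommGroup F] {α R : ℝ} (hα : 0 ≤ α)
    (hR : 1 ≤ R) :
    ∃ C : ℝ, 0 < C ∧ ∀ δ : ℝ, 0 < δ → ∀ c : F, ∃ a : F, ∀ x : F, ‖x - c‖ ≤ R / δ →
      ∃ j : ℕ, ‖x‖ ^ (-α) ≤ C * (max (1 / δ) ‖c‖) ^ (-α) *
        (dyadCoeff α j * Real.exp (-Real.pi * (δ * 2 ^ j * ‖x - a‖) ^ 2)) := by
  refine ⟨(2 * R) ^ α * ((2 : ℝ) ^ α * Real.exp (Real.pi * (3 * R) ^ 2)), by positivity,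
    fun δ hδ c => ?_⟩
  have hmax : 0 < max (1 / δ) ‖c‖ := lt_max_of_lt_left (by positivity)
  have h2α : 1 ≤ (2 : ℝ) ^ α := Real.one_le_rpow one_le_two hα
  rcases le_total ‖c‖ (2 * R / δ) with hc | hc
  -- Near the singularity, `|x| ≤ 3R/δ`: the Gaussians are centred at the origin and the dyadic
  -- bound is applied to `δ|x|` at radius `3R`. The factor `(2R)^α` in the constant compensates for
  -- `max (1/δ) |c| ≤ 2R/δ`.
  · refine ⟨0, fun x hx => ?_⟩
    have hx3 : δ * ‖x‖ ≤ 3 * R := by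
      have : ‖x‖ ≤ 3 * R / δ := by
        calc ‖x‖ = ‖(x - c) + c‖ := by rw [sub_add_cancel]
          _ ≤ R / δ + 2 * R / δ := (norm_add_le _ _).trans (add_le_add hx hc)
          _ = _ := by ring
      rw [le_div_iff₀ hδ] at this
      linarith
    obtain ⟨j, hj⟩ := exists_rpow_neg_le_dyadic hα (by linarith : 1 ≤ 3 * R) (by positivity) hx3
    refine ⟨j, ?_⟩
    rw [Real.mul_rpow hδ.le (norm_nonneg _)] at hj
    have h1 : ‖x‖ ^ (-α) = δ ^ α * (δ ^ (-α) * ‖x‖ ^ (-α)) := by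
      rw [← mul_assoc, ← Real.rpow_add hδ, add_neg_cancel, Real.rpow_zero, one_mul]
    have h2 : δ ^ α ≤ (2 * R) ^ α * (max (1 / δ) ‖c‖) ^ (-α) := by
      have hle : max (1 / δ) ‖c‖ ≤ 2 * R / δ := by
        refine max_le ?_ hc
        gcongr
        linarith
      calc δ ^ α = (2 * R) ^ α * (2 * R / δ) ^ (-α) := by
            rw [Real.rpow_neg (by positivity), ← Real.inv_rpow (by positivity), inv_div,
              ← Real.mul_rpow (by positivity) (by positivity)]
            congr 1
            field_simp
        _ ≤ _ := mul_le_mul_of_nonneg_left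
            (Real.rpow_le_rpow_of_nonpos hmax hle (by linarith)) (by positivity)
    rw [h1, sub_zero]
    calc δ ^ α * (δ ^ (-α) * ‖x‖ ^ (-α)) ≤ ((2 * R) ^ α * (max (1 / δ) ‖c‖) ^ (-α)) *
          ((2 : ℝ) ^ α * Real.exp (Real.pi * (3 * R) ^ 2) *
            (dyadCoeff α j * Real.exp (-Real.pi * (2 ^ j * (δ * ‖x‖)) ^ 2))) := by
          refine mul_le_mul h2 hj (by positivity) (by positivity)
      _ = _ := by
          rw [show 2 ^ j * (δ * ‖x‖) = δ * 2 ^ j * ‖x‖ by ring]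
          ring
  -- Far from the singularity the weight is essentially constant, since `|x| ≥ |c|/2`; a single
  -- Gaussian centred at `c` is enough.
  · refine ⟨c, fun x hx => ⟨0, ?_⟩⟩
    have hRδ : 0 < R / δ := by positivity
    have hc' : 2 * (R / δ) ≤ ‖c‖ := by rw [← mul_div_assoc]; exact hc
    have hmaxc : max (1 / δ) ‖c‖ = ‖c‖ := by
      refine max_eq_right (le_trans ?_ hc')
      have : 1 / δ ≤ R / δ := by gcongr
      linarith
    have hcpos : 0 < ‖c‖ := by linarith
    have hxc : ‖c‖ / 2 ≤ ‖x‖ := by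
      have := norm_sub_norm_le c x
      rw [norm_sub_rev] at this
      linarith
    have h1 : ‖x‖ ^ (-α) ≤ (2 : ℝ) ^ α * ‖c‖ ^ (-α) := by
      calc ‖x‖ ^ (-α) ≤ (‖c‖ / 2) ^ (-α) :=
            Real.rpow_le_rpow_of_nonpos (by positivity) hxc (by linarith)
        _ = _ := by
            rw [Real.div_rpow hcpos.le (by norm_num), Real.rpow_neg (by norm_num : (0 : ℝ) ≤ 2),
              div_inv_eq_mul, mul_comm]
    have hδx : δ * ‖x - c‖ ≤ R := by
      rw [le_div_iff₀ hδ] at hx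
      linarith
    have h2 : 1 ≤ Real.exp (Real.pi * (3 * R) ^ 2) * Real.exp (-Real.pi * (δ * ‖x - c‖) ^ 2) := by
      rw [← Real.exp_add]
      refine Real.one_le_exp ?_
      have : (δ * ‖x - c‖) ^ 2 ≤ R ^ 2 := pow_le_pow_left₀ (by positivity) hδx 2
      nlinarith [Real.pi_pos, sq_nonneg R]
    have h3 : 1 ≤ (2 * R) ^ α := Real.one_le_rpow (by linarith) hα
    rw [hmaxc, dyadCoeff_zero, pow_zero, mul_one, one_mul]
    calc ‖x‖ ^ (-α) ≤ 1 * ((2 : ℝ) ^ α * ‖c‖ ^ (-α)) * 1 := by rw [one_mul, mul_one]; exact h1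
      _ ≤ (2 * R) ^ α * ((2 : ℝ) ^ α * ‖c‖ ^ (-α)) *
          (Real.exp (Real.pi * (3 * R) ^ 2) * Real.exp (-Real.pi * (δ * ‖x - c‖) ^ 2)) := by
          gcongr
      _ = _ := by ring

/-- The size of the cone weight on the box of side `1 / δ` around `c`. -/
noncomputable def boxWeight {d : ℕ} (δ α β : ℝ) (c : Euc (d + 1)) : ℝ :=
  (max (1 / δ) ‖headPart c‖) ^ (-α) * (max (1 / δ) |lastPart c|) ^ (-β)

theorem boxWeight_pos {d : ℕ} {δ : ℝ} (hδ : 0 < δ) (α β : ℝ) (c : Euc (d + 1)) :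
    0 < boxWeight δ α β c := by
  have h1 : 0 < max (1 / δ) ‖headPart c‖ := lt_max_of_lt_left (by positivity)
  have h2 : 0 < max (1 / δ) |lastPart c| := lt_max_of_lt_left (by positivity)
  unfold boxWeight
  positivity

theorem headPart_sub {d : ℕ} (x y : Euc (d + 1)) : headPart (x - y) = headPart x - headPart y := by
  ext i; simp [headPart]

theorem lastPart_sub {d : ℕ} (x y : Euc (d + 1)) : lastPart (x - y) = lastPart x - lastPart y := by
  simp [lastPart]

theorem headPart_smul {d : ℕ} (s : ℝ) (x : Euc (d + 1)) : headPart (s • x) = s • headPart x := by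
  ext i; simp [headPart]

theorem lastPart_smul {d : ℕ} (s : ℝ) (x : Euc (d + 1)) : lastPart (s • x) = s * lastPart x := by
  simp [lastPart]

theorem norm_headPart_le {d : ℕ} (x : Euc (d + 1)) : ‖headPart x‖ ≤ ‖x‖ := by
  refine le_of_sq_le_sq ?_ (norm_nonneg _)
  rw [norm_headPart_sq, EuclideanSpace.norm_sq_eq, Fin.sum_univ_castSucc]
  simp only [Real.norm_eq_abs, sq_abs]
  nlinarith [sq_nonneg (x (Fin.last d))]

theorem abs_lastPart_le {d : ℕ} (x : Euc (d + 1)) : |lastPart x| ≤ ‖x‖ := by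
  have := PiLp.norm_apply_le x (Fin.last d)
  simpa [lastPart] using this

theorem norm_headPart_le_of_abs_le {d : ℕ} (hd : 0 < d) {x : Euc (d + 1)} {R : ℝ} (hR : 0 ≤ R)
    (h : ∀ i, |x i| ≤ R) : ‖headPart x‖ ≤ d * R := by
  have hd1 : (1 : ℝ) ≤ d := by exact_mod_cast hd
  refine le_of_sq_le_sq ?_ (by positivity)
  rw [norm_headPart_sq]
  calc ∑ i : Fin d, x i.castSucc ^ 2 ≤ ∑ _i : Fin d, R ^ 2 := by
        refine Finset.sum_le_sum fun i _ => ?_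
        rw [← sq_abs]
        exact pow_le_pow_left₀ (abs_nonneg _) (h _) 2
    _ = d * R ^ 2 := by simp
    _ ≤ d * d * R ^ 2 := by
        have : (d : ℝ) ≤ d * d := by nlinarith
        gcongr
    _ = _ := by ring

theorem gaussWeight_coneScale {d : ℕ} (r s : ℝ) (a x : Euc (d + 1)) :
    gaussWeight (coneScale d r s) a x = Real.exp (-Real.pi * (r * ‖headPart x - headPart a‖) ^ 2) *
      Real.exp (-Real.pi * (s * |lastPart x - lastPart a|) ^ 2) := by
  rw [gaussWeight, ← Real.exp_add, ← mul_add, Fin.sum_univ_castSucc, ← headPart_sub, mul_pow r,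
    norm_headPart_sq, mul_pow s, sq_abs, Finset.mul_sum]
  simp [mul_pow, lastPart]

/-- On a box of side `1 / δ` the cone weight is dominated by a dyadic sum of Gaussians. -/
theorem exists_coneWeight_le {d : ℕ} (hd : 0 < d) {α β : ℝ} (hα : 0 ≤ α) (hβ : 0 ≤ β) :
    ∃ C : ℝ, 0 < C ∧ ∀ δ : ℝ, 0 < δ → ∀ c : Euc (d + 1), ∃ a : Euc (d + 1), ∀ x : Euc (d + 1),
      (∀ i, |x i - c i| ≤ 1 / δ) →
      ENNReal.ofReal (coneWeight α β x) ≤ ENNReal.ofReal (C * boxWeight δ α β c) *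
        ∑' p : ℕ × ℕ, ENNReal.ofReal (dyadCoeff α p.1 * dyadCoeff β p.2) *
          ENNReal.ofReal (gaussWeight (coneScale d (δ * 2 ^ p.1) (δ * 2 ^ p.2)) a x) := by
  have hd1 : (1 : ℝ) ≤ d := by exact_mod_cast hd
  -- The radius is `d` because a box of half-side `1/δ` has its horizontal part in a Euclidean ball
  -- of radius `d/δ`.
  obtain ⟨C₁, hC₁, h₁⟩ := exists_norm_rpow_neg_le (F := Euc d) hα hd1
  obtain ⟨C₂, hC₂, h₂⟩ := exists_norm_rpow_neg_le (F := ℝ) hβ le_rfl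
  refine ⟨C₁ * C₂, by positivity, fun δ hδ c => ?_⟩
  obtain ⟨a₁, h₁⟩ := h₁ δ hδ (headPart c)
  obtain ⟨a₂, h₂⟩ := h₂ δ hδ (lastPart c)
  set a : Euc (d + 1) := WithLp.toLp 2 (Fin.snoc (fun i => a₁ i) a₂) with ha
  have hah : headPart a = a₁ := by ext i; simp [headPart, ha]
  have hal : lastPart a = a₂ := by simp [lastPart, ha]
  refine ⟨a, fun x hx => ?_⟩
  have hx1 : ‖headPart x - headPart c‖ ≤ d / δ := by
    rw [← headPart_sub, div_eq_mul_one_div]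
    exact norm_headPart_le_of_abs_le hd (by positivity) fun i => by simpa using hx i
  have hx2 : ‖lastPart x - lastPart c‖ ≤ 1 / δ := hx (Fin.last d)
  obtain ⟨j, hj⟩ := h₁ _ hx1
  obtain ⟨k, hk⟩ := h₂ _ hx2
  have hcj := dyadCoeff_nonneg α j
  have hck := dyadCoeff_nonneg β k
  have hw := boxWeight_pos hδ α β c
  calc ENNReal.ofReal (coneWeight α β x)
      ≤ ENNReal.ofReal (C₁ * C₂ * boxWeight δ α β c * ((dyadCoeff α j * dyadCoeff β k) *
          gaussWeight (coneScale d (δ * 2 ^ j) (δ * 2 ^ k)) a x)) := by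
        refine ENNReal.ofReal_le_ofReal ?_
        rw [gaussWeight_coneScale, hah, hal]
        refine (mul_le_mul hj hk (by positivity) ?_).trans (le_of_eq ?_)
        · have : 0 < max (1 / δ) ‖headPart c‖ := lt_max_of_lt_left (by positivity)
          positivity
        · simp only [boxWeight, Real.norm_eq_abs]
          ring
    _ = ENNReal.ofReal (C₁ * C₂ * boxWeight δ α β c) *
          (ENNReal.ofReal (dyadCoeff α j * dyadCoeff β k) *
          ENNReal.ofReal (gaussWeight (coneScale d (δ * 2 ^ j) (δ * 2 ^ k)) a x)) := by
        rw [ENNReal.ofReal_mul (p := C₁ * C₂ * boxWeight δ α β c) (by positivity),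
          ENNReal.ofReal_mul (p := dyadCoeff α j * dyadCoeff β k) (by positivity)]
    _ ≤ _ := by
        gcongr
        exact ENNReal.le_tsum (f := fun p : ℕ × ℕ => ENNReal.ofReal (dyadCoeff α p.1 *
          dyadCoeff β p.2) * ENNReal.ofReal
            (gaussWeight (coneScale d (δ * 2 ^ p.1) (δ * 2 ^ p.2)) a x)) (j, k)

/-- The weight of a box is controlled by the weight at a point, with polynomial loss in the
rescaled distance. -/
theorem boxWeight_le {d : ℕ} {δ α β : ℝ} (hδ : 0 < δ) (hα : 0 ≤ α) (hβ : 0 ≤ β)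
    (c y : Euc (d + 1)) (hy : headPart y ≠ 0) (hy' : lastPart y ≠ 0) :
    boxWeight δ α β c ≤ coneWeight α β y * (1 + ‖δ • (y - c)‖) ^ (α + β) := by
  -- Since `|v - u| ≤ T/δ`, the triangle inequality gives `|v| ≤ max (1/δ) |u| · (1 + T)`; the claim
  -- follows by taking negative powers.
  have key : ∀ {F : Type} [NormedAddCommGroup F] (γ : ℝ) (u v : F) (T : ℝ), 0 ≤ γ → v ≠ 0 →
      δ * ‖v - u‖ ≤ T →
      (max (1 / δ) ‖u‖) ^ (-γ) ≤ ‖v‖ ^ (-γ) * (1 + T) ^ γ := by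
    intro F _ γ u v T hγ hv hT
    have hmax : 0 < max (1 / δ) ‖u‖ := lt_max_of_lt_left (by positivity)
    have hv0 : 0 < ‖v‖ := norm_pos_iff.2 hv
    have hT0 : 0 ≤ T := le_trans (by positivity) hT
    have h1 : ‖v‖ ≤ max (1 / δ) ‖u‖ * (1 + T) := by
      have h2 : ‖v - u‖ ≤ max (1 / δ) ‖u‖ * T := by
        calc ‖v - u‖ = 1 / δ * (δ * ‖v - u‖) := by field_simp
          _ ≤ max (1 / δ) ‖u‖ * T := by
            gcongr
            exact le_max_left _ _
      have h3 : ‖v‖ ≤ ‖v - u‖ + ‖u‖ := by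
        simpa using norm_add_le (v - u) u
      have h4 : ‖u‖ ≤ max (1 / δ) ‖u‖ := le_max_right _ _
      linarith
    rw [Real.rpow_neg hmax.le, Real.rpow_neg hv0.le, inv_mul_eq_div, inv_eq_one_div,
      div_le_div_iff₀ (by positivity) (by positivity), one_mul, mul_comm,
      ← Real.mul_rpow hmax.le (by positivity)]
    exact Real.rpow_le_rpow hv0.le h1 hγ
  have hT : ∀ z : Euc (d + 1), δ * ‖z‖ = ‖δ • z‖ := fun z => by
    rw [norm_smul, Real.norm_of_nonneg hδ.le]
  have h1 := key α (headPart c) (headPart y) ‖δ • (y - c)‖ hα hy (by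
    rw [← hT, ← headPart_sub]; gcongr; exact norm_headPart_le _)
  have h2 := key β (lastPart c) (lastPart y) ‖δ • (y - c)‖ hβ hy' (by
    rw [← hT, ← lastPart_sub]; gcongr; exact abs_lastPart_le _)
  have hmax : 0 < max (1 / δ) |lastPart c| := lt_max_of_lt_left (by positivity)
  unfold boxWeight coneWeight
  rw [Real.rpow_add (by positivity)]
  simp only [Real.norm_eq_abs] at h2
  calc _ ≤ (‖headPart y‖ ^ (-α) * (1 + ‖δ • (y - c)‖) ^ α) *
        (|lastPart y| ^ (-β) * (1 + ‖δ • (y - c)‖) ^ β) := by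
        refine mul_le_mul h1 h2 (by positivity) (by positivity)
    _ = _ := by ring

end WeightMajorant

/-! ### Derivatives of the multiplier and moments of its kernel -/

section MultiplierDerivatives

variable {d : ℕ}

/-- `headPart` as a continuous linear map. -/
noncomputable def headPartL (d : ℕ) : Euc (d + 1) →L[ℝ] Euc d :=
  LinearMap.toContinuousLinearMap
    { toFun := headPart
      map_add' := fun x y => by ext i; simp [headPart]
      map_smul' := fun s x => headPart_smul s x }

/-- `lastPart` as a continuous linear map. -/
noncomputable def lastPartL (d : ℕ) : Euc (d + 1) →L[ℝ] ℝ :=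
  LinearMap.toContinuousLinearMap
    { toFun := lastPart
      map_add' := fun x y => by simp [lastPart]
      map_smul' := fun s x => lastPart_smul s x }

theorem contDiff_headPart : ContDiff ℝ ∞ (headPart : Euc (d + 1) → Euc d) :=
  (headPartL d).contDiff

theorem contDiff_lastPart : ContDiff ℝ ∞ (lastPart : Euc (d + 1) → ℝ) :=
  (lastPartL d).contDiff

theorem bump_eq_zero {ψ : ℝ → ℝ} (hψ : IsDyadicBump ψ) {s : ℝ} (hs : s ∉ Set.Icc (1 / 4 : ℝ) 1) :
    ψ s = 0 :=
  image_eq_zero_of_notMem_tsupport fun h => hs (hψ.supp h)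

theorem mem_coneShell_of_ne_zero {δ t : ℝ} (ht : t ∈ Set.Icc (1 : ℝ) 2) {B : ℕ → ℝ}
    {μ : Euc d → ℂ} (hμ : IsAnnularCutoff δ B μ) {ψ : ℝ → ℝ} (hψ : IsDyadicBump ψ)
    {ξ : Euc (d + 1)} (h : coneMultiplierDil μ ψ t ξ ≠ 0) : ξ ∈ coneShell d δ t := by
  unfold coneMultiplierDil coneMultiplier at h
  have h1 := left_ne_zero_of_mul h
  have h2 : ψ (2⁻¹ * lastPart ξ) ≠ 0 := fun h0 => right_ne_zero_of_mul h (by rw [h0]; rfl)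
  have h3 : 2⁻¹ * lastPart ξ ∈ Set.Icc (1 / 4 : ℝ) 1 := by
    by_contra hcon; exact h2 (bump_eq_zero hψ hcon)
  have h4 := hμ.supp (subset_tsupport _ h1)
  have hs : 0 < lastPart ξ := by linarith [h3.1]
  have ht0 : 0 < t := by linarith [ht.1]
  simp only [Set.mem_ofPred_eq, norm_smul, norm_inv, Real.norm_of_nonneg hs.le,
    Real.norm_of_nonneg ht0.le] at h4
  rw [← mul_assoc, ← mul_inv, inv_mul_eq_div, mul_comm (lastPart ξ) t] at h4
  obtain ⟨h5, h6⟩ := h4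
  rw [le_div_iff₀ (by positivity)] at h5
  rw [div_le_one (by positivity)] at h6
  exact ⟨h5, h6, by linarith [h3.1], by linarith [h3.2]⟩

theorem tsupport_coneMultiplierDil_subset {δ t : ℝ} (ht : t ∈ Set.Icc (1 : ℝ) 2) {B : ℕ → ℝ}
    {μ : Euc d → ℂ} (hμ : IsAnnularCutoff δ B μ) {ψ : ℝ → ℝ} (hψ : IsDyadicBump ψ) :
    tsupport (coneMultiplierDil μ ψ t) ⊆ coneShell d δ t :=
  closure_minimal (fun _ h => mem_coneShell_of_ne_zero ht hμ hψ h) (isClosed_coneShell_slice d δ t)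

/-- A compact set containing all the cone shells. -/
def coneShellHull (d : ℕ) : Set (Euc (d + 1)) :=
  Metric.closedBall 0 (Real.sqrt (∑ _j : Fin (d + 1), 4 ^ 2)) ∩
    {ξ | lastPart ξ ∈ Set.Icc (1 / 2 : ℝ) 2}

theorem isCompact_coneShellHull (d : ℕ) : IsCompact (coneShellHull d) :=
  (isCompact_closedBall _ _).inter_right (isClosed_Icc.preimage continuous_lastPart)

theorem coneShell_subset_hull {δ t : ℝ} (ht : t ∈ Set.Icc (1 : ℝ) 2) :
    coneShell d δ t ⊆ coneShellHull d := by
  intro ξ hξ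
  refine ⟨?_, hξ.2.2⟩
  rw [mem_closedBall_zero_iff, EuclideanSpace.norm_eq]
  refine Real.sqrt_le_sqrt (Finset.sum_le_sum fun j _ => ?_)
  rw [Real.norm_eq_abs]
  exact pow_le_pow_left₀ (abs_nonneg _) (coneShell_abs_le ht hξ j) 2

theorem contDiff_bump_lastPart {ψ : ℝ → ℝ} (hψ : IsDyadicBump ψ) :
    ContDiff ℝ ∞ (fun ξ : Euc (d + 1) => (ψ (2⁻¹ * lastPart ξ) : ℂ)) :=
  Complex.ofRealCLM.contDiff.comp (hψ.smooth.comp (contDiff_const.mul contDiff_lastPart))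

theorem isOpen_lastPart_pos : IsOpen {ξ : Euc (d + 1) | 0 < lastPart ξ} :=
  isOpen_lt continuous_const continuous_lastPart

theorem contDiffOn_projective :
    ContDiffOn ℝ ∞ (fun ξ : Euc (d + 1) => (lastPart ξ)⁻¹ • headPart ξ)
      {ξ | 0 < lastPart ξ} := by
  refine ContDiffOn.smul (ContDiffOn.inv contDiff_lastPart.contDiffOn fun ξ hξ => ?_)
    contDiff_headPart.contDiffOn
  exact (show 0 < lastPart ξ from hξ).ne'

/-- The quotient by `ξ_n` is smooth where `ξ_n > 0`; elsewhere the factor `ψ (ξ_n / 2)` vanishes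
identically for `ξ_n < 1/2`, which is a neighbourhood. -/
theorem contDiff_coneMultiplierDil {δ : ℝ} (t : ℝ) {B : ℕ → ℝ}
    {μ : Euc d → ℂ} (hμ : IsAnnularCutoff δ B μ) {ψ : ℝ → ℝ} (hψ : IsDyadicBump ψ) :
    ContDiff ℝ ∞ (coneMultiplierDil μ ψ t) := by
  rw [contDiff_iff_contDiffAt]
  intro ξ
  by_cases hξ : 0 < lastPart ξ
  · have h1 : ContDiffOn ℝ ∞ (coneMultiplierDil μ ψ t) {ξ | 0 < lastPart ξ} := by
      refine ContDiffOn.mul (hμ.smooth.comp_contDiffOn ?_) (contDiff_bump_lastPart hψ).contDiffOn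
      refine (contDiffOn_projective.const_smul t⁻¹).congr fun ζ _ => ?_
      exact smul_comm _ _ _
    exact h1.contDiffAt (isOpen_lastPart_pos.mem_nhds hξ)
  · have h0 : coneMultiplierDil μ ψ t =ᶠ[nhds ξ] fun _ => 0 := by
      have : {ζ : Euc (d + 1) | lastPart ζ < 1 / 2} ∈ nhds ξ := by
        refine (isOpen_lt continuous_lastPart continuous_const).mem_nhds ?_
        change lastPart ξ < 1 / 2
        linarith
      filter_upwards [this] with ζ hζ
      unfold coneMultiplierDil coneMultiplier
      rw [bump_eq_zero hψ, Complex.ofReal_zero, mul_zero]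
      intro h
      have h2 : lastPart ζ < 1 / 2 := hζ
      linarith [h.1]
    exact contDiffAt_const.congr_of_eventuallyEq h0

/-- The derivatives of order `k` of the multiplier are of size `δ ^ (-k)`. -/
theorem exists_norm_iteratedFDeriv_coneMultiplierDil_le (d : ℕ) {ψ : ℝ → ℝ} (hψ : IsDyadicBump ψ)
    (B : ℕ → ℝ) (k : ℕ) :
    ∃ A : ℝ, 0 ≤ A ∧ ∀ δ : ℝ, 0 < δ → δ ≤ 1 / 2 → ∀ μ : Euc d → ℂ, IsAnnularCutoff δ B μ →
      ∀ t ∈ Set.Icc (1 : ℝ) 2, ∀ ξ,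
        ‖iteratedFDeriv ℝ k (coneMultiplierDil μ ψ t) ξ‖ ≤ A * (δ ^ k)⁻¹ := by
  set U : Set (Euc (d + 1)) := {ξ | 0 < lastPart ξ} with hU
  have hUo : IsOpen U := isOpen_lastPart_pos
  have hUd : UniqueDiffOn ℝ U := hUo.uniqueDiffOn
  have hsub : coneShellHull d ⊆ U := fun ξ hξ => by
    have := hξ.2.1
    change 0 < lastPart ξ
    linarith
  -- The projective map and the bump do not involve `δ`, `μ` or `t`, and the hull is a compact
  -- subset of `ξ_n > 0` containing all shells; hence uniform bounds for their derivatives.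
  have hΦ : ∀ i : ℕ, ∃ c : ℝ, ∀ ξ ∈ coneShellHull d, ‖iteratedFDerivWithin ℝ i
      (fun ξ : Euc (d + 1) => (lastPart ξ)⁻¹ • headPart ξ) U ξ‖ ≤ c := fun i =>
    (isCompact_coneShellHull d).exists_bound_of_continuousOn
      ((contDiffOn_projective.continuousOn_iteratedFDerivWithin
        (by exact_mod_cast le_top) hUd).mono hsub)
  have hP : ∀ i : ℕ, ∃ c : ℝ, ∀ ξ ∈ coneShellHull d, ‖iteratedFDerivWithin ℝ i
      (fun ξ : Euc (d + 1) => (ψ (2⁻¹ * lastPart ξ) : ℂ)) U ξ‖ ≤ c := fun i =>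
    (isCompact_coneShellHull d).exists_bound_of_continuousOn
      (((contDiff_bump_lastPart hψ).contDiffOn.continuousOn_iteratedFDerivWithin
        (by exact_mod_cast le_top) hUd).mono hsub)
  choose c hc using hΦ
  choose p hp using hP
  set D : ℝ := 1 + ∑ i ∈ Finset.range (k + 1), |c i| with hD
  have hD1 : 1 ≤ D := le_add_of_nonneg_right (Finset.sum_nonneg fun _ _ => abs_nonneg _)
  set S : ℝ := ∑ i ∈ Finset.range (k + 1), |B i| with hS
  have hS0 : 0 ≤ S := Finset.sum_nonneg fun _ _ => abs_nonneg _
  have hA0 : 0 ≤ ∑ i ∈ Finset.range (k + 1), (k.choose i : ℝ) * (i.factorial * S * D ^ i) *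
      |p (k - i)| := Finset.sum_nonneg fun _ _ => by positivity
  refine ⟨∑ i ∈ Finset.range (k + 1), (k.choose i : ℝ) * (i.factorial * S * D ^ i) *
      |p (k - i)|, hA0, fun δ hδ hδ' μ hμ t ht ξ => ?_⟩
  by_cases hξ : ξ ∈ coneShell d δ t
  · have hξh := coneShell_subset_hull ht hξ
    have hξU := hsub hξh
    have hΦt : ContDiffOn ℝ ∞ (fun ξ : Euc (d + 1) => t⁻¹ • ((lastPart ξ)⁻¹ • headPart ξ)) U :=
      contDiffOn_projective.const_smul t⁻¹
    have hcomp : ∀ i ∈ Finset.range (k + 1), ‖iteratedFDerivWithin ℝ i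
        (μ ∘ fun ξ : Euc (d + 1) => t⁻¹ • ((lastPart ξ)⁻¹ • headPart ξ)) U ξ‖ ≤
        i.factorial * (S * (δ ^ k)⁻¹) * D ^ i := by
      intro i hi
      rw [Finset.mem_range] at hi
      -- The powers of `δ⁻¹` come only from `μ`, and those of order `l ≤ k` are absorbed into
      -- `δ^(-k)` since `δ ≤ 1`. The inner derivatives must be bounded by `D ^ l`, so `D ≥ 1` is
      -- taken above all the constants; `t⁻¹ ≤ 1` keeps this uniform in `t`.
      refine norm_iteratedFDerivWithin_comp_le (N := ∞) hμ.smooth.contDiffOn hΦt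
        (by exact_mod_cast le_top) uniqueDiffOn_univ hUd (fun _ _ => Set.mem_univ _) hξU
        (fun l hl => ?_) (fun l hl1 hl => ?_)
      · rw [iteratedFDerivWithin_univ]
        refine (hμ.bound l _).trans ?_
        have h1 : B l ≤ S := (le_abs_self _).trans (Finset.single_le_sum
          (f := fun i => |B i|) (fun _ _ => abs_nonneg _) (Finset.mem_range.2 (by omega)))
        have h2 : (δ ^ l)⁻¹ ≤ (δ ^ k)⁻¹ := by
          gcongr ?_⁻¹
          exact pow_le_pow_of_le_one hδ.le (by linarith) (by omega)
        gcongr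
      · have h1 : iteratedFDerivWithin ℝ l
            (fun ξ : Euc (d + 1) => t⁻¹ • ((lastPart ξ)⁻¹ • headPart ξ)) U ξ =
            t⁻¹ • iteratedFDerivWithin ℝ l
              (fun ξ : Euc (d + 1) => (lastPart ξ)⁻¹ • headPart ξ) U ξ :=
          iteratedFDerivWithin_const_smul_apply (a := t⁻¹)
            ((contDiffOn_projective ξ hξU).of_le (by exact_mod_cast le_top)) hUd hξU
        have ht1 : ‖t⁻¹‖ ≤ 1 := by
          rw [norm_inv, Real.norm_of_nonneg (by linarith [ht.1])]
          exact inv_le_one_of_one_le₀ ht.1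
        rw [h1, norm_smul]
        calc ‖t⁻¹‖ * _ ≤ 1 * |c l| := by
              gcongr
              exact (hc l ξ hξh).trans (le_abs_self _)
          _ ≤ D := by
              rw [one_mul]
              refine le_trans (Finset.single_le_sum (f := fun i => |c i|)
                (fun _ _ => abs_nonneg _) (Finset.mem_range.2 (by omega : l < k + 1))) ?_
              rw [hD]; linarith
          _ ≤ D ^ l := le_self_pow₀ hD1 (by omega)
    have heq : coneMultiplierDil μ ψ t = fun ξ =>
        (μ ∘ fun ξ : Euc (d + 1) => t⁻¹ • ((lastPart ξ)⁻¹ • headPart ξ)) ξ *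
          (ψ (2⁻¹ * lastPart ξ) : ℂ) := by
      ext ζ
      simp only [coneMultiplierDil, coneMultiplier, Function.comp]
      rw [smul_comm]
    rw [← iteratedFDerivWithin_of_isOpen k hUo hξU, heq]
    refine (norm_iteratedFDerivWithin_mul_le (N := ∞) (hμ.smooth.comp_contDiffOn hΦt)
      (contDiff_bump_lastPart hψ).contDiffOn hUd hξU (by exact_mod_cast le_top)).trans ?_
    rw [Finset.sum_mul]
    refine Finset.sum_le_sum fun i hi => ?_
    calc _ ≤ (k.choose i : ℝ) * (i.factorial * (S * (δ ^ k)⁻¹) * D ^ i) * |p (k - i)| := by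
          gcongr
          · exact hcomp i hi
          · exact (hp (k - i) ξ hξh).trans (le_abs_self _)
      _ = _ := by ring
  · have : iteratedFDeriv ℝ k (coneMultiplierDil μ ψ t) ξ = 0 := by
      by_contra hne
      exact hξ (tsupport_coneMultiplierDil_subset ht hμ hψ (support_iteratedFDeriv_subset k hne))
    rw [this, norm_zero]
    positivity

/-- The multiplier of the operator with kernel `(δ z_i) ^ k K_t(z)`. -/
noncomputable def momentMultiplier (δ : ℝ) (μ : Euc d → ℂ) (ψ : ℝ → ℝ) (i : Fin (d + 1)) (k : ℕ)
    (t : ℝ) (ξ : Euc (d + 1)) : ℂ :=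
  (δ / (-(2 * Real.pi * Complex.I))) ^ k *
    iteratedFDeriv ℝ k (coneMultiplierDil μ ψ t) ξ fun _ => EuclideanSpace.single i 1

variable {δ : ℝ} {B : ℕ → ℝ} {μ : Euc d → ℂ} {ψ : ℝ → ℝ}

theorem hasCompactSupport_coneMultiplierDil {t : ℝ} (ht : t ∈ Set.Icc (1 : ℝ) 2)
    (hμ : IsAnnularCutoff δ B μ) (hψ : IsDyadicBump ψ) :
    HasCompactSupport (coneMultiplierDil μ ψ t) :=
  (isCompact_coneShellHull d).of_isClosed_subset (isClosed_tsupport _)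
    ((tsupport_coneMultiplierDil_subset ht hμ hψ).trans (coneShell_subset_hull ht))

theorem continuous_momentMultiplier (hμ : IsAnnularCutoff δ B μ) (hψ : IsDyadicBump ψ)
    (i : Fin (d + 1)) (k : ℕ) (t : ℝ) : Continuous (momentMultiplier δ μ ψ i k t) := by
  unfold momentMultiplier
  have h := (contDiff_coneMultiplierDil t hμ hψ).continuous_iteratedFDeriv (m := k)
    (by exact_mod_cast le_top)
  exact continuous_const.mul
    ((ContinuousMultilinearMap.apply ℝ (fun _ : Fin k => Euc (d + 1)) ℂ
      (fun _ => EuclideanSpace.single i 1)).continuous.comp h)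

theorem momentMultiplier_eq_zero {t : ℝ} (ht : t ∈ Set.Icc (1 : ℝ) 2)
    (hμ : IsAnnularCutoff δ B μ) (hψ : IsDyadicBump ψ) (i : Fin (d + 1)) (k : ℕ)
    {ξ : Euc (d + 1)} (hξ : ξ ∉ coneShell d δ t) : momentMultiplier δ μ ψ i k t ξ = 0 := by
  have : iteratedFDeriv ℝ k (coneMultiplierDil μ ψ t) ξ = 0 := by
    by_contra hne
    exact hξ (tsupport_coneMultiplierDil_subset ht hμ hψ (support_iteratedFDeriv_subset k hne))
  simp [momentMultiplier, this]

theorem integrable_momentMultiplier {t : ℝ} (ht : t ∈ Set.Icc (1 : ℝ) 2)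
    (hμ : IsAnnularCutoff δ B μ) (hψ : IsDyadicBump ψ) (i : Fin (d + 1)) (k : ℕ) :
    Integrable (momentMultiplier δ μ ψ i k t) :=
  (continuous_momentMultiplier hμ hψ i k t).integrable_of_hasCompactSupport
    (HasCompactSupport.of_support_subset_isCompact (isCompact_coneShellHull d) fun _ h => by
      by_contra hcon
      exact h (momentMultiplier_eq_zero ht hμ hψ i k fun h' =>
        hcon (coneShell_subset_hull ht h')))

/-- The factor `δ^k` cancels the `δ^(-k)` lost in differentiating: a moment weighed at scale `1/δ`
costs nothing. -/
theorem norm_momentMultiplier_le (hδ : 0 < δ) (μ : Euc d → ℂ) (ψ : ℝ → ℝ) (i : Fin (d + 1)) (k : ℕ)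
    (t : ℝ) (ξ : Euc (d + 1)) {A : ℝ}
    (hA : ‖iteratedFDeriv ℝ k (coneMultiplierDil μ ψ t) ξ‖ ≤ A * (δ ^ k)⁻¹) :
    ‖momentMultiplier δ μ ψ i k t ξ‖ ≤ A := by
  have h1 : ‖(δ / (-(2 * Real.pi * Complex.I)) : ℂ)‖ ≤ δ := by
    rw [norm_div, norm_neg, norm_mul, norm_mul, Complex.norm_I, Complex.norm_real,
      Complex.norm_real, Real.norm_of_nonneg hδ.le, Real.norm_of_nonneg Real.pi_pos.le,
      Complex.norm_ofNat, mul_one]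
    refine div_le_self hδ.le ?_
    linarith [Real.pi_gt_three]
  have h2 : ‖iteratedFDeriv ℝ k (coneMultiplierDil μ ψ t) ξ fun _ => EuclideanSpace.single i 1‖ ≤
      ‖iteratedFDeriv ℝ k (coneMultiplierDil μ ψ t) ξ‖ := by
    refine (ContinuousMultilinearMap.le_opNorm _ _).trans (le_of_eq ?_)
    simp
  unfold momentMultiplier
  rw [norm_mul, norm_pow]
  calc _ ≤ δ ^ k * (A * (δ ^ k)⁻¹) := by
        gcongr
        exact h2.trans hA
    _ = A := by field_simp

/-- Differentiating in `ξ_i` amounts to multiplying the kernel by `-2πi z_i`; the normalisation of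
`momentMultiplier` removes this constant. -/
theorem fourierInv_momentMultiplier {t : ℝ} (ht : t ∈ Set.Icc (1 : ℝ) 2)
    (hμ : IsAnnularCutoff δ B μ) (hψ : IsDyadicBump ψ) (i : Fin (d + 1)) (k : ℕ)
    (z : Euc (d + 1)) :
    𝓕⁻ (momentMultiplier δ μ ψ i k t) z = ((δ * z i) ^ k : ℝ) * coneKernel μ ψ t z := by
  have hsm := contDiff_coneMultiplierDil t hμ hψ
  have hint : ∀ n : ℕ, Integrable (iteratedFDeriv ℝ n (coneMultiplierDil μ ψ t)) := fun n =>
    (hsm.continuous_iteratedFDeriv (by exact_mod_cast le_top)).integrable_of_hasCompactSupport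
      ((hasCompactSupport_coneMultiplierDil ht hμ hψ).iteratedFDeriv n)
  have h1 := congrFun (Real.fourier_iteratedFDeriv (N := ⊤) hsm (fun n _ => hint n)
    (n := k) le_top) (-z)
  have h2 := congrArg (fun L => L fun _ => (EuclideanSpace.single i 1 : Euc (d + 1))) h1
  rw [Real.fourier_continuousMultilinearMap_apply (hint k),
    VectorFourier.fourierPowSMulRight_apply] at h2
  have h3 : 𝓕⁻ (momentMultiplier δ μ ψ i k t) z =
      (δ / (-(2 * Real.pi * Complex.I))) ^ k * 𝓕 (fun ξ => iteratedFDeriv ℝ k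
        (coneMultiplierDil μ ψ t) ξ fun _ => EuclideanSpace.single i 1) (-z) := by
    rw [Real.fourierInv_eq_fourier_neg, Real.fourier_eq, Real.fourier_eq, ← integral_const_mul]
    refine integral_congr_ae (Filter.Eventually.of_forall fun ξ => ?_)
    simp only [momentMultiplier, Circle.smul_def, smul_eq_mul]
    ring
  rw [h3, h2, coneKernel, Real.fourierInv_eq_fourier_neg]
  have e : (-innerSL ℝ) (-z) (EuclideanSpace.single i (1 : ℝ)) = z i := by
    simp [EuclideanSpace.inner_single_right]
  simp only [e, Finset.prod_const, Finset.card_univ, Fintype.card_fin]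
  simp only [smul_eq_mul, Complex.real_smul]
  push_cast
  rw [div_pow, mul_pow]
  have hne : (-(2 * (Real.pi : ℂ) * Complex.I)) ^ k ≠ 0 := by
    refine pow_ne_zero _ (neg_ne_zero.2 ?_)
    simp [Real.pi_ne_zero]
  field_simp

/-- Convolution with an inverse Fourier transform is a Fourier multiplier. -/
theorem integral_fourierInv_sub_mul {m : ℕ} {M g : Euc m → ℂ} (hM : Integrable M)
    (hg : Integrable g) (x : Euc m) :
    ∫ y, 𝓕⁻ M (x - y) * g y = 𝓕⁻ (fun ξ => M ξ * 𝓕 g ξ) x := by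
  have hMx : Integrable (fun ξ => Real.fourierChar (inner ℝ ξ x) • M ξ) := by
    have := (Real.fourierIntegral_convergent_iff (μ := volume) (-x)).2 hM
    simpa using this
  have key := VectorFourier.integral_fourierIntegral_smul_eq_flip
    (μ := (volume : Measure (Euc m))) (ν := (volume : Measure (Euc m)))
    (L := innerₗ (Euc m)) (f := g) Real.continuous_fourierChar
    (by simpa using continuous_inner) hg hMx
  have h1 : ∀ y, VectorFourier.fourierIntegral Real.fourierChar volume (innerₗ (Euc m)).flip
      (fun ξ => Real.fourierChar (inner ℝ ξ x) • M ξ) y = 𝓕⁻ M (x - y) := by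
    intro y
    rw [Real.fourierInv_eq]
    unfold VectorFourier.fourierIntegral
    refine integral_congr_ae (Filter.Eventually.of_forall fun ξ => ?_)
    simp only [LinearMap.flip_apply, innerₗ_apply_apply]
    rw [smul_smul, ← AddChar.map_add_eq_mul, inner_sub_right, real_inner_comm ξ y]
    congr 2
    ring
  simp only [h1, smul_eq_mul] at key
  rw [Real.fourierInv_eq]
  calc ∫ y, 𝓕⁻ M (x - y) * g y = ∫ y, g y * 𝓕⁻ M (x - y) := by simp only [mul_comm]
    _ = _ := key.symm
    _ = _ := by
        refine integral_congr_ae (Filter.Eventually.of_forall fun ξ => ?_)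
        simp only [Circle.smul_def, smul_eq_mul]
        change 𝓕 g ξ * _ = _
        ring

end MultiplierDerivatives

/-! ### Localising to a box of side comparable to `1/δ` -/

section Localization

variable {d : ℕ} {δ : ℝ} {B : ℕ → ℝ} {μ : Euc d → ℂ} {ψ : ℝ → ℝ}

/-- The kernel `(δ z_i) ^ k K_t(z)`. -/
noncomputable def momentKernel (δ : ℝ) (μ : Euc d → ℂ) (ψ : ℝ → ℝ) (i : Fin (d + 1)) (k : ℕ)
    (t : ℝ) (z : Euc (d + 1)) : ℂ :=
  ((δ * z i) ^ k : ℝ) * coneKernel μ ψ t z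

/-- Convolution with `momentKernel`. -/
noncomputable def momentOp (δ : ℝ) (μ : Euc d → ℂ) (ψ : ℝ → ℝ) (i : Fin (d + 1)) (k : ℕ)
    (g : Euc (d + 1) → ℂ) (t : ℝ) (x : Euc (d + 1)) : ℂ :=
  ∫ y, momentKernel δ μ ψ i k t (x - y) * g y

theorem momentOp_eq_fourierInv {t : ℝ} (ht : t ∈ Set.Icc (1 : ℝ) 2)
    (hμ : IsAnnularCutoff δ B μ) (hψ : IsDyadicBump ψ) (i : Fin (d + 1)) (k : ℕ)
    {g : Euc (d + 1) → ℂ} (hg : Integrable g) (x : Euc (d + 1)) :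
    momentOp δ μ ψ i k g t x = 𝓕⁻ (fun ξ => momentMultiplier δ μ ψ i k t ξ * 𝓕 g ξ) x := by
  rw [← integral_fourierInv_sub_mul (integrable_momentMultiplier ht hμ hψ i k) hg]
  simp_rw [fourierInv_momentMultiplier ht hμ hψ]
  rfl

theorem integrable_momentKernel_mul {t : ℝ} (ht : t ∈ Set.Icc (1 : ℝ) 2)
    (hμ : IsAnnularCutoff δ B μ) (hψ : IsDyadicBump ψ) (i : Fin (d + 1)) (k : ℕ)
    {g : Euc (d + 1) → ℂ} (hg : Integrable g) (x : Euc (d + 1)) :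
    Integrable fun y => momentKernel δ μ ψ i k t (x - y) * g y := by
  have hM := integrable_momentMultiplier ht hμ hψ i k
  have heq : momentKernel δ μ ψ i k t = fun z => 𝓕 (momentMultiplier δ μ ψ i k t) (-z) := by
    ext z
    rw [← Real.fourierInv_eq_fourier_neg, fourierInv_momentMultiplier ht hμ hψ]
    rfl
  have hcont : Continuous (𝓕 (momentMultiplier δ μ ψ i k t)) :=
    VectorFourier.fourierIntegral_continuous Real.continuous_fourierChar
      (by simpa using continuous_inner) hM
  refine hg.bdd_mul (c := ∫ ξ, ‖momentMultiplier δ μ ψ i k t ξ‖) ?_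
    (Filter.Eventually.of_forall fun y => ?_)
  · rw [heq]
    exact (hcont.comp (by fun_prop)).aestronglyMeasurable
  · rw [heq]
    exact VectorFourier.norm_fourierIntegral_le_integral_norm _ _ _ _ _

theorem measurable_coneKernel (hμ : IsAnnularCutoff δ B μ) (hψ : IsDyadicBump ψ) :
    Measurable fun p : ℝ × Euc (d + 1) => coneKernel μ ψ p.1 p.2 := by
  have hμm : Measurable μ := hμ.smooth.continuous.measurable
  have hψm : Measurable ψ := hψ.smooth.continuous.measurable
  have hh : Measurable (headPart : Euc (d + 1) → Euc d) := continuous_headPart.measurable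
  have hl : Measurable (lastPart : Euc (d + 1) → ℝ) := continuous_lastPart.measurable
  have h1 : Measurable fun q : (ℝ × Euc (d + 1)) × Euc (d + 1) =>
      (Real.fourierChar (inner ℝ q.2 q.1.2) : ℂ) * coneMultiplierDil μ ψ q.1.1 q.2 := by
    have hc : Continuous fun q : (ℝ × Euc (d + 1)) × Euc (d + 1) =>
        (Real.fourierChar (inner ℝ q.2 q.1.2) : ℂ) := by
      have := Real.continuous_fourierChar
      fun_prop
    refine hc.measurable.mul ?_
    unfold coneMultiplierDil coneMultiplier
    fun_prop
  have h2 := (h1.stronglyMeasurable.integral_prod_right'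
    (ν := (volume : Measure (Euc (d + 1))))).measurable
  have heq : (fun p : ℝ × Euc (d + 1) => coneKernel μ ψ p.1 p.2) = fun p => ∫ ξ,
      (Real.fourierChar (inner ℝ ξ p.2) : ℂ) * coneMultiplierDil μ ψ p.1 ξ := by
    funext p
    rw [coneKernel, Real.fourierInv_eq]
    rfl
  rw [heq]
  exact h2

theorem measurable_momentOp (hμ : IsAnnularCutoff δ B μ) (hψ : IsDyadicBump ψ) (i : Fin (d + 1))
    (k : ℕ) {g : Euc (d + 1) → ℂ} (hg : Measurable g) :
    Measurable fun p : ℝ × Euc (d + 1) => momentOp δ μ ψ i k g p.1 p.2 := by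
  have hK := measurable_coneKernel hμ hψ
  have h1 : Measurable fun q : (ℝ × Euc (d + 1)) × Euc (d + 1) =>
      momentKernel δ μ ψ i k q.1.1 (q.1.2 - q.2) * g q.2 := by
    have hm : Measurable fun q : (ℝ × Euc (d + 1)) × Euc (d + 1) => (q.1.1, q.1.2 - q.2) := by
      have : Continuous fun q : (ℝ × Euc (d + 1)) × Euc (d + 1) => (q.1.1, q.1.2 - q.2) := by
        fun_prop
      exact this.measurable
    have h2 : Continuous fun q : (ℝ × Euc (d + 1)) × Euc (d + 1) =>
        (((δ * (q.1.2 - q.2) i) ^ k : ℝ) : ℂ) := by fun_prop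
    have h3 : Measurable fun q : (ℝ × Euc (d + 1)) × Euc (d + 1) =>
        coneKernel μ ψ q.1.1 (q.1.2 - q.2) := by
      generalize coneKernel μ ψ = K at hK
      exact hK.comp hm
    have h4 : Measurable fun q : (ℝ × Euc (d + 1)) × Euc (d + 1) => g q.2 :=
      hg.comp measurable_snd
    unfold momentKernel
    exact (h2.measurable.mul h3).mul h4
  exact (h1.stronglyMeasurable.integral_prod_right'
    (ν := (volume : Measure (Euc (d + 1))))).measurable

/-- The localizing polynomial `∑ (1 + z_i ^ (2n))`. -/
noncomputable def locPoly (d : ℕ) (z : Euc (d + 1)) : ℝ := ∑ i, (1 + z i ^ (2 * (d + 1)))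

theorem one_le_locPoly (z : Euc (d + 1)) : 1 ≤ locPoly d z := by
  unfold locPoly
  have h : ∀ i, 0 ≤ z i ^ (2 * (d + 1)) := fun i => by rw [pow_mul]; positivity
  calc (1 : ℝ) ≤ 1 + z 0 ^ (2 * (d + 1)) := by linarith [h 0]
    _ ≤ _ := Finset.single_le_sum (f := fun i => 1 + z i ^ (2 * (d + 1)))
      (fun i _ => by linarith [h i]) (Finset.mem_univ _)

theorem continuous_locPoly : Continuous (locPoly d) := by
  unfold locPoly; fun_prop

/-- The coefficients in the expansion of `1 + (v - u) ^ m` in powers of `u`. -/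
noncomputable def locCoeff (m k : ℕ) (v : ℝ) : ℝ :=
  (-1) ^ k * v ^ (m - k) * m.choose k + if k = 0 then 1 else 0

/-- Used with `v = δ(x_i - c_i)`, bounded by one on the box, and `u = δ(x_i - y_i)`, which the
kernel absorbs; then `v - u = δ(y_i - c_i)`. -/
theorem one_add_sub_pow (m : ℕ) (u v : ℝ) :
    1 + (v - u) ^ m = ∑ k ∈ Finset.range (m + 1), locCoeff m k v * u ^ k := by
  have h1 : (v - u) ^ m = ∑ k ∈ Finset.range (m + 1), (-u) ^ k * v ^ (m - k) * m.choose k := by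
    rw [← add_pow]; ring
  have h2 : ∑ k ∈ Finset.range (m + 1), (if k = 0 then (1 : ℝ) else 0) * u ^ k = 1 := by
    rw [Finset.sum_eq_single_of_mem 0 (by simp)]
    · simp
    · intro k _ hk; simp [hk]
  simp_rw [locCoeff, add_mul]
  rw [Finset.sum_add_distrib, h2, h1, add_comm]
  congr 1
  refine Finset.sum_congr rfl fun k _ => ?_
  rw [neg_pow u]
  ring

theorem abs_locCoeff_le {m k : ℕ} {v : ℝ} (hv : |v| ≤ 1) : |locCoeff m k v| ≤ 2 ^ m + 1 := by
  unfold locCoeff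
  refine (abs_add_le _ _).trans (add_le_add ?_ ?_)
  · rw [abs_mul, abs_mul, abs_pow, abs_neg, abs_one, one_pow, one_mul, abs_pow, Nat.abs_cast]
    calc |v| ^ (m - k) * (m.choose k : ℝ) ≤ 1 * (m.choose k : ℝ) := by
          gcongr
          exact pow_le_one₀ (abs_nonneg _) hv
      _ ≤ 2 ^ m := by
          rw [one_mul]
          exact_mod_cast Nat.choose_le_two_pow m k
  · split_ifs <;> simp

/-- Trades growth in `y - c` for moments of the kernel, with coefficients depending on `x` and `c`
but not on `y`, so that they leave the convolution integral. -/
theorem coneKernel_mul_locPoly (μ : Euc d → ℂ) (ψ : ℝ → ℝ) (δ t : ℝ) (x y c : Euc (d + 1)) (w : ℂ) :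
    coneKernel μ ψ t (x - y) * (locPoly d (δ • (y - c)) * w) =
      ∑ i, ∑ k ∈ Finset.range (2 * (d + 1) + 1),
        (locCoeff (2 * (d + 1)) k (δ * (x i - c i)) : ℂ) *
          (momentKernel δ μ ψ i k t (x - y) * w) := by
  have h : locPoly d (δ • (y - c)) = ∑ i, ∑ k ∈ Finset.range (2 * (d + 1) + 1),
      locCoeff (2 * (d + 1)) k (δ * (x i - c i)) * (δ * (x - y) i) ^ k := by
    unfold locPoly
    refine Finset.sum_congr rfl fun i _ => ?_
    rw [← one_add_sub_pow]
    congr 2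
    simp only [PiLp.smul_apply, PiLp.sub_apply, smul_eq_mul]
    ring
  rw [h]
  push_cast
  simp only [Finset.sum_mul, Finset.mul_sum]
  refine Finset.sum_congr rfl fun i _ => Finset.sum_congr rfl fun k _ => ?_
  simp only [momentKernel]
  push_cast
  ring

theorem integrable_coneKernel_mul {t : ℝ} (ht : t ∈ Set.Icc (1 : ℝ) 2)
    (hμ : IsAnnularCutoff δ B μ) (hψ : IsDyadicBump ψ) {f g : Euc (d + 1) → ℂ} (hg : Integrable g)
    {c : Euc (d + 1)} (hfg : ∀ y, f y = locPoly d (δ • (y - c)) * g y) (x : Euc (d + 1)) :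
    Integrable fun y => coneKernel μ ψ t (x - y) * f y := by
  simp_rw [hfg, coneKernel_mul_locPoly]
  exact integrable_finsetSum _ fun i _ => integrable_finsetSum _ fun k _ =>
    (integrable_momentKernel_mul ht hμ hψ i k hg x).const_mul _

theorem coneOp_eq_sum_momentOp {t : ℝ} (ht : t ∈ Set.Icc (1 : ℝ) 2)
    (hμ : IsAnnularCutoff δ B μ) (hψ : IsDyadicBump ψ) {f g : Euc (d + 1) → ℂ} (hg : Integrable g)
    {c : Euc (d + 1)} (hfg : ∀ y, f y = locPoly d (δ • (y - c)) * g y) (x : Euc (d + 1)) :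
    coneOp μ ψ t f x = ∑ i, ∑ k ∈ Finset.range (2 * (d + 1) + 1),
        (locCoeff (2 * (d + 1)) k (δ * (x i - c i)) : ℂ) * momentOp δ μ ψ i k g t x := by
  have hint : ∀ i k, Integrable fun y =>
      (locCoeff (2 * (d + 1)) k (δ * (x i - c i)) : ℂ) *
        (momentKernel δ μ ψ i k t (x - y) * g y) := fun i k =>
    (integrable_momentKernel_mul ht hμ hψ i k hg x).const_mul _
  unfold coneOp momentOp
  simp_rw [hfg, coneKernel_mul_locPoly]
  rw [integral_finsetSum _ fun i _ => integrable_finsetSum _ fun k _ => hint i k]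
  refine Finset.sum_congr rfl fun i _ => ?_
  rw [integral_finsetSum _ fun k _ => hint i k]
  refine Finset.sum_congr rfl fun k _ => ?_
  rw [integral_const_mul]

/-- The number of terms in the expansion times the square of the bound for the coefficients. -/
noncomputable def locConst (d : ℕ) : ℝ :=
  ((d + 1) * (2 * (d + 1) + 1)) * (2 ^ (2 * (d + 1)) + 1) ^ 2

theorem enorm_coneOp_sq_le {t : ℝ} (ht : t ∈ Set.Icc (1 : ℝ) 2)
    (hμ : IsAnnularCutoff δ B μ) (hψ : IsDyadicBump ψ) {f g : Euc (d + 1) → ℂ} (hg : Integrable g)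
    {c : Euc (d + 1)} (hfg : ∀ y, f y = locPoly d (δ • (y - c)) * g y) {x : Euc (d + 1)}
    (hx : ∀ i, |δ * (x i - c i)| ≤ 1) :
    ‖coneOp μ ψ t f x‖ₑ ^ 2 ≤ ENNReal.ofReal (locConst d) *
      ∑ i, ∑ k ∈ Finset.range (2 * (d + 1) + 1), ‖momentOp δ μ ψ i k g t x‖ₑ ^ 2 := by
  have hreal : ‖coneOp μ ψ t f x‖ ^ 2 ≤ locConst d *
      ∑ i, ∑ k ∈ Finset.range (2 * (d + 1) + 1), ‖momentOp δ μ ψ i k g t x‖ ^ 2 := by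
    -- Cauchy–Schwarz over the finite set of pairs `(i, k)`: `locConst` is their number times the
    -- square of the coefficient bound.
    rw [coneOp_eq_sum_momentOp ht hμ hψ hg hfg, ← Finset.sum_product', ← Finset.sum_product']
    set s := (Finset.univ : Finset (Fin (d + 1))) ×ˢ Finset.range (2 * (d + 1) + 1) with hs
    set L : ℝ := 2 ^ (2 * (d + 1)) + 1 with hL
    have hcard : (s.card : ℝ) = (d + 1) * (2 * (d + 1) + 1) := by
      rw [hs, Finset.card_product, Finset.card_univ, Fintype.card_fin, Finset.card_range]
      push_cast; ring
    calc _ ≤ (∑ p ∈ s, L * ‖momentOp δ μ ψ p.1 p.2 g t x‖) ^ 2 := by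
          gcongr
          refine (norm_sum_le _ _).trans (Finset.sum_le_sum fun p _ => ?_)
          rw [norm_mul, Complex.norm_real, Real.norm_eq_abs]
          gcongr
          exact abs_locCoeff_le (hx p.1)
      _ ≤ s.card * ∑ p ∈ s, (L * ‖momentOp δ μ ψ p.1 p.2 g t x‖) ^ 2 :=
          sq_sum_le_card_mul_sum_sq
      _ = _ := by
          simp_rw [mul_pow]
          rw [← Finset.mul_sum, hcard, locConst, ← hL]
          ring
  have hC : 0 ≤ locConst d := by unfold locConst; positivity
  have he : ∀ z : ℂ, ‖z‖ₑ ^ 2 = ENNReal.ofReal (‖z‖ ^ 2) := fun z => by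
    rw [ENNReal.ofReal_pow (norm_nonneg _), ofReal_norm]
  simp_rw [he]
  have h2 : ∑ i, ∑ k ∈ Finset.range (2 * (d + 1) + 1),
      ENNReal.ofReal (‖momentOp δ μ ψ i k g t x‖ ^ 2) = ENNReal.ofReal
      (∑ i, ∑ k ∈ Finset.range (2 * (d + 1) + 1), ‖momentOp δ μ ψ i k g t x‖ ^ 2) := by
    rw [ENNReal.ofReal_sum_of_nonneg fun i _ => Finset.sum_nonneg fun k _ => sq_nonneg _]
    refine Finset.sum_congr rfl fun i _ => ?_
    rw [ENNReal.ofReal_sum_of_nonneg fun k _ => sq_nonneg _]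
  rw [h2, ← ENNReal.ofReal_mul hC]
  exact ENNReal.ofReal_le_ofReal hreal

/-- Summing the basic estimate over the dyadic Gaussians. -/
theorem exists_lintegral_tsum_gaussWeight_momentOp_le {α β : ℝ} (hα : 0 ≤ α)
    (hαd : α < d) (hβ : 0 ≤ β) (hβ1 : β < 1) {ψ : ℝ → ℝ} (hψ : IsDyadicBump ψ) (B : ℕ → ℝ) (k : ℕ) :
    ∃ C : ℝ, 0 ≤ C ∧ ∀ δ : ℝ, 0 < δ → δ ≤ 1 / 2 → ∀ μ : Euc d → ℂ, IsAnnularCutoff δ B μ →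
      ∀ g : Euc (d + 1) → ℂ, Measurable g → Integrable g → ∀ (i : Fin (d + 1)) (a : Euc (d + 1)),
      ∫⁻ x, (∑' p : ℕ × ℕ, ENNReal.ofReal (dyadCoeff α p.1 * dyadCoeff β p.2) *
          ENNReal.ofReal (gaussWeight (coneScale d (δ * 2 ^ p.1) (δ * 2 ^ p.2)) a x)) *
        ∫⁻ t in Set.Icc (1 : ℝ) 2, ‖momentOp δ μ ψ i k g t x‖ₑ ^ 2 ≤
      ENNReal.ofReal (C * coneFactor δ α β ^ 2) * ∫⁻ x, ‖g x‖ₑ ^ 2 := by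
  have hd : 0 < d := by
    rw [← Nat.cast_pos (α := ℝ)]; linarith
  obtain ⟨A, hA, hAb⟩ := exists_norm_iteratedFDeriv_coneMultiplierDil_le d hψ B k
  obtain ⟨C, hC, hCb⟩ := exists_tsum_capBound_le hα hαd hβ hβ1
  refine ⟨512 * d ^ 2 * 8 ^ d * A ^ 2 * C, by positivity, fun δ hδ hδ' μ hμ g hgm hg i a => ?_⟩
  have hmeas : Measurable fun p : ℝ × Euc (d + 1) => ‖momentOp δ μ ψ i k g p.1 p.2‖ₑ ^ 2 :=
    (measurable_momentOp hμ hψ i k hgm).enorm.pow_const 2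
  have hmeasx : Measurable fun x => ∫⁻ t in Set.Icc (1 : ℝ) 2, ‖momentOp δ μ ψ i k g t x‖ₑ ^ 2 :=
    hmeas.lintegral_prod_left'
  have hgw : ∀ p : ℕ × ℕ, Measurable fun x =>
      ENNReal.ofReal (gaussWeight (coneScale d (δ * 2 ^ p.1) (δ * 2 ^ p.2)) a x) := fun p =>
    (continuous_gaussWeight _ a).measurable.ennreal_ofReal
  have hone : ∀ p : ℕ × ℕ, ∫⁻ x, ENNReal.ofReal
      (gaussWeight (coneScale d (δ * 2 ^ p.1) (δ * 2 ^ p.2)) a x) *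
        ∫⁻ t in Set.Icc (1 : ℝ) 2, ‖momentOp δ μ ψ i k g t x‖ₑ ^ 2 ≤
      ENNReal.ofReal (512 * d ^ 2 * 8 ^ d * A ^ 2 *
        (δ ^ 2 * capBound d (δ * 2 ^ p.1) (δ * 2 ^ p.2))) * ∫⁻ x, ‖g x‖ₑ ^ 2 := by
    intro p
    have hbase := lintegral_gaussWeight_coneShell_multiplier_le hd hδ hδ'
      (r := δ * 2 ^ p.1) (s := δ * 2 ^ p.2) (by positivity) (by positivity) a hA
      (M := fun t => momentMultiplier δ μ ψ i k t)
      (fun t _ => (continuous_momentMultiplier hμ hψ i k t).measurable)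
      (fun t ht ξ => norm_momentMultiplier_le hδ μ ψ i k t ξ (hAb δ hδ hδ' μ hμ t ht ξ))
      (fun t ht ξ hξ => momentMultiplier_eq_zero ht hμ hψ i k hξ) hg
    rw [mul_assoc (512 * (d : ℝ) ^ 2 * 8 ^ d * A ^ 2)] at hbase
    refine le_trans (le_of_eq ?_) hbase
    calc _ = ∫⁻ x, ∫⁻ t in Set.Icc (1 : ℝ) 2, ENNReal.ofReal
          (gaussWeight (coneScale d (δ * 2 ^ p.1) (δ * 2 ^ p.2)) a x) *
            ‖momentOp δ μ ψ i k g t x‖ₑ ^ 2 := by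
          refine lintegral_congr fun x => ?_
          rw [lintegral_const_mul' _ _ ENNReal.ofReal_ne_top]
      _ = ∫⁻ t in Set.Icc (1 : ℝ) 2, ∫⁻ x, ENNReal.ofReal
          (gaussWeight (coneScale d (δ * 2 ^ p.1) (δ * 2 ^ p.2)) a x) *
            ‖momentOp δ μ ψ i k g t x‖ₑ ^ 2 := by
          rw [lintegral_lintegral_swap]
          exact (((hgw p).comp measurable_fst).mul (hmeas.comp measurable_swap)).aemeasurable
      _ = _ := by
          refine setLIntegral_congr_fun measurableSet_Icc fun t ht => ?_
          refine lintegral_congr fun x => ?_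
          rw [momentOp_eq_fourierInv ht hμ hψ i k hg]
  calc _ = ∑' p : ℕ × ℕ, ENNReal.ofReal (dyadCoeff α p.1 * dyadCoeff β p.2) *
        ∫⁻ x, ENNReal.ofReal (gaussWeight (coneScale d (δ * 2 ^ p.1) (δ * 2 ^ p.2)) a x) *
        ∫⁻ t in Set.Icc (1 : ℝ) 2, ‖momentOp δ μ ψ i k g t x‖ₑ ^ 2 := by
        simp_rw [← ENNReal.tsum_mul_right]
        have hm : ∀ p : ℕ × ℕ, AEMeasurable (fun x =>
            ENNReal.ofReal (dyadCoeff α p.1 * dyadCoeff β p.2) *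
              ENNReal.ofReal (gaussWeight (coneScale d (δ * 2 ^ p.1) (δ * 2 ^ p.2)) a x) *
              ∫⁻ t in Set.Icc (1 : ℝ) 2, ‖momentOp δ μ ψ i k g t x‖ₑ ^ 2) volume := fun p =>
          (((hgw p).const_mul _).mul hmeasx).aemeasurable
        rw [lintegral_tsum hm]
        refine tsum_congr fun p => ?_
        simp_rw [mul_assoc]
        rw [lintegral_const_mul' _ _ ENNReal.ofReal_ne_top]
    _ ≤ ∑' p : ℕ × ℕ, ENNReal.ofReal (dyadCoeff α p.1 * dyadCoeff β p.2) *
        (ENNReal.ofReal (512 * d ^ 2 * 8 ^ d * A ^ 2 *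
        (δ ^ 2 * capBound d (δ * 2 ^ p.1) (δ * 2 ^ p.2))) * ∫⁻ x, ‖g x‖ₑ ^ 2) :=
        ENNReal.tsum_le_tsum fun p => mul_le_mul' le_rfl (hone p)
    _ = ENNReal.ofReal (512 * d ^ 2 * 8 ^ d * A ^ 2) * (∑' p : ℕ × ℕ, ENNReal.ofReal
          (dyadCoeff α p.1 * dyadCoeff β p.2 *
            (δ ^ 2 * capBound d (δ * 2 ^ p.1) (δ * 2 ^ p.2)))) * ∫⁻ x, ‖g x‖ₑ ^ 2 := by
        rw [← ENNReal.tsum_mul_left, ← ENNReal.tsum_mul_right]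
        refine tsum_congr fun p => ?_
        have h1 := dyadCoeff_nonneg α p.1
        have h2 := dyadCoeff_nonneg β p.2
        rw [ENNReal.ofReal_mul (p := 512 * (d : ℝ) ^ 2 * 8 ^ d * A ^ 2) (by positivity),
          ENNReal.ofReal_mul (p := dyadCoeff α p.1 * dyadCoeff β p.2) (by positivity)]
        ring
    _ ≤ ENNReal.ofReal (512 * d ^ 2 * 8 ^ d * A ^ 2) * ENNReal.ofReal (C * coneFactor δ α β ^ 2) *
          ∫⁻ x, ‖g x‖ₑ ^ 2 := by
        gcongr
        exact hCb δ hδ hδ'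
    _ = _ := by
        rw [← ENNReal.ofReal_mul (by positivity), mul_assoc _ C]

/-- The weighted estimate on a box of side `1 / δ`, for a function written as the localizing
polynomial times `g`. -/
theorem exists_lintegral_box_le {α β : ℝ} (hα : 0 ≤ α) (hαd : α < d) (hβ : 0 ≤ β) (hβ1 : β < 1)
    {ψ : ℝ → ℝ} (hψ : IsDyadicBump ψ) (B : ℕ → ℝ) :
    ∃ C : ℝ, 0 ≤ C ∧ ∀ δ : ℝ, 0 < δ → δ ≤ 1 / 2 → ∀ μ : Euc d → ℂ, IsAnnularCutoff δ B μ →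
      ∀ (c : Euc (d + 1)) (f g : Euc (d + 1) → ℂ), Measurable g → Integrable g →
      (∀ y, f y = locPoly d (δ • (y - c)) * g y) →
      ∫⁻ x in {x : Euc (d + 1) | ∀ i, |δ * (x i - c i)| ≤ 1}, ENNReal.ofReal (coneWeight α β x) *
          ∫⁻ t in Set.Icc (1 : ℝ) 2, ‖coneOp μ ψ t f x‖ₑ ^ 2 ≤
        ENNReal.ofReal (C * coneFactor δ α β ^ 2) *
          (ENNReal.ofReal (boxWeight δ α β c) * ∫⁻ x, ‖g x‖ₑ ^ 2) := by
  have hd : 0 < d := by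
    rw [← Nat.cast_pos (α := ℝ)]; linarith
  have hC := exists_lintegral_tsum_gaussWeight_momentOp_le hα hαd hβ hβ1 hψ B
  choose C hC0 hC using hC
  obtain ⟨Cw, hCw, hw⟩ := exists_coneWeight_le hd hα hβ
  have hLC : 0 ≤ locConst d := by unfold locConst; positivity
  have hS0 : 0 ≤ ∑ _i : Fin (d + 1), ∑ k ∈ Finset.range (2 * (d + 1) + 1), C k :=
    Finset.sum_nonneg fun i _ => Finset.sum_nonneg fun k _ => hC0 k
  refine ⟨Cw * locConst d * ∑ _i : Fin (d + 1), ∑ k ∈ Finset.range (2 * (d + 1) + 1), C k,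
    by positivity, fun δ hδ hδ' μ hμ c f g hgm hg hfg => ?_⟩
  -- One centre `a` serves the whole box, so the majorant `G` is a fixed function and the integral
  -- over the box may be enlarged to the whole space once the weight has been replaced by it.
  obtain ⟨a, ha⟩ := hw δ hδ c
  have hmeas : ∀ i k, Measurable fun p : ℝ × Euc (d + 1) =>
      ‖momentOp δ μ ψ i k g p.1 p.2‖ₑ ^ 2 := fun i k =>
    (measurable_momentOp hμ hψ i k hgm).enorm.pow_const 2
  have hmeasx : ∀ i k, Measurable fun x =>
      ∫⁻ t in Set.Icc (1 : ℝ) 2, ‖momentOp δ μ ψ i k g t x‖ₑ ^ 2 := fun i k =>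
    (hmeas i k).lintegral_prod_left'
  set G : Euc (d + 1) → ℝ≥0∞ := fun x => ∑' p : ℕ × ℕ,
    ENNReal.ofReal (dyadCoeff α p.1 * dyadCoeff β p.2) *
      ENNReal.ofReal (gaussWeight (coneScale d (δ * 2 ^ p.1) (δ * 2 ^ p.2)) a x) with hG
  have hGm : Measurable G := Measurable.tsum fun p =>
    ((continuous_gaussWeight _ a).measurable.ennreal_ofReal).const_mul _
  have hGS : ∀ i k, Measurable fun x =>
      G x * ∫⁻ t in Set.Icc (1 : ℝ) 2, ‖momentOp δ μ ψ i k g t x‖ₑ ^ 2 := fun i k =>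
    hGm.mul (hmeasx i k)
  have hbw := (boxWeight_pos hδ α β c).le
  have hbox : MeasurableSet {x : Euc (d + 1) | ∀ i, |δ * (x i - c i)| ≤ 1} := by
    have : {x : Euc (d + 1) | ∀ i, |δ * (x i - c i)| ≤ 1} =
        ⋂ i, {x : Euc (d + 1) | |δ * (x i - c i)| ≤ 1} := by ext; simp
    rw [this]
    exact MeasurableSet.iInter fun i =>
      (isClosed_le (by fun_prop) continuous_const).measurableSet
  have hpt : ∀ x ∈ {x : Euc (d + 1) | ∀ i, |δ * (x i - c i)| ≤ 1},
      ENNReal.ofReal (coneWeight α β x) * ∫⁻ t in Set.Icc (1 : ℝ) 2, ‖coneOp μ ψ t f x‖ₑ ^ 2 ≤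
      (ENNReal.ofReal (Cw * boxWeight δ α β c) * ENNReal.ofReal (locConst d)) *
        ∑ i, ∑ k ∈ Finset.range (2 * (d + 1) + 1),
          G x * ∫⁻ t in Set.Icc (1 : ℝ) 2, ‖momentOp δ μ ψ i k g t x‖ₑ ^ 2 := by
    intro x hx
    have hx' : ∀ i, |x i - c i| ≤ 1 / δ := fun i => by
      have := hx i
      rw [abs_mul, abs_of_pos hδ] at this
      rw [le_div_iff₀ hδ]
      linarith
    have h1 : ∫⁻ t in Set.Icc (1 : ℝ) 2, ‖coneOp μ ψ t f x‖ₑ ^ 2 ≤ ENNReal.ofReal (locConst d) *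
        ∑ i, ∑ k ∈ Finset.range (2 * (d + 1) + 1),
          ∫⁻ t in Set.Icc (1 : ℝ) 2, ‖momentOp δ μ ψ i k g t x‖ₑ ^ 2 := by
      have hmt : ∀ i k, Measurable fun t => ‖momentOp δ μ ψ i k g t x‖ₑ ^ 2 := fun i k =>
        ((measurable_momentOp hμ hψ i k hgm).of_uncurry_right (f := momentOp δ μ ψ i k g)
          ).enorm.pow_const 2
      calc _ ≤ ∫⁻ t in Set.Icc (1 : ℝ) 2, ENNReal.ofReal (locConst d) *
            ∑ i, ∑ k ∈ Finset.range (2 * (d + 1) + 1), ‖momentOp δ μ ψ i k g t x‖ₑ ^ 2 :=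
            setLIntegral_mono' measurableSet_Icc fun t ht =>
              enorm_coneOp_sq_le ht hμ hψ hg hfg hx
        _ = _ := by
            rw [lintegral_const_mul' _ _ ENNReal.ofReal_ne_top, lintegral_finsetSum _
              fun i _ => Finset.measurable_fun_sum _ fun k _ => hmt i k]
            congr 1
            refine Finset.sum_congr rfl fun i _ => ?_
            rw [lintegral_finsetSum _ fun k _ => hmt i k]
    calc _ ≤ (ENNReal.ofReal (Cw * boxWeight δ α β c) * G x) * (ENNReal.ofReal (locConst d) *
        ∑ i, ∑ k ∈ Finset.range (2 * (d + 1) + 1),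
          ∫⁻ t in Set.Icc (1 : ℝ) 2, ‖momentOp δ μ ψ i k g t x‖ₑ ^ 2) :=
          mul_le_mul' (ha x hx') h1
      _ = _ := by
          simp_rw [← Finset.mul_sum]
          ring
  calc _ ≤ ∫⁻ x in {x : Euc (d + 1) | ∀ i, |δ * (x i - c i)| ≤ 1},
        (ENNReal.ofReal (Cw * boxWeight δ α β c) * ENNReal.ofReal (locConst d)) *
        ∑ i, ∑ k ∈ Finset.range (2 * (d + 1) + 1),
          G x * ∫⁻ t in Set.Icc (1 : ℝ) 2, ‖momentOp δ μ ψ i k g t x‖ₑ ^ 2 :=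
        setLIntegral_mono' hbox hpt
    _ ≤ ∫⁻ x, (ENNReal.ofReal (Cw * boxWeight δ α β c) * ENNReal.ofReal (locConst d)) *
        ∑ i, ∑ k ∈ Finset.range (2 * (d + 1) + 1),
          G x * ∫⁻ t in Set.Icc (1 : ℝ) 2, ‖momentOp δ μ ψ i k g t x‖ₑ ^ 2 :=
        setLIntegral_le_lintegral _ _
    _ = (ENNReal.ofReal (Cw * boxWeight δ α β c) * ENNReal.ofReal (locConst d)) *
        ∑ i, ∑ k ∈ Finset.range (2 * (d + 1) + 1),
          ∫⁻ x, G x * ∫⁻ t in Set.Icc (1 : ℝ) 2, ‖momentOp δ μ ψ i k g t x‖ₑ ^ 2 := by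
        rw [lintegral_const_mul' _ _ (by finiteness), lintegral_finsetSum _
          fun i _ => Finset.measurable_fun_sum _ fun k _ => hGS i k]
        congr 1
        refine Finset.sum_congr rfl fun i _ => ?_
        rw [lintegral_finsetSum _ fun k _ => hGS i k]
    _ ≤ (ENNReal.ofReal (Cw * boxWeight δ α β c) * ENNReal.ofReal (locConst d)) *
        ∑ _i : Fin (d + 1), ∑ k ∈ Finset.range (2 * (d + 1) + 1),
          ENNReal.ofReal (C k * coneFactor δ α β ^ 2) * ∫⁻ x, ‖g x‖ₑ ^ 2 := by
        refine mul_le_mul' le_rfl (Finset.sum_le_sum fun i _ => Finset.sum_le_sum fun k _ => ?_)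
        exact hC k δ hδ hδ' μ hμ g hgm hg i a
    _ = _ := by
        have hsum : ∑ _i : Fin (d + 1), ∑ k ∈ Finset.range (2 * (d + 1) + 1),
            ENNReal.ofReal (C k * coneFactor δ α β ^ 2) = ENNReal.ofReal
            ((∑ _i : Fin (d + 1), ∑ k ∈ Finset.range (2 * (d + 1) + 1), C k) *
              coneFactor δ α β ^ 2) := by
          have h0 : ∀ k, 0 ≤ C k * coneFactor δ α β ^ 2 := fun k =>
            mul_nonneg (hC0 k) (sq_nonneg _)
          simp_rw [Finset.sum_mul]
          rw [ENNReal.ofReal_sum_of_nonneg fun i _ => Finset.sum_nonneg fun k _ => h0 k]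
          refine Finset.sum_congr rfl fun i _ => ?_
          rw [ENNReal.ofReal_sum_of_nonneg fun k _ => h0 k]
        simp_rw [← Finset.sum_mul]
        rw [hsum]
        generalize ∑ _i : Fin (d + 1), ∑ k ∈ Finset.range (2 * (d + 1) + 1), C k = S at hS0 ⊢
        rw [mul_assoc _ S, ENNReal.ofReal_mul (q := S * _) (by positivity),
          ENNReal.ofReal_mul (q := locConst d) hCw.le,
          ENNReal.ofReal_mul (q := boxWeight δ α β c) hCw.le]
        ring

end Localization

/-! ### Decay of the localising weight, and integration over box centres -/

section Averaging

variable {d : ℕ}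

theorem norm_le_mul_of_forall_abs_le {z : Euc (d + 1)} {M : ℝ} (hM : ∀ i, |z i| ≤ M) :
    ‖z‖ ≤ (d + 1) * M := by
  have hM0 : 0 ≤ M := (abs_nonneg _).trans (hM 0)
  refine abs_le_of_sq_le_sq' ?_ (by positivity) |>.2
  rw [EuclideanSpace.real_norm_sq_eq]
  calc ∑ i, z i ^ 2 ≤ ∑ _i : Fin (d + 1), M ^ 2 := by
        refine Finset.sum_le_sum fun i _ => ?_
        rw [← sq_abs]
        gcongr
        exact hM i
    _ = (d + 1) * M ^ 2 := by simp
    _ ≤ ((d + 1) * M) ^ 2 := by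
        have : (0 : ℝ) ≤ d := d.cast_nonneg
        nlinarith [mul_nonneg this (sq_nonneg M), mul_nonneg (mul_nonneg this this) (sq_nonneg M)]

/-- The largest coordinate controls the norm up to a dimensional factor, and its even power is one
of the nonnegative summands of `locPoly`. -/
theorem one_add_norm_pow_le_locPoly (z : Euc (d + 1)) :
    (1 + ‖z‖) ^ (2 * (d + 1)) ≤ (d + 2) ^ (2 * (d + 1)) * locPoly d z := by
  obtain ⟨j, hj⟩ := Finite.exists_max fun i => |z i|
  have h1 := norm_le_mul_of_forall_abs_le hj
  have hd : (0 : ℝ) ≤ d := d.cast_nonneg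
  have h2 : 1 + ‖z‖ ≤ (d + 2) * max 1 |z j| := by
    have := le_max_left 1 |z j|
    have := le_max_right 1 |z j|
    nlinarith
  have heven : ∀ i, |z i| ^ (2 * (d + 1)) = z i ^ (2 * (d + 1)) := fun i =>
    (even_two_mul _).pow_abs _
  have hnn : ∀ i, 0 ≤ z i ^ (2 * (d + 1)) := fun i => by rw [← heven]; positivity
  have h3 : (max 1 |z j|) ^ (2 * (d + 1)) ≤ locPoly d z := by
    calc (max 1 |z j|) ^ (2 * (d + 1)) ≤ 1 + z j ^ (2 * (d + 1)) := by
          rcases max_cases 1 |z j| with ⟨h, _⟩ | ⟨h, _⟩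
          · rw [h, one_pow]; linarith [hnn j]
          · rw [h, heven]; linarith
      _ ≤ _ := Finset.single_le_sum (f := fun i => 1 + z i ^ (2 * (d + 1)))
        (fun i _ => by linarith [hnn i]) (Finset.mem_univ _)
  calc (1 + ‖z‖) ^ (2 * (d + 1)) ≤ ((d + 2) * max 1 |z j|) ^ (2 * (d + 1)) := by gcongr
    _ = (d + 2) ^ (2 * (d + 1)) * (max 1 |z j|) ^ (2 * (d + 1)) := mul_pow _ _ _
    _ ≤ _ := by gcongr

/-- The weight `(1 + |z|) ^ γ / P(z) ^ 2` coming from the localizing polynomial `P`. -/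
noncomputable def locTail (d : ℕ) (γ : ℝ) (z : Euc (d + 1)) : ℝ :=
  (1 + ‖z‖) ^ γ * (locPoly d z ^ 2)⁻¹

theorem locTail_nonneg (γ : ℝ) (z : Euc (d + 1)) : 0 ≤ locTail d γ z := by
  unfold locTail; positivity

theorem measurable_locTail (γ : ℝ) : Measurable (locTail d γ) := by
  have h := (continuous_locPoly (d := d)).measurable
  unfold locTail
  fun_prop

/-- With `n = d + 1`, the inverse square of `locPoly` decays like `(1 + |z|)^(-4n)`; after spending
`γ < n`, the exponent `-3n` remains and is integrable. -/
theorem lintegral_locTail_lt_top {γ : ℝ} (hγ : γ < d + 1) :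
    ∫⁻ z, ENNReal.ofReal (locTail d γ z) < ⊤ := by
  have hfin := finite_integral_one_add_norm (E := Euc (d + 1)) (μ := volume) (r := 3 * (d + 1))
    (by simp; linarith [(d.cast_nonneg : (0 : ℝ) ≤ d)])
  set A : ℝ := ((d + 2) ^ (2 * (d + 1))) ^ 2 with hA
  calc ∫⁻ z, ENNReal.ofReal (locTail d γ z)
      ≤ ∫⁻ z : Euc (d + 1), ENNReal.ofReal A *
          ENNReal.ofReal ((1 + ‖z‖) ^ (-(3 * ((d : ℝ) + 1)))) := by
        refine lintegral_mono fun z => ?_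
        rw [← ENNReal.ofReal_mul (by positivity)]
        refine ENNReal.ofReal_le_ofReal ?_
        have hz : 0 < 1 + ‖z‖ := by positivity
        have hp := one_le_locPoly z
        have h1 := one_add_norm_pow_le_locPoly z
        unfold locTail
        rw [← div_eq_mul_inv, div_le_iff₀ (by positivity)]
        have h2 : ((1 + ‖z‖) ^ (2 * (d + 1))) ^ 2 ≤ A * locPoly d z ^ 2 := by
          rw [hA, ← mul_pow]; gcongr
        have h3 : (1 + ‖z‖) ^ γ ≤ (1 + ‖z‖) ^ ((d : ℝ) + 1) :=
          Real.rpow_le_rpow_of_exponent_le (by linarith [norm_nonneg z]) hγ.le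
        calc (1 + ‖z‖) ^ γ ≤ (1 + ‖z‖) ^ ((d : ℝ) + 1) := h3
          _ = (1 + ‖z‖) ^ (-(3 * ((d : ℝ) + 1))) * ((1 + ‖z‖) ^ (2 * (d + 1))) ^ 2 := by
            rw [← pow_mul, ← Real.rpow_natCast (1 + ‖z‖), ← Real.rpow_add hz]
            congr 1
            push_cast
            ring
          _ ≤ (1 + ‖z‖) ^ (-(3 * ((d : ℝ) + 1))) * (A * locPoly d z ^ 2) := by gcongr
          _ = _ := by ring
    _ = ENNReal.ofReal A * ∫⁻ z : Euc (d + 1),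
          ENNReal.ofReal ((1 + ‖z‖) ^ (-(3 * ((d : ℝ) + 1)))) :=
        lintegral_const_mul' _ _ ENNReal.ofReal_ne_top
    _ < ⊤ := ENNReal.mul_lt_top ENNReal.ofReal_lt_top hfin

theorem lintegral_comp_smul {δ : ℝ} (hδ : 0 < δ) {φ : Euc (d + 1) → ℝ≥0∞} (hφ : Measurable φ) :
    ∫⁻ z, φ (δ • z) = ENNReal.ofReal (δ ^ (d + 1))⁻¹ * ∫⁻ z, φ z := by
  have h := Measure.map_addHaar_smul (volume : Measure (Euc (d + 1))) hδ.ne'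
  rw [← lintegral_map (μ := volume) hφ (measurable_const_smul δ), h, lintegral_smul_measure,
    smul_eq_mul, abs_of_pos (by positivity)]
  simp

theorem lintegral_comp_smul_sub_left {δ : ℝ} (hδ : 0 < δ) {φ : Euc (d + 1) → ℝ≥0∞}
    (hφ : Measurable φ) (x : Euc (d + 1)) :
    ∫⁻ c, φ (δ • (x - c)) = ENNReal.ofReal (δ ^ (d + 1))⁻¹ * ∫⁻ z, φ z := by
  rw [lintegral_sub_left_eq_self (fun z => φ (δ • z)) x, lintegral_comp_smul hδ hφ]

theorem lintegral_comp_smul_sub_right {δ : ℝ} (hδ : 0 < δ) {φ : Euc (d + 1) → ℝ≥0∞}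
    (hφ : Measurable φ) (c : Euc (d + 1)) :
    ∫⁻ y, φ (δ • (y - c)) = ENNReal.ofReal (δ ^ (d + 1))⁻¹ * ∫⁻ z, φ z := by
  rw [lintegral_sub_right_eq_self (fun z => φ (δ • z)) c, lintegral_comp_smul hδ hφ]

theorem ae_apply_ne_zero (i : Fin (d + 1)) : ∀ᵐ x : Euc (d + 1), x i ≠ 0 := by
  let p : Submodule ℝ (Euc (d + 1)) := LinearMap.ker (EuclideanSpace.proj (𝕜 := ℝ) i).toLinearMap
  have hp : p ≠ ⊤ := by
    intro h
    have : EuclideanSpace.single i (1 : ℝ) ∈ p := by rw [h]; trivial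
    simp [p] at this
  have h := Measure.addHaar_submodule volume p hp
  rw [ae_iff]
  convert h using 2
  ext x
  simp [p]

theorem ae_headPart_ne_zero (hd : 0 < d) : ∀ᵐ x : Euc (d + 1), headPart x ≠ 0 := by
  filter_upwards [ae_apply_ne_zero (Fin.castSucc (⟨0, hd⟩ : Fin d))] with x hx h
  exact hx (by simpa [headPart] using congrArg (fun v : Euc d => v ⟨0, hd⟩) h)

theorem ae_lastPart_ne_zero : ∀ᵐ x : Euc (d + 1), lastPart x ≠ 0 :=
  ae_apply_ne_zero (Fin.last d)

theorem coneWeight_nonneg (α β : ℝ) (x : Euc (d + 1)) : 0 ≤ coneWeight α β x := by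
  unfold coneWeight; positivity

theorem coneWeight_pos (α β : ℝ) {x : Euc (d + 1)} (hx : headPart x ≠ 0) (hx' : lastPart x ≠ 0) :
    0 < coneWeight α β x := by
  unfold coneWeight
  have := norm_pos_iff.2 hx
  have := abs_pos.2 hx'
  positivity

theorem measurable_coneWeight (α β : ℝ) : Measurable (coneWeight α β : Euc (d + 1) → ℝ) := by
  have hh := (continuous_headPart (d := d)).measurable
  have hl := (continuous_lastPart (d := d)).measurable
  unfold coneWeight
  exact (hh.norm.pow_const _).mul ((measurable_norm.comp hl).pow_const _)

theorem volume_box_pos : 0 < volume {z : Euc (d + 1) | ∀ i, |z i| ≤ 1} := by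
  refine (Metric.measure_ball_pos volume (0 : Euc (d + 1)) one_pos).trans_le (measure_mono ?_)
  intro z hz i
  rw [mem_ball_zero_iff] at hz
  exact (PiLp.norm_apply_le z i).trans hz.le

theorem volume_box_lt_top : volume {z : Euc (d + 1) | ∀ i, |z i| ≤ 1} < ⊤ := by
  refine (measure_mono fun z hz => ?_).trans_lt
    (measure_closedBall_lt_top (x := (0 : Euc (d + 1))) (r := (d + 1) * 1))
  rw [mem_closedBall_zero_iff]
  exact norm_le_mul_of_forall_abs_le hz

theorem measurableSet_box : MeasurableSet {z : Euc (d + 1) | ∀ i, |z i| ≤ 1} := by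
  have : {z : Euc (d + 1) | ∀ i, |z i| ≤ 1} = ⋂ i, {z : Euc (d + 1) | |z i| ≤ 1} := by ext; simp
  rw [this]
  exact MeasurableSet.iInter fun i => (isClosed_le (by fun_prop) continuous_const).measurableSet

end Averaging

/-! ### Averaging the box estimates and the conclusion -/

section MainEstimate

variable {d : ℕ} {δ α β : ℝ} {B : ℕ → ℝ} {μ : Euc d → ℂ} {ψ : ℝ → ℝ}

theorem enorm_eq_ofReal_norm_sq (z : ℂ) : ‖z‖ₑ ^ 2 = ENNReal.ofReal (‖z‖ ^ 2) := by
  rw [ENNReal.ofReal_pow (norm_nonneg _), ofReal_norm]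

/-- The quotient of `f` by the localizing polynomial centred at `c`. -/
noncomputable def locQuot (δ : ℝ) (f : Euc (d + 1) → ℂ) (c y : Euc (d + 1)) : ℂ :=
  ((locPoly d (δ • (y - c)))⁻¹ : ℝ) * f y

theorem locPoly_mul_locQuot (f : Euc (d + 1) → ℂ) (c y : Euc (d + 1)) :
    f y = locPoly d (δ • (y - c)) * locQuot δ f c y := by
  have h := one_le_locPoly (δ • (y - c))
  rw [locQuot, ← mul_assoc, ← Complex.ofReal_mul, mul_inv_cancel₀ (by positivity)]
  simp

theorem norm_locQuot (f : Euc (d + 1) → ℂ) (c y : Euc (d + 1)) :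
    ‖locQuot δ f c y‖ = (locPoly d (δ • (y - c)))⁻¹ * ‖f y‖ := by
  have h := one_le_locPoly (δ • (y - c))
  rw [locQuot, norm_mul, Complex.norm_real, Real.norm_of_nonneg (by positivity)]

theorem measurable_locQuot {f : Euc (d + 1) → ℂ} (hf : Measurable f) (c : Euc (d + 1)) :
    Measurable (locQuot δ f c) := by
  have h : Measurable fun y : Euc (d + 1) => locPoly d (δ • (y - c)) :=
    (continuous_locPoly.comp (by fun_prop)).measurable
  unfold locQuot
  exact (Complex.measurable_ofReal.comp h.inv).mul hf

theorem boxWeight_mul_norm_locQuot_sq_le (hδ : 0 < δ) (hα : 0 ≤ α) (hβ : 0 ≤ β)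
    (f : Euc (d + 1) → ℂ) (c : Euc (d + 1)) {y : Euc (d + 1)} (hy : headPart y ≠ 0)
    (hy' : lastPart y ≠ 0) :
    boxWeight δ α β c * ‖locQuot δ f c y‖ ^ 2 ≤
      coneWeight α β y * ‖f y‖ ^ 2 * locTail d (α + β) (δ • (y - c)) := by
  have h := boxWeight_le hδ hα hβ c y hy hy'
  rw [norm_locQuot, locTail, mul_pow, inv_pow]
  calc _ = boxWeight δ α β c * (((locPoly d (δ • (y - c)) ^ 2)⁻¹) * ‖f y‖ ^ 2) := rfl
    _ ≤ (coneWeight α β y * (1 + ‖δ • (y - c)‖) ^ (α + β)) *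
        (((locPoly d (δ • (y - c)) ^ 2)⁻¹) * ‖f y‖ ^ 2) := by gcongr
    _ = _ := by ring

/-- With `q = 1/P`, the inequality `q|f| ≤ w|f|² + w⁻¹q²` separates `f` from the inverse weight, and
`w⁻¹` grows only polynomially away from `c`. It makes the quotient integrable, hence the
convolutions absolutely convergent. -/
theorem norm_locQuot_le (hδ : 0 < δ) (hα : 0 ≤ α) (hβ : 0 ≤ β)
    (f : Euc (d + 1) → ℂ) (c : Euc (d + 1)) {y : Euc (d + 1)} (hy : headPart y ≠ 0)
    (hy' : lastPart y ≠ 0) :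
    ‖locQuot δ f c y‖ ≤ coneWeight α β y * ‖f y‖ ^ 2 +
      (boxWeight δ α β c)⁻¹ * locTail d (α + β) (δ • (y - c)) := by
  have h := boxWeight_le hδ hα hβ c y hy hy'
  have hb := boxWeight_pos hδ α β c
  have hw := coneWeight_pos α β hy hy'
  have hp := one_le_locPoly (δ • (y - c))
  rw [norm_locQuot, locTail]
  set w := coneWeight α β y
  set b := boxWeight δ α β c
  set q := (locPoly d (δ • (y - c)))⁻¹ with hq
  set T := (1 + ‖δ • (y - c)‖) ^ (α + β)
  have h1 : w⁻¹ ≤ b⁻¹ * T := by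
    rw [inv_le_iff_one_le_mul₀ hw, mul_assoc, ← div_eq_inv_mul, le_div_iff₀ hb, one_mul, mul_comm]
    exact h
  have h2 : w⁻¹ * q ^ 2 ≤ b⁻¹ * (T * q ^ 2) := by
    rw [← mul_assoc]; gcongr
  have h3 : q * ‖f y‖ ≤ w * ‖f y‖ ^ 2 + w⁻¹ * q ^ 2 := by
    have h4 : w * ‖f y‖ ^ 2 + w⁻¹ * q ^ 2 - q * ‖f y‖ =
        w * ((‖f y‖ - w⁻¹ * q / 2) ^ 2 + 3 / 4 * (w⁻¹ * q) ^ 2) := by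
      field_simp
      ring
    have : 0 ≤ w * ((‖f y‖ - w⁻¹ * q / 2) ^ 2 + 3 / 4 * (w⁻¹ * q) ^ 2) := by positivity
    linarith
  rw [← inv_pow]
  linarith

theorem integrable_locQuot (hd : 0 < d) (hδ : 0 < δ) (hα : 0 ≤ α) (hαd : α < d) (hβ : 0 ≤ β)
    (hβ1 : β < 1) {f : Euc (d + 1) → ℂ} (hf : Measurable f)
    (hfw : ∫⁻ y, ENNReal.ofReal (coneWeight α β y) * ‖f y‖ₑ ^ 2 < ⊤) (c : Euc (d + 1)) :
    Integrable (locQuot δ f c) := by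
  refine ⟨(measurable_locQuot hf c).aestronglyMeasurable, ?_⟩
  have hb := boxWeight_pos hδ α β c
  have hm := (measurable_locTail (d := d) (α + β)).ennreal_ofReal
  have hfm : Measurable fun y => ENNReal.ofReal (coneWeight α β y) * ‖f y‖ₑ ^ 2 :=
    (measurable_coneWeight α β).ennreal_ofReal.mul (hf.enorm.pow_const 2)
  calc ∫⁻ y, ‖locQuot δ f c y‖ₑ ≤ ∫⁻ y, (ENNReal.ofReal (coneWeight α β y) * ‖f y‖ₑ ^ 2 +
        ENNReal.ofReal (boxWeight δ α β c)⁻¹ *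
          ENNReal.ofReal (locTail d (α + β) (δ • (y - c)))) := by
        refine lintegral_mono_ae ?_
        filter_upwards [ae_headPart_ne_zero hd, ae_lastPart_ne_zero] with y hy hy'
        have hw := coneWeight_nonneg α β y
        have ht := locTail_nonneg (d := d) (α + β) (δ • (y - c))
        rw [enorm_eq_ofReal_norm_sq, ← ENNReal.ofReal_mul hw, ← ENNReal.ofReal_mul (by positivity),
          ← ENNReal.ofReal_add (by positivity) (by positivity), ← ofReal_norm]
        exact ENNReal.ofReal_le_ofReal (norm_locQuot_le hδ hα hβ f c hy hy')
    _ = (∫⁻ y, ENNReal.ofReal (coneWeight α β y) * ‖f y‖ₑ ^ 2) +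
        ENNReal.ofReal (boxWeight δ α β c)⁻¹ * (ENNReal.ofReal (δ ^ (d + 1))⁻¹ *
          ∫⁻ z, ENNReal.ofReal (locTail d (α + β) z)) := by
        rw [lintegral_add_left hfm, lintegral_const_mul' _ _ ENNReal.ofReal_ne_top,
          lintegral_comp_smul_sub_right hδ hm]
    _ < ⊤ := by
        have h1 := lintegral_locTail_lt_top (d := d) (γ := α + β) (by linarith)
        exact ENNReal.add_lt_top.2 ⟨hfw, ENNReal.mul_lt_top ENNReal.ofReal_lt_top
          (ENNReal.mul_lt_top ENNReal.ofReal_lt_top h1)⟩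

theorem measurable_lintegral_coneOp (hμ : IsAnnularCutoff δ B μ) (hψ : IsDyadicBump ψ)
    {f : Euc (d + 1) → ℂ} (hf : Measurable f) :
    Measurable fun x => ∫⁻ t in Set.Icc (1 : ℝ) 2, ‖coneOp μ ψ t f x‖ₑ ^ 2 := by
  -- The moment of order `k = 0` is the original operator, whatever the coordinate.
  have h1 : ∀ t x, momentOp δ μ ψ 0 0 f t x = coneOp μ ψ t f x := fun t x => by
    simp [momentOp, coneOp, momentKernel]
  have h2 : Measurable fun p : ℝ × Euc (d + 1) => ‖momentOp δ μ ψ 0 0 f p.1 p.2‖ₑ ^ 2 :=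
    (measurable_momentOp hμ hψ 0 0 hf).enorm.pow_const 2
  simp_rw [← h1]
  exact h2.lintegral_prod_left'

/-- The weighted estimate for measurable functions, obtained by averaging the estimates on boxes
over their centres. -/
theorem exists_lintegral_coneWeight_coneOp_le (hα : 0 ≤ α) (hαd : α < d) (hβ : 0 ≤ β)
    (hβ1 : β < 1) (hψ : IsDyadicBump ψ) (B : ℕ → ℝ) :
    ∃ C : ℝ, 0 ≤ C ∧ ∀ δ : ℝ, 0 < δ → δ ≤ 1 / 2 → ∀ μ : Euc d → ℂ, IsAnnularCutoff δ B μ →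
      ∀ f : Euc (d + 1) → ℂ, Measurable f →
      ∫⁻ y, ENNReal.ofReal (coneWeight α β y) * ‖f y‖ₑ ^ 2 < ⊤ →
      ∫⁻ x, ENNReal.ofReal (coneWeight α β x) *
          ∫⁻ t in Set.Icc (1 : ℝ) 2, ‖coneOp μ ψ t f x‖ₑ ^ 2 ≤
        ENNReal.ofReal (C * coneFactor δ α β ^ 2) *
          ∫⁻ y, ENNReal.ofReal (coneWeight α β y) * ‖f y‖ₑ ^ 2 := by
  have hd : 0 < d := by
    rw [← Nat.cast_pos (α := ℝ)]; linarith
  obtain ⟨C, hC, hbox⟩ := exists_lintegral_box_le hα hαd hβ hβ1 hψ B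
  set V := volume {z : Euc (d + 1) | ∀ i, |z i| ≤ 1} with hV
  set I := ∫⁻ z, ENNReal.ofReal (locTail d (α + β) z) with hI
  have hV0 : V ≠ 0 := volume_box_pos.ne'
  have hVt : V ≠ ⊤ := volume_box_lt_top.ne
  have hIt : I ≠ ⊤ := (lintegral_locTail_lt_top (by linarith)).ne
  refine ⟨C * (I / V).toReal, by positivity, fun δ hδ hδ' μ hμ f hf hfw => ?_⟩
  set D := ENNReal.ofReal (δ ^ (d + 1))⁻¹ with hD
  have hD0 : D ≠ 0 := by
    rw [hD, ne_eq, ENNReal.ofReal_eq_zero, not_le]; positivity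
  have hDt : D ≠ ⊤ := ENNReal.ofReal_ne_top
  have hwm := (measurable_coneWeight (d := d) α β).ennreal_ofReal
  set S : Euc (d + 1) → ℝ≥0∞ := fun x => ENNReal.ofReal (coneWeight α β x) *
    ∫⁻ t in Set.Icc (1 : ℝ) 2, ‖coneOp μ ψ t f x‖ₑ ^ 2 with hS
  have hSm : Measurable S := hwm.mul (measurable_lintegral_coneOp hμ hψ hf)
  set F : Euc (d + 1) → ℝ≥0∞ := fun y => ENNReal.ofReal (coneWeight α β y) * ‖f y‖ₑ ^ 2 with hF
  have hFm : Measurable F := hwm.mul (hf.enorm.pow_const 2)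
  set χ : Euc (d + 1) → ℝ≥0∞ := Set.indicator {z | ∀ i, |z i| ≤ 1} 1 with hχ
  have hχm : Measurable χ := measurable_one.indicator measurableSet_box
  have hJm := (measurable_locTail (d := d) (α + β)).ennreal_ofReal
  have hsub : Measurable fun q : Euc (d + 1) × Euc (d + 1) => δ • (q.2 - q.1) :=
    (by fun_prop : Continuous fun q : Euc (d + 1) × Euc (d + 1) => δ • (q.2 - q.1)).measurable
  -- Each `x` lies in the box around `c` for a set of centres of measure `D * V`. The right-hand
  -- side acquires the same factor `D = δ^(-n)`, which cancels in `hkey`, leaving `I / V`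
  -- independent of `δ`.
  have hleft : ∫⁻ c, ∫⁻ x, χ (δ • (x - c)) * S x = D * V * ∫⁻ x, S x := by
    rw [lintegral_lintegral_swap ((hχm.comp hsub).mul (hSm.comp measurable_snd)).aemeasurable,
      ← lintegral_const_mul' _ _ (ENNReal.mul_ne_top hDt hVt)]
    refine lintegral_congr fun x => ?_
    have hm : Measurable fun c => χ (δ • (x - c)) := hχm.comp (hsub.comp measurable_prodMk_right)
    rw [lintegral_mul_const _ hm, lintegral_comp_smul_sub_left hδ hχm, hχ,
      lintegral_indicator_one measurableSet_box]
  have hright : ∫⁻ c, ∫⁻ y, F y * ENNReal.ofReal (locTail d (α + β) (δ • (y - c))) =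
      D * I * ∫⁻ y, F y := by
    rw [lintegral_lintegral_swap ((hFm.comp measurable_snd).mul (hJm.comp hsub)).aemeasurable,
      ← lintegral_const_mul' _ _ (ENNReal.mul_ne_top hDt hIt)]
    refine lintegral_congr fun y => ?_
    have hm : Measurable fun c => ENNReal.ofReal (locTail d (α + β) (δ • (y - c))) :=
      hJm.comp (hsub.comp measurable_prodMk_right)
    rw [lintegral_const_mul _ hm, lintegral_comp_smul_sub_left hδ hJm,
      mul_comm]
  have hpt : ∀ c, ∫⁻ x, χ (δ • (x - c)) * S x ≤ ENNReal.ofReal (C * coneFactor δ α β ^ 2) *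
      ∫⁻ y, F y * ENNReal.ofReal (locTail d (α + β) (δ • (y - c))) := by
    intro c
    have hset : MeasurableSet {x : Euc (d + 1) | ∀ i, |δ * (x i - c i)| ≤ 1} :=
      (by fun_prop : Continuous fun x : Euc (d + 1) => δ • (x - c)).measurable measurableSet_box
    have h1 : ∫⁻ x, χ (δ • (x - c)) * S x =
        ∫⁻ x in {x : Euc (d + 1) | ∀ i, |δ * (x i - c i)| ≤ 1}, S x := by
      rw [← lintegral_indicator hset]
      refine lintegral_congr fun x => ?_
      by_cases h : ∀ i, |δ * (x i - c i)| ≤ 1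
      · rw [hχ, Set.indicator_of_mem (show δ • (x - c) ∈ {z : Euc (d + 1) | ∀ i, |z i| ≤ 1} from h),
          Set.indicator_of_mem (show x ∈ {x : Euc (d + 1) | ∀ i, |δ * (x i - c i)| ≤ 1} from h),
          Pi.one_apply, one_mul]
      · rw [hχ, Set.indicator_of_notMem
            (show δ • (x - c) ∉ {z : Euc (d + 1) | ∀ i, |z i| ≤ 1} from h),
          Set.indicator_of_notMem
            (show x ∉ {x : Euc (d + 1) | ∀ i, |δ * (x i - c i)| ≤ 1} from h), zero_mul]
    rw [h1]
    refine (hbox δ hδ hδ' μ hμ c f (locQuot δ f c) (measurable_locQuot hf c)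
      (integrable_locQuot hd hδ hα hαd hβ hβ1 hf hfw c) (locPoly_mul_locQuot f c)).trans ?_
    refine mul_le_mul' le_rfl ?_
    rw [← lintegral_const_mul' _ _ ENNReal.ofReal_ne_top]
    refine lintegral_mono_ae ?_
    filter_upwards [ae_headPart_ne_zero hd, ae_lastPart_ne_zero] with y hy hy'
    have hw := coneWeight_nonneg α β y
    simp only [hF]
    rw [enorm_eq_ofReal_norm_sq, enorm_eq_ofReal_norm_sq, ← ENNReal.ofReal_mul hw,
      ← ENNReal.ofReal_mul (boxWeight_pos hδ α β c).le, ← ENNReal.ofReal_mul (by positivity)]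
    exact ENNReal.ofReal_le_ofReal (boxWeight_mul_norm_locQuot_sq_le hδ hα hβ f c hy hy')
  have hkey : D * (V * ∫⁻ x, S x) ≤
      D * (ENNReal.ofReal (C * coneFactor δ α β ^ 2) * (I * ∫⁻ y, F y)) := by
    calc D * (V * ∫⁻ x, S x) = ∫⁻ c, ∫⁻ x, χ (δ • (x - c)) * S x := by rw [hleft, mul_assoc]
      _ ≤ ∫⁻ c, ENNReal.ofReal (C * coneFactor δ α β ^ 2) *
          ∫⁻ y, F y * ENNReal.ofReal (locTail d (α + β) (δ • (y - c))) := lintegral_mono hpt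
      _ = _ := by
        rw [lintegral_const_mul' _ _ ENNReal.ofReal_ne_top, hright]
        ring
  rw [ENNReal.mul_le_mul_iff_right hD0 hDt] at hkey
  have hIV : ENNReal.ofReal (I / V).toReal = I / V :=
    ENNReal.ofReal_toReal (ENNReal.div_ne_top hIt hV0)
  calc ∫⁻ x, S x ≤ (ENNReal.ofReal (C * coneFactor δ α β ^ 2) * (I * ∫⁻ y, F y)) / V := by
        rw [ENNReal.le_div_iff_mul_le (.inl hV0) (.inl hVt), mul_comm]
        exact hkey
    _ = _ := by
        rw [mul_right_comm C, ENNReal.ofReal_mul (q := (I / V).toReal) (by positivity), hIV]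
        simp only [div_eq_mul_inv]
        ring

/-- On `[1, 2]` one has `dt/t ≤ dt`. -/
theorem localSquareFn_sq_le (μ : Euc d → ℂ) (ψ : ℝ → ℝ) (f : Euc (d + 1) → ℂ) (x : Euc (d + 1)) :
    localSquareFn μ ψ f x ^ 2 ≤ ∫⁻ t in Set.Icc (1 : ℝ) 2, ‖coneOp μ ψ t f x‖ₑ ^ 2 := by
  rw [localSquareFn, ← ENNReal.rpow_natCast, ← ENNReal.rpow_mul]
  norm_num
  refine setLIntegral_mono' measurableSet_Icc fun t ht => ?_
  refine ENNReal.div_le_of_le_mul ?_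
  calc ‖coneOp μ ψ t f x‖ₑ ^ 2 = ‖coneOp μ ψ t f x‖ₑ ^ 2 * 1 := (mul_one _).symm
    _ ≤ _ := by
      gcongr
      rw [ENNReal.one_le_ofReal]
      exact ht.1

theorem lintegral_coneWeightMeasure (α β : ℝ) (F : Euc (d + 1) → ℝ≥0∞) :
    ∫⁻ x, F x ∂coneWeightMeasure d α β = ∫⁻ x, ENNReal.ofReal (coneWeight α β x) * F x := by
  rw [coneWeightMeasure, lintegral_withDensity_eq_lintegral_mul_non_measurable _
    (measurable_coneWeight α β).ennreal_ofReal (by simp)]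
  rfl

/-- The weight is positive off the null sets `x' = 0` and `x_n = 0`, where real powers may take the
value zero. -/
theorem volume_absolutelyContinuous_coneWeightMeasure (hd : 0 < d) (α β : ℝ) :
    (volume : Measure (Euc (d + 1))) ≪ coneWeightMeasure d α β := by
  refine withDensity_absolutelyContinuous' (measurable_coneWeight α β).ennreal_ofReal.aemeasurable ?_
  filter_upwards [ae_headPart_ne_zero hd, ae_lastPart_ne_zero] with y hy hy'
  rw [ne_eq, ENNReal.ofReal_eq_zero, not_le]
  exact coneWeight_pos α β hy hy'

theorem eLpNorm_two_sq {X ε : Type*} [MeasurableSpace X] [ENorm ε] (ν : Measure X) (F : X → ε) :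
    eLpNorm F 2 ν ^ 2 = ∫⁻ x, ‖F x‖ₑ ^ 2 ∂ν := by
  rw [eLpNorm_eq_lintegral_rpow_enorm_toReal (by norm_num) (by norm_num), ← ENNReal.rpow_natCast,
    ← ENNReal.rpow_mul]
  norm_num

end MainEstimate

theorem theorem113 (d : ℕ) :
    ∃ δ₀ : ℝ, 0 < δ₀ ∧ δ₀ < 1 ∧
      ∀ α β : ℝ, 0 ≤ α → α < d → 0 ≤ β → β < 1 →
      ∀ ψ : ℝ → ℝ, IsDyadicBump ψ →
      ∀ B : ℕ → ℝ,
      ∃ C : ℝ, 0 < C ∧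
        ∀ δ : ℝ, 0 < δ → δ < δ₀ →
        ∀ μ : Euc d → ℂ, IsAnnularCutoff δ B μ →
        ∀ f : Euc (d + 1) → ℂ, MemLp f 2 (coneWeightMeasure d α β) →
          (∀ t ∈ Set.Icc (1 : ℝ) 2, ∀ x : Euc (d + 1),
            Integrable (fun y => coneKernel μ ψ t (x - y) * f y)) ∧
          eLpNorm (localSquareFn μ ψ f) 2 (coneWeightMeasure d α β) ≤
            ENNReal.ofReal (C * coneFactor δ α β) *
              eLpNorm f 2 (coneWeightMeasure d α β) := by
  refine ⟨1 / 2, by norm_num, by norm_num, fun α β hα hαd hβ hβ1 ψ hψ B => ?_⟩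
  -- The case `d = 0` is vacuous, as `0 ≤ α < d`.
  have hd : 0 < d := by
    rw [← Nat.cast_pos (α := ℝ)]; linarith
  obtain ⟨C, hC, hmain⟩ := exists_lintegral_coneWeight_coneOp_le hα hαd hβ hβ1 hψ B
  -- The estimate is proved for squares, hence the root; the added one makes the constant positive
  -- even when `C = 0`.
  refine ⟨√C + 1, by positivity, fun δ hδ hδ' μ hμ f hf => ?_⟩
  -- The function `f` is only almost everywhere measurable for the weighted measure. Its measurable
  -- representative agrees with it almost everywhere for Lebesgue measure too, so all convolutions
  -- coincide at every point.
  set g := hf.1.mk f with hg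
  have hgm : Measurable g := hf.1.stronglyMeasurable_mk.measurable
  have hfgν : f =ᵐ[coneWeightMeasure d α β] g := hf.1.ae_eq_mk
  have hfg : f =ᵐ[volume] g :=
    (volume_absolutelyContinuous_coneWeightMeasure hd α β).ae_le hfgν
  have hmul : ∀ t x, (fun y => coneKernel μ ψ t (x - y) * f y) =ᵐ[volume]
      fun y => coneKernel μ ψ t (x - y) * g y := fun t x => by
    filter_upwards [hfg] with y hy
    rw [hy]
  have hop : ∀ t, coneOp μ ψ t f = coneOp μ ψ t g := fun t => by
    funext x
    exact integral_congr_ae (hmul t x)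
  have hnorm : eLpNorm f 2 (coneWeightMeasure d α β) ^ 2 =
      ∫⁻ y, ENNReal.ofReal (coneWeight α β y) * ‖g y‖ₑ ^ 2 := by
    rw [eLpNorm_congr_ae hfgν, eLpNorm_two_sq, lintegral_coneWeightMeasure]
  have hfin : ∫⁻ y, ENNReal.ofReal (coneWeight α β y) * ‖g y‖ₑ ^ 2 < ⊤ := by
    rw [← hnorm]
    exact ENNReal.pow_lt_top hf.2
  refine ⟨fun t ht x => ?_, ?_⟩
  · exact (integrable_coneKernel_mul ht hμ hψ
      (integrable_locQuot hd hδ hα hαd hβ hβ1 hgm hfin 0) (locPoly_mul_locQuot g 0) x).congr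
      (hmul t x).symm
  have hcF := coneFactor_nonneg hδ hδ'.le α β
  rw [← ENNReal.pow_le_pow_left_iff two_ne_zero, mul_pow, hnorm, eLpNorm_two_sq,
    lintegral_coneWeightMeasure]
  calc _ ≤ ∫⁻ x, ENNReal.ofReal (coneWeight α β x) *
        ∫⁻ t in Set.Icc (1 : ℝ) 2, ‖coneOp μ ψ t g x‖ₑ ^ 2 := by
        refine lintegral_mono fun x => ?_
        gcongr
        simp_rw [← hop]
        exact localSquareFn_sq_le μ ψ f x
    _ ≤ ENNReal.ofReal (C * coneFactor δ α β ^ 2) *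
        ∫⁻ y, ENNReal.ofReal (coneWeight α β y) * ‖g y‖ₑ ^ 2 := hmain δ hδ hδ'.le μ hμ g hgm hfin
    _ ≤ _ := by
        gcongr
        rw [← ENNReal.ofReal_pow (by positivity), mul_pow]
        refine ENNReal.ofReal_le_ofReal ?_
        gcongr
        nlinarith [Real.sq_sqrt hC, Real.sqrt_nonneg C]
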